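/- Let $B:\mathbb{R}^2\to\mathbb{R}$ satisfy $B\in L^p_{\rm loc}(\mathbb{R}^2)$ for some $p>2$ and $|B(x)|=\mathcal{O}(|x|^{-\tau})$ as $|x|\to\infty$ for some $\tau>2$, and let $A=(A_1,A_2)\in L^\infty(\mathbb{R}^2;\mathbb{R}^2)$ satisfy $\partial_1A_2-\partial_2A_1=B$ in the sense of distributions. Put $$\alpha=\frac1{2\pi}\int_{\mathbb{R}^2}B\,dx,\qquad h(x)=-\frac1{2\pi}\int_{\mathbb{R}^2}B(y)\log|x-y|\,dy,\qquad \mu_\alpha=\min_{m\in\mathbb{Z}}|m-\alpha| .$$ For $\rho>0$ let $g_+(\rho;r)=1$ if $r\le\rho$ and $g_+(\rho;r)=\rho^{-\alpha}r^{\alpha}$ if $r>\rho$, let $g_-=1/g_+$, and $$k_\pm(\rho)=\inf_{x\in\mathbb{R}^2}\frac{e^{\mp h(x)}}{g_\pm(\rho;|x|)},\qquad K_\pm(\rho)=\sup_{x\in\mathbb{R}^2}\frac{e^{\mp h(x)}}{g_\pm(\rho;|x|)},\qquad \beta_\pm(B;\rho)=\Big(\frac{k_\pm(\rho)}{K_\pm(\rho)}\Big)^2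 ,$$ $$\mathrm{w}_\pm(\rho;x)=\beta_\pm(B;\rho)\cdot\begin{cases}\dfrac{\mu_\alpha^2}{\rho^2+|x|^2}, & \alpha\notin\mathbb{Z},\\[2ex] \dfrac{|\alpha|}{4|\alpha|+\pi}\,\dfrac{1}{\rho^2+|x|^2\big(1+\log^2(|x|/\rho)\big)}, & \alpha\in\mathbb{Z}.\end{cases}$$ Let $\mathcal W(\rho;x)=\begin{pmatrix}\mathrm{w}_+(\rho;x)&0\\0&0\end{pmatrix}$ if $\alpha\ge0$ and $\mathcal W(\rho;x)=\begin{pmatrix}0&0\\0&\mathrm{w}_-(\rho;x)\end{pmatrix}$ if $\alpha\le0$ (both are zero if $\alpha=0$). Then the integrals defining $\alpha$ and $h(x)$, $x\in\mathbb{R}^2$, converge absolutely, $0<k_\pm(\rho)\le K_\pm(\rho)<\infty$ for every $\rho>0$, and for every $\rho>0$ the Pauli operator $P(A)=\begin{pmatrix}(i\nabla+A)^2+B&0\\0&(i\nabla+A)^2-B\end{pmatrix}$ satisfies $$P(A)\ \ge\ \mathcal W(\rho;\cdot)$$ in the sense of quadratic forms on $H^1(\mathbb{R}^2;\mathbb{C}^2)$.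 That is, for every $u=(u_+,u_-)\in H^1(\mathbb{R}^2;\mathbb{C}^2)$ the integrands below are integrable and $$\int_{\mathbb{R}^2}\Big(|(i\nabla+A)u_+|^2+B|u_+|^2+|(i\nabla+A)u_-|^2-B|u_-|^2\Big)dx\ \ge\ \int_{\mathbb{R}^2}\langle u,\mathcal W(\rho;x)u\rangle_{\mathbb{C}^2}\,dx .$$ -/

import Mathlib

open MeasureTheory Set Filter
open scoped ENNReal ContDiff

noncomputable section

namespace PauliHardy

/-- The Euclidean plane. -/
abbrev Plane : Type := EuclideanSpace ℝ (Fin 2)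

/-- The space of spinors, i.e. complex two-vectors; index `0` is spin up and `1` is spin down. -/
abbrev Spinor : Type := EuclideanSpace ℂ (Fin 2)

/-- Real-valued smooth compactly supported test functions on the plane. -/
structure IsTest (φ : Plane → ℝ) : Prop where
  smooth : ContDiff ℝ ∞ φ
  compact : HasCompactSupport φ

/-- The classical partial derivative of a differentiable function in the `j`-th direction. -/
def partialDeriv (j : Fin 2) (φ : Plane → ℝ) (x : Plane) : ℝ :=
  fderiv ℝ φ x (EuclideanSpace.single j 1)

/-- `u ∈ H¹(ℝ²; F)` with weak partial derivatives `D 0`, `D 1`: the function and its weak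
partial derivatives are square integrable. -/
structure IsH1 {F : Type*} [NormedAddCommGroup F] [NormedSpace ℝ F]
    (u : Plane → F) (D : Fin 2 → Plane → F) : Prop where
  memLp : MemLp u 2 volume
  memLp_deriv : ∀ j, MemLp (D j) 2 volume
  weakDeriv : ∀ j, ∀ φ : Plane → ℝ, IsTest φ →
    ∫ x, partialDeriv j φ x • u x = - ∫ x, φ x • D j x

/-- The standing assumption on the magnetic field: `B ∈ L^p_loc` for some `p > 2`, and
`B(x) = O(|x|^{-τ})` at infinity for some `τ > 2` (almost everywhere, since `B` is an
`L^p_loc` function). -/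
structure IsAdmissibleField (B : Plane → ℝ) : Prop where
  locLp : ∃ p : ℝ≥0∞, 2 < p ∧ ∀ K : Set Plane, IsCompact K → MemLp B p (volume.restrict K)
  decay : ∃ τ : ℝ, 2 < τ ∧ ∃ C R : ℝ, ∀ᵐ x : Plane, R ≤ ‖x‖ → |B x| ≤ C * ‖x‖ ^ (-τ)

/-- `∂₁ A₂ - ∂₂ A₁ = B` in the sense of distributions. -/
def HasDistribCurl (A : Plane → Plane) (B : Plane → ℝ) : Prop :=
  ∀ φ : Plane → ℝ, IsTest φ →
    ∫ x, (A x 0 * partialDeriv 1 φ x - A x 1 * partialDeriv 0 φ x) = ∫ x, B x * φ x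

/-- The normalized flux `α = (2π)⁻¹ ∫ B`. -/
def flux (B : Plane → ℝ) : ℝ := (2 * Real.pi)⁻¹ * ∫ x, B x

/-- The superpotential `h(x) = -(2π)⁻¹ ∫ B(y) log |x - y| dy`. -/
def superpotential (B : Plane → ℝ) (x : Plane) : ℝ :=
  -(2 * Real.pi)⁻¹ * ∫ y, B y * Real.log ‖x - y‖

/-- The comparison profile `g₊(ρ; r)`: `1` for `r ≤ ρ` and `ρ^{-α} r^α` for `r > ρ`. -/
def gPlus (α ρ r : ℝ) : ℝ := if r ≤ ρ then 1 else ρ ^ (-α) * r ^ α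

/-- The comparison profile `g₋ = 1 / g₊`. -/
def gMinus (α ρ r : ℝ) : ℝ := 1 / gPlus α ρ r

/-- The quotient `e^{-h(x)} / g₊(ρ; |x|)`. -/
def ratioPlus (B : Plane → ℝ) (ρ : ℝ) (x : Plane) : ℝ :=
  Real.exp (-superpotential B x) / gPlus (flux B) ρ ‖x‖

/-- The quotient `e^{h(x)} / g₋(ρ; |x|)`. -/
def ratioMinus (B : Plane → ℝ) (ρ : ℝ) (x : Plane) : ℝ :=
  Real.exp (superpotential B x) / gMinus (flux B) ρ ‖x‖

/-- `k₊(ρ)`, the infimum of `e^{-h} / g₊`. -/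
def kPlus (B : Plane → ℝ) (ρ : ℝ) : ℝ := ⨅ x, ratioPlus B ρ x

/-- `K₊(ρ)`, the supremum of `e^{-h} / g₊`. -/
def bigKPlus (B : Plane → ℝ) (ρ : ℝ) : ℝ := ⨆ x, ratioPlus B ρ x

/-- `k₋(ρ)`, the infimum of `e^{h} / g₋`. -/
def kMinus (B : Plane → ℝ) (ρ : ℝ) : ℝ := ⨅ x, ratioMinus B ρ x

/-- `K₋(ρ)`, the supremum of `e^{h} / g₋`. -/
def bigKMinus (B : Plane → ℝ) (ρ : ℝ) : ℝ := ⨆ x, ratioMinus B ρ x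

/-- `β₊(B; ρ) = (k₊ / K₊)²`. -/
def betaPlus (B : Plane → ℝ) (ρ : ℝ) : ℝ := (kPlus B ρ / bigKPlus B ρ) ^ 2

/-- `β₋(B; ρ) = (k₋ / K₋)²`. -/
def betaMinus (B : Plane → ℝ) (ρ : ℝ) : ℝ := (kMinus B ρ / bigKMinus B ρ) ^ 2

/-- `μ_α`, the distance from `α` to the integers. -/
def distToInt (α : ℝ) : ℝ := ⨅ m : ℤ, |(m : ℝ) - α|

open Classical in
/-- The common radial factor of the Hardy weights: for non-integer flux it is
`μ_α² / (ρ² + r²)`, and for integer flux it is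
`|α| / (4|α| + π) · 1 / (ρ² + r² (1 + log² (r/ρ)))`. -/
def hardyProfile (α ρ r : ℝ) : ℝ :=
  if ∃ m : ℤ, (m : ℝ) = α then
    |α| / (4 * |α| + Real.pi) * (1 / (ρ ^ 2 + r ^ 2 * (1 + Real.log (r / ρ) ^ 2)))
  else distToInt α ^ 2 / (ρ ^ 2 + r ^ 2)

/-- The Hardy weight `w₊(ρ; x)`. -/
def wPlus (B : Plane → ℝ) (ρ : ℝ) (x : Plane) : ℝ :=
  betaPlus B ρ * hardyProfile (flux B) ρ ‖x‖

/-- The Hardy weight `w₋(ρ; x)`. -/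
def wMinus (B : Plane → ℝ) (ρ : ℝ) (x : Plane) : ℝ :=
  betaMinus B ρ * hardyProfile (flux B) ρ ‖x‖

/-- The density `|(i∇ + A) v|² + s B |v|²` of the quadratic form of the scalar operator
`(i∇ + A)² + s B`, where `D` is the weak gradient of `v`. -/
def scalarDensity (s : ℝ) (A : Plane → Plane) (B : Plane → ℝ)
    (v : Plane → ℂ) (D : Fin 2 → Plane → ℂ) (x : Plane) : ℝ :=
  (∑ j, ‖Complex.I * D j x + (A x j : ℂ) * v x‖ ^ 2) + s * B x * ‖v x‖ ^ 2

/-- The density of the quadratic form of the Pauli operator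
`P(A) = diag ((i∇ + A)² + B, (i∇ + A)² - B)`. -/
def pauliDensity (A : Plane → Plane) (B : Plane → ℝ)
    (u : Plane → Spinor) (D : Fin 2 → Plane → Spinor) (x : Plane) : ℝ :=
  scalarDensity 1 A B (fun y => u y 0) (fun j y => D j y 0) x
    + scalarDensity (-1) A B (fun y => u y 1) (fun j y => D j y 1) x

/-- The density `⟨u(x), W(x) u(x)⟩` of the quadratic form of a matrix-valued potential. -/
def weightDensity (W : Plane → Matrix (Fin 2) (Fin 2) ℝ) (u : Plane → Spinor) (x : Plane) : ℝ :=
  (∑ i, ∑ k, (starRingEnd ℂ) (u x i) * (W x i k : ℂ) * u x k).re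

/-- `P(A) ≥ W` in the sense of quadratic forms on `H¹(ℝ²; ℂ²)`: both forms are finite on the
whole of `H¹(ℝ²; ℂ²)`, and the one of `P(A)` dominates. -/
def PauliGE (A : Plane → Plane) (B : Plane → ℝ)
    (W : Plane → Matrix (Fin 2) (Fin 2) ℝ) : Prop :=
  ∀ (u : Plane → Spinor) (D : Fin 2 → Plane → Spinor), IsH1 u D →
    Integrable (pauliDensity A B u D) ∧ Integrable (weightDensity W u) ∧
      ∫ x, weightDensity W u x ≤ ∫ x, pauliDensity A B u D x

end PauliHardy

end

/-!
Choose a complex `Ψ` with real part `h` such that multiplication by `e^Ψ` turns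
`∂₁ - i ∂₂ - i (A₁ - i A₂)` into `∂₁ - i ∂₂`; it exists because `curl A = B = -Δh`. Up to a null
Lagrangian, which integrates to zero, the spin-up density is the squared modulus of the former
operator, so the form at `u` is `∫ e^{-2h} |(∂₁ - i ∂₂) f|²` with `f = e^Ψ u`. The bounds
`k g₊ ≤ e^{-h} ≤ K g₊` replace `e^{-h}` by the radial weight `g₊` at the cost of the factor `β`.
In polar coordinates the angular modes of `f` then decouple: the `m`-th one contributes
`∫ g₊² |F' + m F / r|² r dr`, and completing the square with a subsolution of the associated Riccati
equation gives the Hardy inequality. Mollifying `A` and `h` makes the factorization rigorous for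
test functions, and `B ∈ L²` is form bounded, which extends the inequality to `H¹`. The spin-down
component is the spin-up component of the complex conjugate in the field `-B`.
-/

noncomputable section

namespace PauliHardy

/-! ### The Hardy inequality for a single angular mode -/

section RadialHardy

theorem gPlus_eq_exp {ρ : ℝ} (hρ : 0 < ρ) (α r : ℝ) :
    gPlus α ρ r = Real.exp (α * Real.log (max r ρ / ρ)) := by
  unfold gPlus
  split_ifs with h
  · simp [max_eq_right h, div_self hρ.ne']
  · have hr : 0 < r := hρ.trans (not_le.1 h)
    rw [max_eq_left (not_le.1 h).le, Real.log_div hr.ne' hρ.ne', Real.rpow_def_of_pos hρ,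
      Real.rpow_def_of_pos hr, ← Real.exp_add]
    congr 1; ring

theorem gPlus_pos {ρ : ℝ} (hρ : 0 < ρ) (α r : ℝ) : 0 < gPlus α ρ r :=
  gPlus_eq_exp hρ α r ▸ Real.exp_pos _

theorem gPlus_of_le {ρ r : ℝ} (h : r ≤ ρ) (α : ℝ) : gPlus α ρ r = 1 := if_pos h

theorem gPlus_of_ge {ρ r : ℝ} (hρ : 0 < ρ) (h : ρ ≤ r) (α : ℝ) :
    gPlus α ρ r = ρ ^ (-α) * r ^ α := by
  rcases h.eq_or_lt with rfl | h
  · rw [gPlus_of_le le_rfl, ← Real.rpow_add hρ, neg_add_cancel, Real.rpow_zero]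
  · exact if_neg (not_le.2 h)

theorem continuous_gPlus {ρ : ℝ} (hρ : 0 < ρ) (α : ℝ) : Continuous (gPlus α ρ) := by
  rw [funext (gPlus_eq_exp hρ α)]
  have hmax (r : ℝ) : max r ρ / ρ ≠ 0 := (div_pos (lt_max_of_lt_right hρ) hρ).ne'
  exact (continuous_const.mul (((continuous_id.max continuous_const).div_const ρ).log hmax)).rexp

theorem hasDerivAt_const_mul_rpow (c a : ℝ) {r : ℝ} (hr : 0 < r) :
    HasDerivAt (fun r => c * r ^ a) (c * r ^ a * (a / r)) r := by
  refine ((Real.hasDerivAt_rpow_const (Or.inl hr.ne')).const_mul c).congr_deriv ?_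
  rw [Real.rpow_sub_one hr.ne']
  ring

variable {E : Type*} [NormedAddCommGroup E] [InnerProductSpace ℝ E] {F F' : ℝ → E}

theorem add_boundary_density_le {v w p p' c : ℝ} (hw : 0 < w) (h : v ≤ -p' + 2 * p * c - p ^ 2 / w)
    (x y : E) :
    v * ‖x‖ ^ 2 + (p' * ‖x‖ ^ 2 + p * (2 * inner ℝ x y)) ≤ w * ‖y + c • x‖ ^ 2 := by
  have square : w * ‖(y + c • x) - (p / w) • x‖ ^ 2 = w * ‖y + c • x‖ ^ 2
      - 2 * p * (inner ℝ x y + c * ‖x‖ ^ 2) + p ^ 2 / w * ‖x‖ ^ 2 := by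
    rw [norm_sub_sq_real, real_inner_smul_right, inner_add_left, real_inner_smul_left,
      real_inner_self_eq_norm_sq, real_inner_comm x y, norm_smul, mul_pow, Real.norm_eq_abs, sq_abs]
    field_simp
  linarith [mul_nonneg hw.le (sq_nonneg ‖(y + c • x) - (p / w) • x‖),
    mul_le_mul_of_nonneg_right h (sq_nonneg ‖x‖)]

theorem integral_add_boundary_le {w p p' v c : ℝ → ℝ} {a b : ℝ} (hab : a ≤ b)
    (hF : ∀ r ∈ Icc a b, HasDerivAt F (F' r) r) (hF' : ContinuousOn F' (Icc a b))
    (hp : ∀ r ∈ Icc a b, HasDerivAt p (p' r) r) (hp' : ContinuousOn p' (Icc a b))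
    (hw : ContinuousOn w (Icc a b)) (hw0 : ∀ r ∈ Icc a b, 0 < w r)
    (hv : ContinuousOn v (Icc a b)) (hc : ContinuousOn c (Icc a b))
    (h : ∀ r ∈ Icc a b, v r ≤ -p' r + 2 * p r * c r - p r ^ 2 / w r) :
    (∫ r in a..b, v r * ‖F r‖ ^ 2) + (p b * ‖F b‖ ^ 2 - p a * ‖F a‖ ^ 2)
      ≤ ∫ r in a..b, w r * ‖F' r + c r • F r‖ ^ 2 := by
  have cF : ContinuousOn F (Icc a b) := HasDerivAt.continuousOn hF
  have cp : ContinuousOn p (Icc a b) := HasDerivAt.continuousOn hp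
  have potential : ContinuousOn (fun r => v r * ‖F r‖ ^ 2) (Icc a b) := hv.mul (cF.norm.pow 2)
  have kinetic : ContinuousOn (fun r => w r * ‖F' r + c r • F r‖ ^ 2) (Icc a b) :=
    hw.mul ((hF'.add (hc.smul cF)).norm.pow 2)
  have boundary : ContinuousOn
      (fun r => p' r * ‖F r‖ ^ 2 + p r * (2 * inner ℝ (F r) (F' r))) (Icc a b) :=
    (hp'.mul (cF.norm.pow 2)).add (cp.mul (continuousOn_const.mul (cF.inner hF')))
  rw [← uIcc_of_le hab] at hF hp potential kinetic boundary
  rw [← intervalIntegral.integral_eq_sub_of_hasDerivAt (f := fun r => p r * ‖F r‖ ^ 2)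
    (fun r hr => (hp r hr).mul (hF r hr).norm_sq) boundary.intervalIntegrable,
    ← intervalIntegral.integral_add potential.intervalIntegrable boundary.intervalIntegrable]
  exact intervalIntegral.integral_mono_on hab (potential.add boundary).intervalIntegrable
    kinetic.intervalIntegrable fun r hr => add_boundary_density_le (hw0 r hr) (h r hr) _ _

/-- `q`, with derivative `q'`, is a subsolution on `s` of the Riccati equation
`r q' = 2 ν q - q² - r² V` attached to the Euler operator `r ∂_r + ν` and the potential `V`. The
equation is kept multiplied by `r`, so that it contains no division. -/
structure IsRiccatiSubsolution (ν : ℝ) (V q q' : ℝ → ℝ) (s : Set ℝ) : Prop where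
  hasDerivAt : ∀ r ∈ s, HasDerivAt q (q' r) r
  continuousOn_deriv : ContinuousOn q' s
  le : ∀ r ∈ s, V r * r ^ 2 ≤ 2 * ν * q r - q r ^ 2 - r * q' r

theorem IsRiccatiSubsolution.mono {ν : ℝ} {V q q' : ℝ → ℝ} {s t : Set ℝ}
    (h : IsRiccatiSubsolution ν V q q' s) (hts : t ⊆ s) : IsRiccatiSubsolution ν V q q' t :=
  ⟨fun r hr => h.hasDerivAt r (hts hr), h.continuousOn_deriv.mono hts, fun r hr => h.le r (hts hr)⟩

theorem IsRiccatiSubsolution.integral_add_boundary_le {V q q' g : ℝ → ℝ} {m a c b d : ℝ}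
    (hb : 0 < b) (hbd : b ≤ d) (hc : 0 < c) (hg : ∀ r ∈ Icc b d, g r = c * r ^ a)
    (hq : IsRiccatiSubsolution (m - a) V q q' (Icc b d)) (hV : ContinuousOn V (Icc b d))
    (hF : ∀ r ∈ Icc b d, HasDerivAt F (F' r) r) (hF' : ContinuousOn F' (Icc b d)) :
    (∫ r in b..d, V r * g r ^ 2 * r * ‖F r‖ ^ 2)
        + (g d ^ 2 * q d * ‖F d‖ ^ 2 - g b ^ 2 * q b * ‖F b‖ ^ 2)
      ≤ ∫ r in b..d, g r ^ 2 * r * ‖F' r + (m / r) • F r‖ ^ 2 := by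
  have pos : ∀ r ∈ Icc b d, 0 < r := fun r hr => hb.trans_le hr.1
  have hG : ∀ r ∈ Icc b d, HasDerivAt (fun r => c * r ^ a) (g r * (a / r)) r := fun r hr =>
    hg r hr ▸ hasDerivAt_const_mul_rpow c a (pos r hr)
  have cg : ContinuousOn g (Icc b d) := (HasDerivAt.continuousOn hG).congr hg
  have cq : ContinuousOn q (Icc b d) := HasDerivAt.continuousOn hq.hasDerivAt
  have cdiv (x : ℝ) : ContinuousOn (fun r : ℝ => x / r) (Icc b d) :=
    continuousOn_const.div continuousOn_id fun r hr => (pos r hr).ne'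
  rw [hg d (right_mem_Icc.2 hbd), hg b (left_mem_Icc.2 hbd)]
  refine PauliHardy.integral_add_boundary_le (p := fun r => (c * r ^ a) ^ 2 * q r)
    (p' := fun r => g r ^ 2 * (2 * (a / r) * q r + q' r)) (c := fun r => m / r) hbd hF hF'
    (fun r hr => ?_) ?_ ((cg.pow 2).mul continuousOn_id) (fun r hr => ?_)
    ((hV.mul (cg.pow 2)).mul continuousOn_id) (cdiv m) (fun r hr => ?_)
  · refine (((hG r hr).pow 2).mul (hq.hasDerivAt r hr)).congr_deriv ?_
    rw [Pi.pow_apply, ← hg r hr]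
    push_cast
    ring
  · exact (cg.pow 2).mul (((continuousOn_const.mul (cdiv a)).mul cq).add hq.continuousOn_deriv)
  · have := pos r hr
    rw [hg r hr]
    positivity
  · have hr0 := pos r hr
    have hg0 : 0 < g r := hg r hr ▸ by positivity
    rw [← hg r hr]
    calc V r * g r ^ 2 * r = g r ^ 2 / r * (V r * r ^ 2) := by field_simp
      _ ≤ g r ^ 2 / r * (2 * (m - a) * q r - q r ^ 2 - r * q' r) := by gcongr; exact hq.le r hr
      _ = _ := by field_simp; ring

variable {V q₁ q₁' q₂ q₂' : ℝ → ℝ} {m α ρ R₀ : ℝ}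

theorem continuousOn_potential_density {G : Type*} [NormedAddCommGroup G] {F : ℝ → G}
    (hρ : 0 < ρ) (α : ℝ) (hF : ContinuousOn F (Ioi 0)) (hV : ContinuousOn V (Ioi 0)) :
    ContinuousOn (fun r => V r * gPlus α ρ r ^ 2 * r * ‖F r‖ ^ 2) (Ioi 0) :=
  ((hV.mul ((continuous_gPlus hρ α).continuousOn.pow 2)).mul continuousOn_id).mul (hF.norm.pow 2)

theorem continuousOn_kinetic_density {G : Type*} [NormedAddCommGroup G] [NormedSpace ℝ G]
    {F F' : ℝ → G} (hρ : 0 < ρ) (α m : ℝ) (hF : ContinuousOn F (Ioi 0))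
    (hF' : ContinuousOn F' (Ioi 0)) :
    ContinuousOn (fun r => gPlus α ρ r ^ 2 * r * ‖F' r + (m / r) • F r‖ ^ 2) (Ioi 0) := by
  have div_radius : ContinuousOn (fun r => m / r) (Ioi 0) :=
    continuousOn_const.div continuousOn_id fun r hr => (mem_Ioi.1 hr).ne'
  exact (((continuous_gPlus hρ α).continuousOn.pow 2).mul continuousOn_id).mul
    ((hF'.add (div_radius.smul hF)).norm.pow 2)

theorem integral_gPlus_le (hρ : 0 < ρ) (hF : ∀ r, 0 < r → HasDerivAt F (F' r) r)
    (hF' : ContinuousOn F' (Ioi 0)) (hV : ContinuousOn V (Ioi 0))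
    (hq₁ : IsRiccatiSubsolution m V q₁ q₁' (Ioc 0 ρ))
    (hq₂ : IsRiccatiSubsolution (m - α) V q₂ q₂' (Ici ρ)) (hjump : q₂ ρ ≤ q₁ ρ)
    {δ R : ℝ} (hδ : 0 < δ) (hδρ : δ ≤ ρ) (hρR : ρ ≤ R) (hFR : F R = 0) :
    ∫ r in δ..R, V r * gPlus α ρ r ^ 2 * r * ‖F r‖ ^ 2 ≤
      (∫ r in δ..R, gPlus α ρ r ^ 2 * r * ‖F' r + (m / r) • F r‖ ^ 2) + q₁ δ * ‖F δ‖ ^ 2 := by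
  have inner_sub : Icc δ ρ ⊆ Ioc 0 ρ := fun r hr => ⟨hδ.trans_le hr.1, hr.2⟩
  have inner_pos : Icc δ ρ ⊆ Ioi 0 := fun r hr => hδ.trans_le hr.1
  have outer_pos : Icc ρ R ⊆ Ioi 0 := fun r hr => hρ.trans_le hr.1
  have inner := IsRiccatiSubsolution.integral_add_boundary_le (a := 0) (g := gPlus α ρ) hδ hδρ
    one_pos (fun r hr => by rw [gPlus_of_le hr.2, Real.rpow_zero, one_mul])
    ((sub_zero m).symm ▸ hq₁.mono inner_sub) (hV.mono inner_pos)
    (fun r hr => hF r (inner_pos hr)) (hF'.mono inner_pos)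
  have outer := (hq₂.mono Icc_subset_Ici_self).integral_add_boundary_le (g := gPlus α ρ) hρ hρR
    (by positivity) (fun r hr => gPlus_of_ge hρ hr.1 α) (hV.mono outer_pos)
    (fun r hr => hF r (outer_pos hr)) (hF'.mono outer_pos)
  simp only [gPlus_of_le hδρ, gPlus_of_le le_rfl, hFR, norm_zero, one_pow, one_mul, ne_eq,
    OfNat.ofNat_ne_zero, not_false_eq_true, zero_pow, mul_zero, zero_sub] at inner outer
  have potential := continuousOn_potential_density hρ α (HasDerivAt.continuousOn hF) hV
  have kinetic := continuousOn_kinetic_density hρ α m (HasDerivAt.continuousOn hF) hF'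
  rw [← uIcc_of_le hδρ] at inner_pos
  rw [← uIcc_of_le hρR] at outer_pos
  rw [← intervalIntegral.integral_add_adjacent_intervals
      (potential.mono inner_pos).intervalIntegrable (potential.mono outer_pos).intervalIntegrable,
    ← intervalIntegral.integral_add_adjacent_intervals
      (kinetic.mono inner_pos).intervalIntegrable (kinetic.mono outer_pos).intervalIntegrable]
  linarith [mul_le_mul_of_nonneg_right hjump (sq_nonneg ‖F ρ‖)]

theorem lintegral_Ioc_ofReal {φ : ℝ → ℝ} {a b : ℝ} (hab : a ≤ b) (hφ : ContinuousOn φ (Icc a b))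
    (h0 : ∀ r ∈ Icc a b, 0 ≤ φ r) :
    ∫⁻ r in Ioc a b, ENNReal.ofReal (φ r) = ENNReal.ofReal (∫ r in a..b, φ r) := by
  rw [intervalIntegral.integral_of_le hab, ofReal_integral_eq_lintegral_ofReal]
  · exact hφ.integrableOn_Icc.mono_set Ioc_subset_Icc_self
  · filter_upwards [self_mem_ae_restrict measurableSet_Ioc] with r hr
    exact h0 r (Ioc_subset_Icc_self hr)

theorem lintegral_Ioi_le_of_tendsto {f e : ℝ → ℝ≥0∞} {C : ℝ≥0∞} {a : ℝ}
    (hf : AEMeasurable f (volume.restrict (Ioi a)))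
    (he : Tendsto e (nhdsWithin a (Ioi a)) (nhds 0))
    (h : ∀ᶠ δ in nhdsWithin a (Ioi a), ∫⁻ r in Ioi δ, f r ≤ C + e δ) :
    ∫⁻ r in Ioi a, f r ≤ C := by
  have cover : AECover (volume.restrict (Ioi a)) (nhdsWithin a (Ioi a)) Ioi :=
    aecover_Ioi_of_Ioi (tendsto_id.mono_left nhdsWithin_le_nhds)
  have hC : Tendsto (fun δ => C + e δ) (nhdsWithin a (Ioi a)) (nhds C) := by
    simpa only [add_zero] using he.const_add C
  refine le_of_tendsto_of_tendsto (cover.lintegral_tendsto_of_countably_generated hf) hC ?_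
  filter_upwards [h, self_mem_nhdsWithin] with δ hδ ha
  rwa [Measure.restrict_restrict measurableSet_Ioi,
    inter_eq_self_of_subset_left (Ioi_subset_Ioi (mem_Ioi.1 ha).le)]

theorem lintegral_gPlus_le (hρ : 0 < ρ) (hF : ∀ r, 0 < r → HasDerivAt F (F' r) r)
    (hF' : ContinuousOn F' (Ioi 0)) (hR : ∀ r, R₀ ≤ r → F r = 0)
    (hV : ContinuousOn V (Ioi 0)) (hV0 : ∀ r, 0 < r → 0 ≤ V r)
    (hq₁ : IsRiccatiSubsolution m V q₁ q₁' (Ioc 0 ρ))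
    (hq₂ : IsRiccatiSubsolution (m - α) V q₂ q₂' (Ici ρ)) (hjump : q₂ ρ ≤ q₁ ρ)
    (hzero : Tendsto (fun r => q₁ r * ‖F r‖ ^ 2) (nhdsWithin 0 (Ioi 0)) (nhds 0)) :
    ∫⁻ r in Ioi 0, ENNReal.ofReal (V r * gPlus α ρ r ^ 2 * r * ‖F r‖ ^ 2) ≤
      ∫⁻ r in Ioi 0, ENNReal.ofReal (gPlus α ρ r ^ 2 * r * ‖F' r + (m / r) • F r‖ ^ 2) := by
  have potential := continuousOn_potential_density hρ α (HasDerivAt.continuousOn hF) hV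
  have kinetic := continuousOn_kinetic_density hρ α m (HasDerivAt.continuousOn hF) hF'
  refine lintegral_Ioi_le_of_tendsto (e := fun δ => ENNReal.ofReal (q₁ δ * ‖F δ‖ ^ 2))
    (potential.aemeasurable measurableSet_Ioi).ennreal_ofReal
    (by simpa only [ENNReal.ofReal_zero] using ENNReal.tendsto_ofReal hzero) ?_
  filter_upwards [Ioo_mem_nhdsGT hρ] with δ hδ
  set R := max ρ R₀
  have pos : Icc δ R ⊆ Ioi 0 := fun r hr => hδ.1.trans_le hr.1
  have hδR : δ ≤ R := hδ.2.le.trans (le_max_left _ _)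
  have vanish : EqOn (fun r => ENNReal.ofReal (V r * gPlus α ρ r ^ 2 * r * ‖F r‖ ^ 2))
      (fun _ => 0) (Ioi R) := fun r hr => by
    simp [hR r ((le_max_right _ _).trans (mem_Ioi.1 hr).le)]
  calc ∫⁻ r in Ioi δ, ENNReal.ofReal (V r * gPlus α ρ r ^ 2 * r * ‖F r‖ ^ 2)
      ≤ ∫⁻ r in Ioc δ R, ENNReal.ofReal (V r * gPlus α ρ r ^ 2 * r * ‖F r‖ ^ 2) := by
        rw [← Ioc_union_Ioi_eq_Ioi hδR]
        refine (lintegral_union_le _ _ _).trans_eq ?_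
        rw [setLIntegral_congr_fun measurableSet_Ioi vanish, lintegral_zero, add_zero]
    _ = ENNReal.ofReal (∫ r in δ..R, V r * gPlus α ρ r ^ 2 * r * ‖F r‖ ^ 2) :=
        lintegral_Ioc_ofReal hδR (potential.mono pos) fun r hr => by
          have := hV0 r (pos hr)
          have := (mem_Ioi.1 (pos hr)).le
          positivity
    _ ≤ ENNReal.ofReal ((∫ r in δ..R, gPlus α ρ r ^ 2 * r * ‖F' r + (m / r) • F r‖ ^ 2)
          + q₁ δ * ‖F δ‖ ^ 2) := ENNReal.ofReal_le_ofReal <| integral_gPlus_le hρ hF hF' hV hq₁ hq₂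
        hjump hδ.1 hδ.2.le (le_max_left _ _) (hR R (le_max_right _ _))
    _ ≤ ENNReal.ofReal (∫ r in δ..R, gPlus α ρ r ^ 2 * r * ‖F' r + (m / r) • F r‖ ^ 2)
          + ENNReal.ofReal (q₁ δ * ‖F δ‖ ^ 2) := ENNReal.ofReal_add_le
    _ ≤ _ := by
      rw [← lintegral_Ioc_ofReal hδR (kinetic.mono pos) fun r hr => by
        have := (mem_Ioi.1 (pos hr)).le
        positivity]
      gcongr
      exact Ioc_subset_Ioi_self.trans (Ioi_subset_Ioi hδ.1.le)

end RadialHardy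

theorem distToInt_nonneg (α : ℝ) : 0 ≤ distToInt α := Real.iInf_nonneg fun _ => abs_nonneg _

theorem distToInt_le (α : ℝ) (m : ℤ) : distToInt α ≤ |(m : ℝ) - α| :=
  ciInf_le ⟨0, by rintro _ ⟨m, rfl⟩; exact abs_nonneg _⟩ m

theorem distToInt_le_half (α : ℝ) : distToInt α ≤ 1 / 2 :=
  (distToInt_le α (round α)).trans (by rw [abs_sub_comm]; exact abs_sub_round α)

theorem hardyProfile_nonneg (α ρ r : ℝ) : 0 ≤ hardyProfile α ρ r := by
  unfold hardyProfile
  split_ifs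
  · have := Real.pi_pos
    positivity
  · positivity

theorem hardyProfile_zero_left (ρ r : ℝ) : hardyProfile 0 ρ r = 0 := by
  rw [hardyProfile, if_pos ⟨0, Int.cast_zero⟩, abs_zero, zero_div, zero_mul]

theorem continuousOn_hardyProfile {α ρ : ℝ} (hρ : 0 < ρ) :
    ContinuousOn (hardyProfile α ρ) (Ioi 0) := by
  unfold hardyProfile
  split_ifs
  · refine continuousOn_const.mul (continuousOn_const.div ?_ fun r _ => ?_)
    · refine continuousOn_const.add ((continuousOn_id.pow 2).mul (continuousOn_const.add
        ((ContinuousOn.log (continuousOn_id.div_const _) fun r hr =>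
          (div_pos hr hρ).ne').pow 2)))
    · positivity
  · refine continuousOn_const.div (continuousOn_const.add (continuousOn_id.pow 2)) fun r _ => ?_
    positivity

theorem measurable_hardyProfile (α ρ : ℝ) : Measurable (hardyProfile α ρ) := by
  unfold hardyProfile
  split_ifs <;> fun_prop

theorem hardyProfile_le {α ρ r : ℝ} (hρ : 0 < ρ) : hardyProfile α ρ r ≤ 1 / ρ ^ 2 := by
  unfold hardyProfile
  split_ifs
  · have coeff_le : |α| / (4 * |α| + Real.pi) ≤ 1 := by
      have := Real.pi_pos
      rw [div_le_one (by positivity)]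
      nlinarith [abs_nonneg α]
    calc _ ≤ 1 * (1 / ρ ^ 2) := by
          gcongr
          nlinarith [mul_nonneg (sq_nonneg r) (sq_nonneg (Real.log (r / ρ))), sq_nonneg r]
      _ = _ := one_mul _
  · have := distToInt_le_half α
    have := distToInt_nonneg α
    gcongr
    · nlinarith
    · nlinarith [sq_nonneg r]

theorem hardyProfile_mul_sq_le_of_int {α ρ r : ℝ} (h : ∃ m : ℤ, (m : ℝ) = α) (hρ : 0 < ρ) :
    hardyProfile α ρ r * r ^ 2 ≤ 1 / 4 * (r ^ 2 / (ρ ^ 2 + r ^ 2)) := by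
  rw [hardyProfile, if_pos h]
  have coeff_le : |α| / (4 * |α| + Real.pi) ≤ 1 / 4 := by
    have := Real.pi_pos
    rw [div_le_div_iff₀ (by positivity) (by norm_num)]
    linarith
  have profile_le : 1 / (ρ ^ 2 + r ^ 2 * (1 + Real.log (r / ρ) ^ 2)) ≤ 1 / (ρ ^ 2 + r ^ 2) := by
    apply one_div_le_one_div_of_le (by positivity)
    nlinarith [mul_nonneg (sq_nonneg r) (sq_nonneg (Real.log (r / ρ)))]
  calc _ ≤ 1 / 4 * (1 / (ρ ^ 2 + r ^ 2)) * r ^ 2 := by gcongr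
    _ = _ := by ring

theorem hardyProfile_mul_sq_of_not_int {α ρ r : ℝ} (h : ¬ ∃ m : ℤ, (m : ℝ) = α) :
    hardyProfile α ρ r * r ^ 2 = distToInt α ^ 2 * (r ^ 2 / (ρ ^ 2 + r ^ 2)) := by
  rw [hardyProfile, if_neg h]; ring

theorem hardyProfile_mul_sq_le_quarter {α ρ r : ℝ} (hρ : 0 < ρ) :
    hardyProfile α ρ r * r ^ 2 ≤ 1 / 4 := by
  have ratio_le : r ^ 2 / (ρ ^ 2 + r ^ 2) ≤ 1 := by
    rw [div_le_one (by positivity)]; nlinarith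
  by_cases h : ∃ m : ℤ, (m : ℝ) = α
  · exact (hardyProfile_mul_sq_le_of_int h hρ).trans (by linarith)
  · rw [hardyProfile_mul_sq_of_not_int h]
    have := distToInt_le_half α
    have dist_sq_le : distToInt α ^ 2 ≤ 1 / 4 := by nlinarith [distToInt_nonneg α]
    calc _ ≤ 1 / 4 * (1 : ℝ) := by gcongr
      _ = _ := by ring

theorem one_le_cast_sq {m : ℤ} (hm : m ≠ 0) : (1 : ℝ) ≤ (m : ℝ) ^ 2 :=
  (one_le_sq_iff_one_le_abs _).2 (mod_cast Int.one_le_abs hm)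

theorem hardyProfile_mul_sq_le_of_ne {α ρ r : ℝ} (hρ : 0 < ρ) {m : ℤ} (hm : (m : ℝ) ≠ α) :
    hardyProfile α ρ r * r ^ 2 ≤ (m - α) ^ 2 := by
  by_cases h : ∃ k : ℤ, (k : ℝ) = α
  · obtain ⟨k, rfl⟩ := h
    have one_le : (1 : ℝ) ≤ ((m - k : ℤ) : ℝ) ^ 2 :=
      one_le_cast_sq (sub_ne_zero.2 fun h => hm (by rw [h]))
    push_cast at one_le
    linarith [hardyProfile_mul_sq_le_quarter (α := k) (r := r) hρ]
  · calc hardyProfile α ρ r * r ^ 2 = distToInt α ^ 2 * (r ^ 2 / (ρ ^ 2 + r ^ 2)) :=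
          hardyProfile_mul_sq_of_not_int h
      _ ≤ |(m : ℝ) - α| ^ 2 * 1 := by
        gcongr
        exacts [distToInt_nonneg α, distToInt_le α m,
          (div_le_one (by positivity)).2 (by linarith [sq_nonneg ρ])]
      _ = (m - α) ^ 2 := by rw [mul_one, sq_abs]

theorem hardyProfile_mul_sq_le_log {α ρ r : ℝ} (hρ : 0 < ρ) (hα : 1 ≤ α)
    (h : ∃ m : ℤ, (m : ℝ) = α) (hr : ρ ≤ r) :
    hardyProfile α ρ r * r ^ 2 ≤ 1 / (4 * (Real.log (r / ρ) + (2 * α)⁻¹) ^ 2) := by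
  rw [hardyProfile, if_pos h, abs_of_pos (by positivity)]
  have hpi := Real.pi_gt_three
  have hl : 0 ≤ Real.log (r / ρ) := Real.log_nonneg ((one_le_div hρ).2 hr)
  set l := Real.log (r / ρ)
  have : 0 < α := by positivity
  have expand : 4 * α * (l + (2 * α)⁻¹) ^ 2 = 4 * α * l ^ 2 + 4 * l + α⁻¹ := by
    field_simp
    ring
  have key : 4 * α * (l + (2 * α)⁻¹) ^ 2 ≤ (4 * α + Real.pi) * (1 + l ^ 2) := by
    nlinarith [sq_nonneg (l - 2 / 3), sq_nonneg l, inv_le_one_of_one_le₀ hα]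
  rw [mul_one_div, div_div, div_mul_eq_mul_div, div_le_div_iff₀ (by positivity) (by positivity),
    one_mul]
  calc α * r ^ 2 * (4 * (l + (2 * α)⁻¹) ^ 2) = 4 * α * (l + (2 * α)⁻¹) ^ 2 * r ^ 2 := by ring
    _ ≤ (4 * α + Real.pi) * (1 + l ^ 2) * r ^ 2 := by gcongr
    _ ≤ (4 * α + Real.pi) * (ρ ^ 2 + r ^ 2 * (1 + l ^ 2)) := by
      rw [mul_assoc]
      gcongr
      linarith [sq_nonneg ρ]

theorem exists_hardyProfile_mul_sq_le {α ρ : ℝ} (hρ : 0 < ρ) (hα : 0 < α) :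
    ∃ κ ∈ Icc (0 : ℝ) 1, κ ≤ α ∧
      ∀ r, hardyProfile α ρ r * r ^ 2 ≤ κ * (r ^ 2 / (ρ ^ 2 + r ^ 2)) := by
  by_cases h : ∃ k : ℤ, (k : ℝ) = α
  · refine ⟨1, by norm_num, ?_, fun r => (hardyProfile_mul_sq_le_of_int h hρ).trans ?_⟩
    · obtain ⟨k, rfl⟩ := h
      exact_mod_cast hα
    · gcongr
      norm_num
  · have half := distToInt_le_half α
    refine ⟨distToInt α, ⟨distToInt_nonneg α, by linarith⟩, ?_, fun r => ?_⟩
    · simpa [abs_of_pos hα] using distToInt_le α 0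
    · rw [hardyProfile_mul_sq_of_not_int h]
      gcongr
      exact pow_le_of_le_one (distToInt_nonneg α) (by linarith) two_ne_zero

theorem isRiccatiSubsolution_const {ν : ℝ} {V : ℝ → ℝ} {s : Set ℝ}
    (h : ∀ r ∈ s, V r * r ^ 2 ≤ ν ^ 2) :
    IsRiccatiSubsolution ν V (fun _ => ν) (fun _ => 0) s :=
  ⟨fun _ _ => hasDerivAt_const _ _, continuousOn_const, fun r hr => by linarith [h r hr]⟩

theorem isRiccatiSubsolution_log {V : ℝ → ℝ} {ρ c : ℝ} {s : Set ℝ} (hρ : 0 < ρ)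
    (hs : s ⊆ Ioi 0) (ht : ∀ r ∈ s, Real.log (r / ρ) + c ≠ 0)
    (h : ∀ r ∈ s, V r * r ^ 2 ≤ 1 / (4 * (Real.log (r / ρ) + c) ^ 2)) :
    IsRiccatiSubsolution 0 V (fun r => (2 * (Real.log (r / ρ) + c))⁻¹)
      (fun r => -(2 * r * (Real.log (r / ρ) + c) ^ 2)⁻¹) s := by
  have hasDerivAt_log : ∀ r ∈ s, HasDerivAt (fun r => Real.log (r / ρ) + c) r⁻¹ r := fun r hr => by
    have hr0 : r ≠ 0 := (mem_Ioi.1 (hs hr)).ne'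
    refine ((((hasDerivAt_id' r).div_const ρ).log
      (div_ne_zero hr0 hρ.ne')).add_const c).congr_deriv ?_
    field_simp
  refine ⟨fun r hr => ?_, ?_, fun r hr => ?_⟩
  · refine (((hasDerivAt_log r hr).const_mul 2).inv (mul_ne_zero two_ne_zero (ht r hr))).congr_deriv
      ?_
    have := ht r hr
    have := (mem_Ioi.1 (hs hr)).ne'
    field_simp
  · exact (((continuousOn_const.mul continuousOn_id).mul
      ((HasDerivAt.continuousOn hasDerivAt_log).pow 2)).inv₀ fun r hr => mul_ne_zero
        (mul_ne_zero two_ne_zero (mem_Ioi.1 (hs hr)).ne') (pow_ne_zero 2 (ht r hr))).neg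
  · refine (h r hr).trans_eq ?_
    have := ht r hr
    have := (mem_Ioi.1 (hs hr)).ne'
    field_simp
    norm_num

theorem isRiccatiSubsolution_sq {V : ℝ → ℝ} {ρ κ : ℝ} (hρ : 0 < ρ) (hκ : κ ∈ Icc (0 : ℝ) 1)
    (h : ∀ r, V r * r ^ 2 ≤ κ * (r ^ 2 / (ρ ^ 2 + r ^ 2))) :
    IsRiccatiSubsolution 0 V (fun r => -κ * (r / ρ) ^ 2) (fun r => -κ * (2 * r / ρ ^ 2))
      (Ioc 0 ρ) := by
  refine ⟨fun r _ => ?_, by fun_prop, fun r hr => ?_⟩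
  · refine ((((hasDerivAt_id' r).div_const ρ).pow 2).const_mul (-κ)).congr_deriv ?_
    push_cast
    ring
  · have ratio_le : (r / ρ) ^ 2 ≤ 1 :=
      pow_le_one₀ (by have := hr.1; positivity) ((div_le_one hρ).2 hr.2)
    have small : κ * (r / ρ) ^ 2 ≤ 1 := mul_le_one₀ hκ.2 (sq_nonneg _) ratio_le
    calc V r * r ^ 2 ≤ κ * (r ^ 2 / (ρ ^ 2 + r ^ 2)) := h r
      _ ≤ κ * (r ^ 2 / ρ ^ 2) := by
        have := hκ.1
        gcongr
        linarith [sq_nonneg r]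
      _ = κ * (r / ρ) ^ 2 * 1 := by rw [div_pow, mul_one]
      _ ≤ κ * (r / ρ) ^ 2 * (2 - κ * (r / ρ) ^ 2) := by
        have := hκ.1
        gcongr
        linarith
      _ = _ := by ring

section

variable {E : Type*} [NormedAddCommGroup E] [InnerProductSpace ℝ E] {F F' : ℝ → E} {α ρ R₀ M : ℝ}

theorem lintegral_hardyProfile_le_of_mode_zero (hρ : 0 < ρ) (hα : 0 < α)
    (hF : ∀ r, 0 < r → HasDerivAt F (F' r) r) (hF' : ContinuousOn F' (Ioi 0))
    (hR : ∀ r, R₀ ≤ r → F r = 0) (hM : ∀ r, 0 < r → ‖F r‖ ≤ M) :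
    ∫⁻ r in Ioi 0, ENNReal.ofReal (hardyProfile α ρ r * gPlus α ρ r ^ 2 * r * ‖F r‖ ^ 2) ≤
      ∫⁻ r in Ioi 0, ENNReal.ofReal (gPlus α ρ r ^ 2 * r * ‖F' r‖ ^ 2) := by
  obtain ⟨κ, hκ, hκα, hV⟩ := exists_hardyProfile_mul_sq_le hρ hα
  have outer : IsRiccatiSubsolution (0 - α) (hardyProfile α ρ) (fun _ => 0 - α) (fun _ => 0)
      (Ici ρ) := isRiccatiSubsolution_const fun r _ => by
    simpa using hardyProfile_mul_sq_le_of_ne (m := 0) hρ (by simpa using hα.ne)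
  have small : Tendsto (fun r => -κ * (r / ρ) ^ 2) (nhdsWithin 0 (Ioi 0)) (nhds 0) :=
    (Continuous.tendsto' (by fun_prop) 0 0 (by simp)).mono_left nhdsWithin_le_nhds
  have hzero : Tendsto (fun r => -κ * (r / ρ) ^ 2 * ‖F r‖ ^ 2) (nhdsWithin 0 (Ioi 0)) (nhds 0) := by
    refine small.zero_mul_isBoundedUnder_le ⟨M ^ 2, eventually_map.2 ?_⟩
    filter_upwards [self_mem_nhdsWithin] with r hr
    simpa using pow_le_pow_left₀ (norm_nonneg _) (hM r hr) 2
  have jump : 0 - α ≤ -κ * (ρ / ρ) ^ 2 := by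
    rw [div_self hρ.ne']
    linarith
  simpa only [zero_div, zero_smul, add_zero] using lintegral_gPlus_le hρ hF hF' hR
    (continuousOn_hardyProfile hρ) (fun r _ => hardyProfile_nonneg α ρ r)
    (isRiccatiSubsolution_sq hρ hκ hV) outer jump hzero

theorem lintegral_hardyProfile_le_of_mode_ne_zero (hρ : 0 < ρ) (hα : 0 < α) {m : ℤ} (hm : m ≠ 0)
    (hF : ∀ r, 0 < r → HasDerivAt F (F' r) r) (hF' : ContinuousOn F' (Ioi 0))
    (hR : ∀ r, R₀ ≤ r → F r = 0) (hzero : Tendsto F (nhdsWithin 0 (Ioi 0)) (nhds 0)) :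
    ∫⁻ r in Ioi 0, ENNReal.ofReal (hardyProfile α ρ r * gPlus α ρ r ^ 2 * r * ‖F r‖ ^ 2) ≤
      ∫⁻ r in Ioi 0, ENNReal.ofReal (gPlus α ρ r ^ 2 * r * ‖F' r + ((m : ℝ) / r) • F r‖ ^ 2) := by
  have inner : IsRiccatiSubsolution m (hardyProfile α ρ) (fun _ => m) (fun _ => 0) (Ioc 0 ρ) :=
    isRiccatiSubsolution_const fun r _ =>
      (hardyProfile_mul_sq_le_quarter hρ).trans (by linarith [one_le_cast_sq hm])
  have hzero : Tendsto (fun r => (m : ℝ) * ‖F r‖ ^ 2) (nhdsWithin 0 (Ioi 0)) (nhds 0) := by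
    simpa using (hzero.norm.pow 2).const_mul (m : ℝ)
  suffices ∃ q₂ q₂' : ℝ → ℝ,
      IsRiccatiSubsolution (m - α) (hardyProfile α ρ) q₂ q₂' (Ici ρ) ∧ q₂ ρ ≤ m by
    obtain ⟨q₂, q₂', outer, jump⟩ := this
    exact lintegral_gPlus_le hρ hF hF' hR (continuousOn_hardyProfile hρ)
      (fun r _ => hardyProfile_nonneg α ρ r) inner outer jump hzero
  by_cases hmα : (m : ℝ) = α
  · have one_le : 1 ≤ α := by
      rw [← hmα] at hα ⊢
      exact_mod_cast hα
    rw [hmα, sub_self]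
    refine ⟨_, _, isRiccatiSubsolution_log (c := (2 * α)⁻¹) hρ (fun r hr => hρ.trans_le hr)
      (fun r hr => ?_) fun r hr => hardyProfile_mul_sq_le_log hρ one_le ⟨m, hmα⟩ hr, le_of_eq ?_⟩
    · have := Real.log_nonneg ((one_le_div hρ).2 (mem_Ici.1 hr))
      positivity
    · rw [div_self hρ.ne', Real.log_one, zero_add]
      field_simp
  · exact ⟨_, _, isRiccatiSubsolution_const fun r _ => hardyProfile_mul_sq_le_of_ne hρ hmα,
      by linarith⟩

theorem lintegral_hardyProfile_mode_le (hρ : 0 < ρ) (hα : 0 ≤ α) (m : ℤ)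
    (hF : ∀ r, 0 < r → HasDerivAt F (F' r) r) (hF' : ContinuousOn F' (Ioi 0))
    (hR : ∀ r, R₀ ≤ r → F r = 0) (hM : ∀ r, 0 < r → ‖F r‖ ≤ M)
    (hzero : m ≠ 0 → Tendsto F (nhdsWithin 0 (Ioi 0)) (nhds 0)) :
    ∫⁻ r in Ioi 0, ENNReal.ofReal (hardyProfile α ρ r * gPlus α ρ r ^ 2 * r * ‖F r‖ ^ 2) ≤
      ∫⁻ r in Ioi 0, ENNReal.ofReal (gPlus α ρ r ^ 2 * r * ‖F' r + ((m : ℝ) / r) • F r‖ ^ 2) := by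
  rcases hα.eq_or_lt with rfl | hα
  · simp [hardyProfile_zero_left]
  rcases eq_or_ne m 0 with rfl | hm
  · simpa using lintegral_hardyProfile_le_of_mode_zero hρ hα hF hF' hR hM
  · exact lintegral_hardyProfile_le_of_mode_ne_zero hρ hα hm hF hF' hR (hzero hm)

end

/-! ### Fourier coefficients on the circle -/

/-- The `m`-th Fourier coefficient of a function of the angle. -/
def circleCoeff (v : ℝ → ℂ) (m : ℤ) : ℂ :=
  ((2 * Real.pi)⁻¹ : ℝ) • ∫ θ in (-Real.pi)..Real.pi, Complex.exp (-(m * θ * Complex.I)) * v θ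

theorem circleCoeff_eq_fourierCoeffOn (v : ℝ → ℂ) (m : ℤ) :
    circleCoeff v m = fourierCoeffOn (neg_lt_self Real.pi_pos) v m := by
  rw [fourierCoeffOn_eq_integral, circleCoeff, sub_neg_eq_add, ← two_mul, one_div]
  congr 1
  refine intervalIntegral.integral_congr fun θ _ => ?_
  simp only [fourier_coe_apply, smul_eq_mul]
  congr 2
  have := Real.pi_pos.ne'
  push_cast
  field_simp

theorem hasSum_sq_circleCoeff {v : ℝ → ℂ} (hv : Continuous v) :
    HasSum (fun m => ‖circleCoeff v m‖ ^ 2)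
      ((2 * Real.pi)⁻¹ * ∫ θ in (-Real.pi)..Real.pi, ‖v θ‖ ^ 2) := by
  have memLp : MemLp v 2 (volume.restrict (Ioc (-Real.pi) Real.pi)) := by
    obtain ⟨C, hC⟩ := (isCompact_Icc (a := -Real.pi) (b := Real.pi)).exists_bound_of_continuousOn
      hv.continuousOn
    refine MemLp.of_bound hv.aestronglyMeasurable C ?_
    filter_upwards [self_mem_ae_restrict measurableSet_Ioc] with r hr
    exact hC r (Ioc_subset_Icc_self hr)
  have parseval := hasSum_sq_fourierCoeffOn (neg_lt_self Real.pi_pos) memLp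
  simp_rw [← circleCoeff_eq_fourierCoeffOn] at parseval
  rwa [sub_neg_eq_add, ← two_mul] at parseval

theorem tsum_ofReal_circleCoeff {v : ℝ → ℂ} (hv : Continuous v) {c : ℝ} (hc : 0 ≤ c) :
    ∑' m, ENNReal.ofReal (c * ‖circleCoeff v m‖ ^ 2) =
      ENNReal.ofReal (2 * Real.pi)⁻¹ *
        ∫⁻ θ in Ioc (-Real.pi) Real.pi, ENNReal.ofReal (c * ‖v θ‖ ^ 2) := by
  have parseval := (hasSum_sq_circleCoeff hv).mul_left c
  rw [← ENNReal.ofReal_tsum_of_nonneg (fun m => by positivity) parseval.summable,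
    parseval.tsum_eq,
    lintegral_Ioc_ofReal (by linarith [Real.pi_pos]) (by fun_prop) (fun r _ => by positivity),
    ← ENNReal.ofReal_mul (by have := Real.pi_pos; positivity),
    intervalIntegral.integral_const_mul]
  congr 1; ring

theorem circleCoeff_deriv {v v' : ℝ → ℂ} (hv : ∀ θ, HasDerivAt v (v' θ) θ) (hv' : Continuous v')
    (hper : v (-Real.pi) = v Real.pi) (m : ℤ) :
    circleCoeff v' m = Complex.I * m * circleCoeff v m := by
  let e : ℝ → ℂ := fun θ => Complex.exp (-(m * θ * Complex.I))
  have he : ∀ θ : ℝ, HasDerivAt e (-(m * Complex.I) * e θ) θ := fun θ => by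
    have : HasDerivAt (fun θ : ℝ => -(m * θ * Complex.I)) (-(m * 1 * Complex.I)) θ :=
      (((Complex.ofRealCLM.hasDerivAt (x := θ)).const_mul (m : ℂ)).mul_const Complex.I).neg
    exact this.cexp.congr_deriv (by ring)
  have ce : Continuous e := by fun_prop
  have eper : e (-Real.pi) = e Real.pi :=
    Complex.exp_eq_exp_iff_exists_int.2 ⟨m, by push_cast; ring⟩
  have by_parts := intervalIntegral.integral_mul_deriv_eq_deriv_mul (a := -Real.pi) (b := Real.pi)
    (fun θ _ => he θ) (fun θ _ => hv θ)
    ((continuous_const.mul ce).intervalIntegrable _ _) (hv'.intervalIntegrable _ _)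
  rw [eper, hper, sub_self, zero_sub, ← intervalIntegral.integral_neg] at by_parts
  rw [circleCoeff, circleCoeff, by_parts, mul_smul_comm, ← intervalIntegral.integral_const_mul]
  congr 1
  refine intervalIntegral.integral_congr fun θ _ => ?_
  ring

theorem circleCoeff_zero (m : ℤ) : circleCoeff (fun _ => 0) m = 0 := by
  simp only [circleCoeff, mul_zero, intervalIntegral.integral_zero, smul_zero]

theorem circleCoeff_const {m : ℤ} (hm : m ≠ 0) (c : ℂ) : circleCoeff (fun _ => c) m = 0 := by
  have := circleCoeff_deriv (fun θ => hasDerivAt_const θ c) continuous_const rfl m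
  rw [circleCoeff_zero, eq_comm] at this
  simpa [hm] using this

theorem circleCoeff_sub_const_mul {v w : ℝ → ℂ} (hv : Continuous v) (hw : Continuous w) (c : ℂ)
    (m : ℤ) : circleCoeff (fun θ => v θ - c * w θ) m = circleCoeff v m - c * circleCoeff w m := by
  rw [circleCoeff, circleCoeff, circleCoeff, mul_smul_comm, ← smul_sub,
    ← intervalIntegral.integral_const_mul, ← intervalIntegral.integral_sub]
  · congr 1
    refine intervalIntegral.integral_congr fun θ _ => ?_
    ring
  · exact Continuous.intervalIntegrable (by fun_prop) _ _
  · exact Continuous.intervalIntegrable (by fun_prop) _ _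

theorem norm_circleCoeff_le {v : ℝ → ℂ} {M : ℝ} (hM : ∀ θ, ‖v θ‖ ≤ M) (m : ℤ) :
    ‖circleCoeff v m‖ ≤ M := by
  have bound := intervalIntegral.norm_integral_le_of_norm_le_const (a := -Real.pi) (b := Real.pi)
    (f := fun θ : ℝ => Complex.exp (-(m * θ * Complex.I)) * v θ) (C := M) fun θ _ => by
      rw [norm_mul, Complex.norm_exp]
      simpa using hM θ
  have hpi := Real.pi_pos
  rw [circleCoeff, norm_smul, Real.norm_of_nonneg (by positivity)]
  rw [sub_neg_eq_add, ← two_mul, abs_of_pos (by positivity)] at bound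
  calc _ ≤ (2 * Real.pi)⁻¹ * (M * (2 * Real.pi)) := by gcongr
    _ = M := by field_simp

theorem continuous_circleCoeff {v : ℝ → ℝ → ℂ} (hv : Continuous fun p : ℝ × ℝ => v p.1 p.2)
    (m : ℤ) : Continuous fun r => circleCoeff (v r) m := by
  unfold circleCoeff
  refine Continuous.fun_const_smul ?_ _
  refine intervalIntegral.continuous_parametric_intervalIntegral_of_continuous' ?_ _ _
  have : Continuous fun p : ℝ × ℝ => Complex.exp (-(m * p.2 * Complex.I)) := by fun_prop
  exact this.mul hv

/-! ### Polar coordinates in the plane -/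

/-- The point with polar coordinates `(r, θ)`. -/
def polarPt (r θ : ℝ) : Plane := !₂[r * Real.cos θ, r * Real.sin θ]

theorem continuous_polarPt : Continuous fun p : ℝ × ℝ => polarPt p.1 p.2 := by
  unfold polarPt
  refine (PiLp.continuous_toLp 2 _).comp (continuous_pi fun i => ?_)
  fin_cases i <;> exact continuous_fst.mul (by fun_prop)

theorem norm_polarPt (r θ : ℝ) : ‖polarPt r θ‖ = |r| := by
  rw [EuclideanSpace.norm_eq, ← Real.sqrt_sq_eq_abs]
  congr 1
  simp only [polarPt, Fin.sum_univ_two, Matrix.cons_val_zero, Matrix.cons_val_one, Real.norm_eq_abs,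
    sq_abs]
  linear_combination r ^ 2 * Real.cos_sq_add_sin_sq θ

theorem polarPt_eq (r θ : ℝ) : polarPt r θ = (r * Real.cos θ) • EuclideanSpace.single 0 1 +
    (r * Real.sin θ) • EuclideanSpace.single 1 1 := by
  ext i; fin_cases i <;> simp [polarPt]

theorem hasDerivAt_polarPt_radius (r θ : ℝ) :
    HasDerivAt (fun r => polarPt r θ) (polarPt 1 θ) r := by
  simp_rw [polarPt_eq]
  exact (((hasDerivAt_id r).mul_const _).smul_const _).add
    (((hasDerivAt_id r).mul_const _).smul_const _)

/-- The velocity `r (-sin θ, cos θ)` of the curve `θ ↦ polarPt r θ`. -/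
def polarTangent (r θ : ℝ) : Plane :=
  (-(r * Real.sin θ)) • EuclideanSpace.single 0 1 + (r * Real.cos θ) • EuclideanSpace.single 1 1

theorem hasDerivAt_polarPt_angle (r θ : ℝ) :
    HasDerivAt (fun θ => polarPt r θ) (polarTangent r θ) θ := by
  simp_rw [polarPt_eq]
  refine (((Real.hasDerivAt_cos θ).const_mul r).smul_const _).add
    (((Real.hasDerivAt_sin θ).const_mul r).smul_const _) |>.congr_deriv ?_
  rw [polarTangent, mul_neg]

theorem continuous_comp_polarPt {E : Type*} [TopologicalSpace E] {g : Plane → E}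
    (hg : Continuous g) (r : ℝ) : Continuous fun θ => g (polarPt r θ) :=
  hg.comp (continuous_polarPt.comp (Continuous.prodMk_right r))

theorem lintegral_polarPt {F : Plane → ℝ≥0∞} (hF : Measurable F) :
    ∫⁻ x, F x = ∫⁻ r in Ioi 0, ∫⁻ θ in Ioc (-Real.pi) Real.pi,
      ENNReal.ofReal r * F (polarPt r θ) := by
  let toPlane : ℂ ≃ₗᵢ[ℝ] Plane := Complex.orthonormalBasisOneI.repr
  have hm : Measurable fun p : ℝ × ℝ => ENNReal.ofReal p.1 * F (polarPt p.1 p.2) :=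
    (ENNReal.measurable_ofReal.comp measurable_fst).mul (hF.comp continuous_polarPt.measurable)
  calc ∫⁻ x, F x = ∫⁻ z, F (toPlane z) :=
        (toPlane.measurePreserving.lintegral_comp_emb
          toPlane.toHomeomorph.measurableEmbedding F).symm
    _ = ∫⁻ p in Ioi 0 ×ˢ Ioo (-Real.pi) Real.pi, ENNReal.ofReal p.1 * F (polarPt p.1 p.2) := by
      rw [← Complex.lintegral_comp_polarCoord_symm, polarCoord_target]
      exact lintegral_congr fun p => rfl
    _ = _ := by
      rw [Measure.volume_eq_prod, setLIntegral_prod _ hm.aemeasurable, restrict_Ioo_eq_restrict_Ioc]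

theorem lintegral_radial_mul_norm_sq {f : Plane → ℂ} {w : ℝ → ℝ} {v : ℝ → ℝ → ℂ}
    (hf : Measurable f) (hw : Measurable w) (hw0 : ∀ r, 0 < r → 0 ≤ w r)
    (hv : ∀ r, 0 < r → Continuous (v r)) (hvm : ∀ m, Measurable fun r => circleCoeff (v r) m)
    (hvf : ∀ r, 0 < r → ∀ θ, ‖v r θ‖ = ‖f (polarPt r θ)‖) :
    ∫⁻ x, ENNReal.ofReal (w ‖x‖ * ‖f x‖ ^ 2) = ENNReal.ofReal (2 * Real.pi) *
      ∑' m, ∫⁻ r in Ioi 0, ENNReal.ofReal (w r * r * ‖circleCoeff (v r) m‖ ^ 2) := by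
  have hpi : 0 < 2 * Real.pi := Real.two_pi_pos
  have parseval : ∀ r ∈ Ioi (0 : ℝ),
      ∫⁻ θ in Ioc (-Real.pi) Real.pi,
        ENNReal.ofReal r * ENNReal.ofReal (w ‖polarPt r θ‖ * ‖f (polarPt r θ)‖ ^ 2)
      = ENNReal.ofReal (2 * Real.pi) *
        ∑' m, ENNReal.ofReal (w r * r * ‖circleCoeff (v r) m‖ ^ 2) := fun r hr => by
    have hr0 : 0 < r := hr
    rw [tsum_ofReal_circleCoeff (hv r hr) (mul_nonneg (hw0 r hr) hr0.le), ← mul_assoc,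
      ← ENNReal.ofReal_mul hpi.le, mul_inv_cancel₀ hpi.ne', ENNReal.ofReal_one, one_mul]
    refine lintegral_congr fun θ => ?_
    rw [← ENNReal.ofReal_mul hr0.le, norm_polarPt, abs_of_pos hr0, hvf r hr]
    congr 1
    ring
  rw [lintegral_polarPt (by fun_prop), setLIntegral_congr_fun measurableSet_Ioi parseval,
    lintegral_const_mul' _ _ ENNReal.ofReal_ne_top, lintegral_tsum]
  exact fun m => by
    have := hvm m
    fun_prop

/-! ### The Hardy inequality for `∂₁ - i ∂₂` -/

/-- The first-order operator `∂₁ - i ∂₂`. -/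
def dz (f : Plane → ℂ) (x : Plane) : ℂ :=
  fderiv ℝ f x (EuclideanSpace.single 0 1) - Complex.I * fderiv ℝ f x (EuclideanSpace.single 1 1)

/-- The expression `∂_r f - (i / r) ∂_θ f` at the point with polar coordinates `(r, θ)`; it agrees
with `dz f` up to the phase `e^{iθ}`. -/
def polarDz (f : Plane → ℂ) (r θ : ℝ) : ℂ :=
  fderiv ℝ f (polarPt r θ) (polarPt 1 θ) -
    Complex.I / r * fderiv ℝ f (polarPt r θ) (polarTangent r θ)

theorem norm_polarDz (f : Plane → ℂ) {r : ℝ} (hr : 0 < r) (θ : ℝ) :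
    ‖polarDz f r θ‖ = ‖dz f (polarPt r θ)‖ := by
  have hr0 : (r : ℂ) ≠ 0 := by exact_mod_cast hr.ne'
  have phase : polarDz f r θ = Complex.exp (θ * Complex.I) * dz f (polarPt r θ) := by
    rw [polarDz, polarTangent, polarPt_eq 1, map_add, map_add, map_smul, map_smul, map_smul,
      map_smul, dz, Complex.exp_mul_I]
    simp only [Complex.real_smul]
    push_cast
    field_simp
    linear_combination (Complex.sin θ * fderiv ℝ f (polarPt r θ) (EuclideanSpace.single 1 1)) *
      Complex.I_sq
  rw [phase, norm_mul, Complex.norm_exp_ofReal_mul_I, one_mul]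

section dz

variable {f : Plane → ℂ}

theorem continuous_dz (hf : ContDiff ℝ 1 f) : Continuous (dz f) := by
  have := hf.continuous_fderiv one_ne_zero
  unfold dz
  fun_prop

/-- The angular Fourier coefficients of a function on the plane. -/
def angularMode (f : Plane → ℂ) (m : ℤ) (r : ℝ) : ℂ := circleCoeff (fun θ => f (polarPt r θ)) m

/-- The angular Fourier coefficients of the radial derivative. -/
def angularModeDeriv (f : Plane → ℂ) (m : ℤ) (r : ℝ) : ℂ :=
  circleCoeff (fun θ => fderiv ℝ f (polarPt r θ) (polarPt 1 θ)) m

theorem continuous_radialDeriv (hf : ContDiff ℝ 1 f) :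
    Continuous fun p : ℝ × ℝ => fderiv ℝ f (polarPt p.1 p.2) (polarPt 1 p.2) :=
  ((hf.continuous_fderiv one_ne_zero).comp continuous_polarPt).clm_apply
    (continuous_polarPt.comp (by fun_prop : Continuous fun p : ℝ × ℝ => ((1 : ℝ), p.2)))

theorem continuous_angularDeriv (hf : ContDiff ℝ 1 f) (r : ℝ) :
    Continuous fun θ => fderiv ℝ f (polarPt r θ) (polarTangent r θ) :=
  (continuous_comp_polarPt (hf.continuous_fderiv one_ne_zero) r).clm_apply
    (by unfold polarTangent; fun_prop)

theorem continuous_polarDz (hf : ContDiff ℝ 1 f) (r : ℝ) : Continuous (polarDz f r) :=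
  ((continuous_radialDeriv hf).comp (Continuous.prodMk_right r)).sub
    (continuous_const.mul (continuous_angularDeriv hf r))

theorem continuous_angularMode (hf : Continuous f) (m : ℤ) : Continuous (angularMode f m) :=
  continuous_circleCoeff (v := fun r θ => f (polarPt r θ)) (hf.comp continuous_polarPt) m

theorem continuous_angularModeDeriv (hf : ContDiff ℝ 1 f) (m : ℤ) :
    Continuous (angularModeDeriv f m) :=
  continuous_circleCoeff (v := fun r θ => fderiv ℝ f (polarPt r θ) (polarPt 1 θ))
    (continuous_radialDeriv hf) m

theorem hasDerivAt_angularMode (hf : ContDiff ℝ 1 f) (hc : HasCompactSupport f) (m : ℤ) (r : ℝ) :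
    HasDerivAt (angularMode f m) (angularModeDeriv f m r) r := by
  obtain ⟨M, hM⟩ := (hc.fderiv (𝕜 := ℝ)).exists_bound_of_continuous
    (hf.continuous_fderiv one_ne_zero)
  have ce : Continuous fun θ : ℝ => Complex.exp (-(m * θ * Complex.I)) := by fun_prop
  unfold angularMode angularModeDeriv circleCoeff
  refine HasDerivAt.fun_const_smul _ ?_
  refine (intervalIntegral.hasDerivAt_integral_of_dominated_loc_of_deriv_le (s := univ)
    (bound := fun _ => M)
    (F' := fun r θ => Complex.exp (-(m * θ * Complex.I)) *
      fderiv ℝ f (polarPt r θ) (polarPt 1 θ)) univ_mem ?_ ?_ ?_ ?_ ?_ ?_).2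
  · exact Eventually.of_forall fun r =>
      (ce.mul (continuous_comp_polarPt hf.continuous r)).aestronglyMeasurable
  · exact (ce.mul (continuous_comp_polarPt hf.continuous r)).intervalIntegrable _ _
  · exact (ce.mul ((continuous_radialDeriv hf).comp
      (Continuous.prodMk_right r))).aestronglyMeasurable
  · refine Eventually.of_forall fun θ _ r _ => ?_
    rw [norm_mul, Complex.norm_exp]
    have := (fderiv ℝ f (polarPt r θ)).le_opNorm (polarPt 1 θ)
    rw [norm_polarPt, abs_one, mul_one] at this
    simpa using this.trans (hM _)
  · exact _root_.intervalIntegrable_const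
  · refine Eventually.of_forall fun θ _ r _ => ?_
    have := ((hf.differentiable one_ne_zero).differentiableAt
      (x := polarPt r θ)).hasFDerivAt.comp_hasDerivAt r (hasDerivAt_polarPt_radius r θ)
    exact this.const_mul _

theorem tendsto_angularMode_zero (hf : Continuous f) {m : ℤ} (hm : m ≠ 0) :
    Tendsto (angularMode f m) (nhdsWithin 0 (Ioi 0)) (nhds 0) := by
  have center : ∀ θ, polarPt 0 θ = 0 := fun θ => by simp [polarPt_eq]
  have at_zero : angularMode f m 0 = 0 := by
    simp only [angularMode, center, circleCoeff_const hm]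
  exact at_zero ▸ ((continuous_angularMode hf m).tendsto 0).mono_left nhdsWithin_le_nhds

theorem exists_angularMode_eq_zero (hc : HasCompactSupport f) :
    ∃ R, ∀ m r, R ≤ r → angularMode f m r = 0 := by
  obtain ⟨R, hR⟩ := hc.isCompact.isBounded.subset_closedBall (0 : Plane)
  refine ⟨max R 0 + 1, fun m r hr => ?_⟩
  have vanish : ∀ θ, f (polarPt r θ) = 0 := fun θ => by
    refine image_eq_zero_of_notMem_tsupport fun h => ?_
    have := hR h
    rw [mem_closedBall_zero_iff, norm_polarPt] at this
    linarith [le_abs_self r, le_max_left R 0]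
  simp only [angularMode, vanish, circleCoeff_zero]

theorem circleCoeff_polarDz (hf : ContDiff ℝ 1 f) (m : ℤ) (r : ℝ) :
    circleCoeff (polarDz f r) m = angularModeDeriv f m r + ((m : ℝ) / r) • angularMode f m r := by
  have crad : Continuous fun θ => fderiv ℝ f (polarPt r θ) (polarPt 1 θ) :=
    (continuous_radialDeriv hf).comp (Continuous.prodMk_right r)
  unfold polarDz
  rw [circleCoeff_sub_const_mul crad (continuous_angularDeriv hf r),
    circleCoeff_deriv (v := fun θ => f (polarPt r θ)) _ (continuous_angularDeriv hf r)]
  · simp only [angularMode, angularModeDeriv, Complex.real_smul]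
    push_cast
    linear_combination (-(m : ℂ) / r * circleCoeff (fun θ => f (polarPt r θ)) m) * Complex.I_sq
  · simp [polarPt_eq]
  · exact fun θ => ((hf.differentiable one_ne_zero).differentiableAt
      (x := polarPt r θ)).hasFDerivAt.comp_hasDerivAt θ (hasDerivAt_polarPt_angle r θ)

theorem lintegral_hardyProfile_le_dz (hf : ContDiff ℝ 1 f) (hc : HasCompactSupport f) {α ρ : ℝ}
    (hρ : 0 < ρ) (hα : 0 ≤ α) :
    ∫⁻ x, ENNReal.ofReal (hardyProfile α ρ ‖x‖ * gPlus α ρ ‖x‖ ^ 2 * ‖f x‖ ^ 2) ≤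
      ∫⁻ x, ENNReal.ofReal (gPlus α ρ ‖x‖ ^ 2 * ‖dz f x‖ ^ 2) := by
  have hg : Measurable (gPlus α ρ) := (continuous_gPlus hρ α).measurable
  have hmode (m : ℤ) : Measurable (angularMode f m) :=
    (continuous_angularMode hf.continuous m).measurable
  have hderiv (m : ℤ) : Measurable (angularModeDeriv f m) :=
    (continuous_angularModeDeriv hf m).measurable
  obtain ⟨M, hM⟩ := hc.exists_bound_of_continuous hf.continuous
  obtain ⟨R, hR⟩ := exists_angularMode_eq_zero hc
  rw [lintegral_radial_mul_norm_sq (w := fun r => hardyProfile α ρ r * gPlus α ρ r ^ 2)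
      (v := fun r θ => f (polarPt r θ)) hf.continuous.measurable
      ((measurable_hardyProfile α ρ).mul (hg.pow_const 2))
      (fun r _ => mul_nonneg (hardyProfile_nonneg α ρ r) (sq_nonneg _))
      (fun r _ => continuous_comp_polarPt hf.continuous r) hmode (fun _ _ _ => rfl),
    lintegral_radial_mul_norm_sq (w := fun r => gPlus α ρ r ^ 2) (v := polarDz f)
      (continuous_dz hf).measurable (hg.pow_const 2) (fun r _ => sq_nonneg _)
      (fun r _ => continuous_polarDz hf r)
      (fun m => by
        simp only [circleCoeff_polarDz hf]
        exact (hderiv m).add ((measurable_const.div measurable_id).smul (hmode m)))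
      (fun r hr θ => norm_polarDz f hr θ)]
  simp only [circleCoeff_polarDz hf]
  refine mul_le_mul' le_rfl (ENNReal.tsum_le_tsum fun m => ?_)
  exact lintegral_hardyProfile_mode_le hρ hα m (fun r _ => hasDerivAt_angularMode hf hc m r)
    (continuous_angularModeDeriv hf m).continuousOn (hR m)
    (fun r _ => norm_circleCoeff_le (fun θ => hM _) m)
    (fun hm => tendsto_angularMode_zero hf.continuous hm)

end dz

/-- The classical partial derivative, as `partialDeriv`, of a function with values in a normed
space. -/
def pd {F : Type*} [NormedAddCommGroup F] [NormedSpace ℝ F] (j : Fin 2) (u : Plane → F)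
    (x : Plane) : F := fderiv ℝ u x (EuclideanSpace.single j 1)

theorem two_le_infty : (2 : ℕ∞ω) ≤ ((⊤ : ℕ∞) : ℕ∞ω) := WithTop.coe_le_coe.2 le_top

theorem one_le_infty : (1 : ℕ∞ω) ≤ ((⊤ : ℕ∞) : ℕ∞ω) := WithTop.coe_le_coe.2 le_top

section pd

variable {F : Type*} [NormedAddCommGroup F] [NormedSpace ℝ F]

theorem partialDeriv_eq_pd (j : Fin 2) (φ : Plane → ℝ) : partialDeriv j φ = pd j φ := rfl

theorem dz_eq_pd (f : Plane → ℂ) (x : Plane) : dz f x = pd 0 f x - Complex.I * pd 1 f x := rfl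

theorem contDiff_pd {u : Plane → F} (hu : ContDiff ℝ ∞ u) (j : Fin 2) : ContDiff ℝ ∞ (pd j u) := by
  unfold pd
  exact (hu.fderiv_right (m := ∞) (by simp)).clm_apply contDiff_const

theorem hasCompactSupport_pd {u : Plane → F} (hc : HasCompactSupport u) (j : Fin 2) :
    HasCompactSupport (pd j u) :=
  (hc.fderiv (𝕜 := ℝ)).comp_left (g := fun L : Plane →L[ℝ] F => L (EuclideanSpace.single j 1))
    (by simp)

theorem pd_comm {u : Plane → F} (hu : ContDiff ℝ ∞ u) (i j : Fin 2) (x : Plane) :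
    pd i (pd j u) x = pd j (pd i u) x := by
  have hd : DifferentiableAt ℝ (fderiv ℝ u) x :=
    (hu.fderiv_right (m := ∞) (by simp)).differentiable (by simp) |>.differentiableAt
  have iterated : ∀ k l : Fin 2, pd k (pd l u) x =
      fderiv ℝ (fderiv ℝ u) x (EuclideanSpace.single k 1) (EuclideanSpace.single l 1) := by
    intro k l
    unfold pd
    rw [fderiv_clm_apply hd (differentiableAt_const _)]
    simp
  rw [iterated, iterated]
  exact (hu.contDiffAt.isSymmSndFDerivAt (by
    rw [minSmoothness_of_isRCLikeNormedField]; exact two_le_infty)) _ _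

theorem fderiv_apply_eq_pd (u : Plane → F) (x v : Plane) :
    fderiv ℝ u x v = v 0 • pd 0 u x + v 1 • pd 1 u x := by
  have : v = v 0 • EuclideanSpace.single 0 1 + v 1 • EuclideanSpace.single 1 1 := by
    ext i; fin_cases i <;> simp
  conv_lhs => rw [this]
  simp [pd]

theorem pd_add {u v : Plane → F} (hu : Differentiable ℝ u) (hv : Differentiable ℝ v) (j : Fin 2)
    (x : Plane) : pd j (fun y => u y + v y) x = pd j u x + pd j v x := by
  unfold pd
  rw [fderiv_fun_add (hu x) (hv x)]; rfl

theorem pd_sub {u v : Plane → F} (hu : Differentiable ℝ u) (hv : Differentiable ℝ v) (j : Fin 2)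
    (x : Plane) : pd j (fun y => u y - v y) x = pd j u x - pd j v x := by
  unfold pd
  rw [fderiv_fun_sub (hu x) (hv x)]; rfl

end pd

theorem pd_conj (u : Plane → ℂ) (j : Fin 2) (x : Plane) :
    pd j (fun y => (starRingEnd ℂ) (u y)) x = (starRingEnd ℂ) (pd j u x) := by
  unfold pd
  have : (fun y => (starRingEnd ℂ) (u y)) = Complex.conjCLE ∘ u := by ext; simp
  rw [this, ContinuousLinearEquiv.comp_fderiv]
  simp

theorem pd_norm_sq {u : Plane → ℂ} {x : Plane} (hu : DifferentiableAt ℝ u x) (j : Fin 2) :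
    pd j (fun y => ‖u y‖ ^ 2) x = 2 * ((starRingEnd ℂ) (u x) * pd j u x).re := by
  unfold pd
  rw [hu.hasFDerivAt.norm_sq.fderiv]
  simp [Complex.inner]
  ring

theorem norm_sq_dz_sub (u : Plane → ℂ) {x : Plane} (hu : DifferentiableAt ℝ u x) (a : Plane) :
    ‖dz u x - Complex.I * (a 0 - Complex.I * a 1) * u x‖ ^ 2 =
      (∑ j, ‖Complex.I * pd j u x + (a j : ℂ) * u x‖ ^ 2) +
        (a 0 * pd 1 (fun y => ‖u y‖ ^ 2) x - a 1 * pd 0 (fun y => ‖u y‖ ^ 2) x) +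
        2 * ((starRingEnd ℂ) (pd 0 u x) * pd 1 u x).im := by
  rw [pd_norm_sq hu, pd_norm_sq hu, dz_eq_pd]
  simp only [Fin.sum_univ_two, ← Complex.normSq_eq_norm_sq, Complex.normSq_apply]
  simp
  ring

theorem integral_mul_pd {𝕜 : Type*} [NormedField 𝕜] [NormedAlgebra ℝ 𝕜] {p q : Plane → 𝕜}
    (hp : ContDiff ℝ ∞ p) (hq : ContDiff ℝ ∞ q) (hc : HasCompactSupport p) (j : Fin 2) :
    ∫ x, p x * pd j q x = -∫ x, pd j p x * q x := by
  refine integral_mul_fderiv_eq_neg_fderiv_mul_of_integrable ?_ ?_ ?_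
    (fun x _ => hp.differentiable (by simp) |>.differentiableAt)
    (fun x _ => hq.differentiable (by simp) |>.differentiableAt)
  · exact ((contDiff_pd hp j).continuous.mul hq.continuous).integrable_of_hasCompactSupport
      (hasCompactSupport_pd hc j).mul_right
  · exact (hp.continuous.mul (contDiff_pd hq j).continuous).integrable_of_hasCompactSupport
      hc.mul_right
  · exact (hp.continuous.mul hq.continuous).integrable_of_hasCompactSupport hc.mul_right

theorem integral_pd_mul_pd_comm {p q : Plane → ℂ} (hp : ContDiff ℝ ∞ p) (hq : ContDiff ℝ ∞ q)
    (hc : HasCompactSupport p) (i j : Fin 2) :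
    ∫ x, pd i p x * pd j q x = ∫ x, pd j p x * pd i q x := by
  have swap := integral_mul_pd hp (contDiff_pd hq j) hc i
  simp_rw [pd_comm hq i j] at swap
  exact neg_injective (swap.symm.trans (integral_mul_pd hp (contDiff_pd hq i) hc j))

theorem integral_im_conj_pd_mul_pd {u : Plane → ℂ} (hu : ContDiff ℝ ∞ u)
    (hc : HasCompactSupport u) :
    ∫ x, ((starRingEnd ℂ) (pd 0 u x) * pd 1 u x).im = 0 := by
  have comm := integral_pd_mul_pd_comm (p := fun y => (starRingEnd ℂ) (u y))
    (Complex.conjCLE.contDiff.comp hu) hu (hc.comp_left (g := starRingEnd ℂ) (by simp)) 0 1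
  simp_rw [pd_conj] at comm
  have hint : Integrable fun x => (starRingEnd ℂ) (pd 0 u x) * pd 1 u x :=
    ((Complex.continuous_conj.comp (contDiff_pd hu 0).continuous).mul
      (contDiff_pd hu 1).continuous).integrable_of_hasCompactSupport
        ((hasCompactSupport_pd hc 1).mul_left)
  have im_integral := integral_im hint
  simp only [RCLike.im_to_complex] at im_integral
  rw [im_integral, ← Complex.conj_eq_iff_im, ← integral_conj, comm]
  refine integral_congr_ae (Eventually.of_forall fun x => ?_)
  simp [mul_comm]

theorem exists_potential_of_closed {c d : Plane → ℝ} (hc : ContDiff ℝ 1 c) (hd : ContDiff ℝ 1 d)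
    (hclosed : ∀ x, pd 1 c x = pd 0 d x) :
    ∃ χ : Plane → ℝ, ContDiff ℝ 1 χ ∧ (∀ x, pd 0 χ x = c x) ∧ ∀ x, pd 1 χ x = d x := by
  set P : Fin 2 → Plane →L[ℝ] ℝ := fun j => EuclideanSpace.proj j
  set η : Plane → Plane →L[ℝ] ℝ := fun x => c x • P 0 + d x • P 1 with hη
  have contDiff_η : ContDiff ℝ 1 η := (hc.smul contDiff_const).add (hd.smul contDiff_const)
  have fderiv_η (x : Plane) :
      fderiv ℝ η x = (fderiv ℝ c x).smulRight (P 0) + (fderiv ℝ d x).smulRight (P 1) :=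
    (((hc.differentiable (by simp) x).hasFDerivAt.smul_const (P 0)).add
      ((hd.differentiable (by simp) x).hasFDerivAt.smul_const (P 1))).fderiv
  obtain ⟨χ, hχ⟩ : ∃ χ : Plane → ℝ, ∀ x ∈ univ, HasFDerivAt χ (η x) x := by
    refine convex_univ.exists_forall_hasFDerivAt_of_fderiv_symmetric isOpen_univ
      (contDiff_η.differentiable (by simp)).differentiableOn fun x _ v w => ?_
    rw [fderiv_η]
    simp only [add_apply, ContinuousLinearMap.smulRight_apply, smul_apply, fderiv_apply_eq_pd,
      smul_eq_mul, hclosed, P, PiLp.proj_apply]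
    ring
  have fderiv_χ : fderiv ℝ χ = η := by ext1 x; exact (hχ x trivial).fderiv
  refine ⟨χ, contDiff_one_iff_fderiv.2
    ⟨fun x => (hχ x trivial).differentiableAt, fderiv_χ ▸ contDiff_η.continuous⟩, fun x => ?_,
    fun x => ?_⟩ <;>
  simp [pd, fderiv_χ, hη, P]

theorem dz_ofReal_sub_I_mul {h χ : Plane → ℝ} {x : Plane} (hh : DifferentiableAt ℝ h x)
    (hχ : DifferentiableAt ℝ χ x) :
    dz (fun y => (h y : ℂ) - Complex.I * χ y) x =
      (pd 0 h x - pd 1 χ x : ℝ) - Complex.I * (pd 0 χ x + pd 1 h x : ℝ) := by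
  have hasFDerivAt_h : HasFDerivAt (fun y => (h y : ℂ)) (Complex.ofRealCLM ∘L fderiv ℝ h x) x :=
    Complex.ofRealCLM.hasFDerivAt.comp x hh.hasFDerivAt
  have hasFDerivAt_χ : HasFDerivAt (fun y => (χ y : ℂ)) (Complex.ofRealCLM ∘L fderiv ℝ χ x) x :=
    Complex.ofRealCLM.hasFDerivAt.comp x hχ.hasFDerivAt
  rw [dz, (hasFDerivAt_h.fun_sub (hasFDerivAt_χ.const_mul Complex.I)).fderiv]
  simp only [sub_apply, smul_apply, ContinuousLinearMap.comp_apply, Complex.ofRealCLM_apply,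
    smul_eq_mul, pd]
  push_cast
  ring_nf
  simp only [Complex.I_sq]
  ring

theorem exists_complex_potential {a : Plane → Plane} {h : Plane → ℝ}
    (ha : ∀ j, ContDiff ℝ ∞ fun x => a x j) (hh : ContDiff ℝ ∞ h)
    (hcurl : ∀ x, pd 0 (fun y => a y 1) x - pd 1 (fun y => a y 0) x +
      (pd 0 (pd 0 h) x + pd 1 (pd 1 h) x) = 0) :
    ∃ Ψ : Plane → ℂ, ContDiff ℝ 1 Ψ ∧ (∀ x, (Ψ x).re = h x) ∧
      ∀ x, dz Ψ x = -Complex.I * (a x 0 - Complex.I * a x 1) := by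
  have hclosed (x : Plane) :
      pd 1 (fun y => a y 0 - pd 1 h y) x = pd 0 (fun y => a y 1 + pd 0 h y) x := by
    rw [pd_sub ((ha 0).differentiable (by simp)) ((contDiff_pd hh 1).differentiable (by simp)),
      pd_add ((ha 1).differentiable (by simp)) ((contDiff_pd hh 0).differentiable (by simp))]
    linarith [hcurl x]
  obtain ⟨χ, contDiff_χ, pd_zero_χ, pd_one_χ⟩ := exists_potential_of_closed
    (((ha 0).sub (contDiff_pd hh 1)).of_le one_le_infty)
    (((ha 1).add (contDiff_pd hh 0)).of_le one_le_infty) hclosed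
  refine ⟨fun x => (h x : ℂ) - Complex.I * χ x, ?_, fun x => by simp, fun x => ?_⟩
  · exact (Complex.ofRealCLM.contDiff.comp (hh.of_le one_le_infty)).sub
      (contDiff_const.mul (Complex.ofRealCLM.contDiff.comp contDiff_χ))
  · rw [dz_ofReal_sub_I_mul (hh.differentiable (by simp) x) (contDiff_χ.differentiable (by simp) x),
      pd_zero_χ, pd_one_χ]
    push_cast
    ring_nf
    simp only [Complex.I_sq]
    ring

theorem integrable_hardyProfile_mul {α ρ : ℝ} (hρ : 0 < ρ) {φ : Plane → ℝ} (hφ : Integrable φ) :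
    Integrable fun x => hardyProfile α ρ ‖x‖ * φ x := by
  refine hφ.bdd_mul (c := 1 / ρ ^ 2) ?_ ?_
  · exact ((measurable_hardyProfile α ρ).comp measurable_norm).aestronglyMeasurable
  · refine Eventually.of_forall fun x => ?_
    rw [Real.norm_of_nonneg (hardyProfile_nonneg _ _ _)]
    exact hardyProfile_le hρ

/-- The density of the quadratic form of `(i∇ + a)² + curl a`, the curl being tested against
`|u|²`. -/
def formDensity (a : Plane → Plane) (u : Plane → ℂ) (x : Plane) : ℝ :=
  (∑ j, ‖Complex.I * pd j u x + (a x j : ℂ) * u x‖ ^ 2) +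
    (a x 0 * pd 1 (fun y => ‖u y‖ ^ 2) x - a x 1 * pd 0 (fun y => ‖u y‖ ^ 2) x)

theorem hasCompactSupport_norm_sq {u : Plane → ℂ} (hc : HasCompactSupport u) :
    HasCompactSupport fun x => ‖u x‖ ^ 2 :=
  hc.comp_left (g := fun z : ℂ => ‖z‖ ^ 2) (by simp)

theorem integrable_norm_sq {u : Plane → ℂ} (hu : Continuous u) (hc : HasCompactSupport u) :
    Integrable fun x => ‖u x‖ ^ 2 :=
  (hu.norm.pow 2).integrable_of_hasCompactSupport (hasCompactSupport_norm_sq hc)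

theorem norm_sq_dz_sub_le {a : Plane} {C : ℝ} (ha : ‖a‖ ≤ C) (u : Plane → ℂ) (x : Plane) :
    ‖dz u x - Complex.I * (a 0 - Complex.I * a 1) * u x‖ ^ 2 ≤
      (‖pd 0 u x‖ + ‖pd 1 u x‖ + 2 * C * ‖u x‖) ^ 2 := by
  refine pow_le_pow_left₀ (norm_nonneg _) ?_ 2
  have abs_zero_le : |a 0| ≤ C := (PiLp.norm_apply_le a 0).trans ha
  have abs_one_le : |a 1| ≤ C := (PiLp.norm_apply_le a 1).trans ha
  refine (norm_sub_le _ _).trans (add_le_add ?_ ?_)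
  · rw [dz_eq_pd]
    refine (norm_sub_le _ _).trans ?_
    simp
  · rw [norm_mul, norm_mul, Complex.norm_I, one_mul]
    refine mul_le_mul_of_nonneg_right ((norm_sub_le _ _).trans ?_) (norm_nonneg _)
    rw [norm_mul, Complex.norm_I, one_mul, Complex.norm_real, Complex.norm_real]
    simp only [Real.norm_eq_abs]
    linarith

theorem integrable_dz_sub_majorant (C : ℝ) {u : Plane → ℂ} (hu : ContDiff ℝ ∞ u)
    (hc : HasCompactSupport u) :
    Integrable fun x => (‖pd 0 u x‖ + ‖pd 1 u x‖ + 2 * C * ‖u x‖) ^ 2 := by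
  have continuous_pd_zero := (contDiff_pd hu 0).continuous
  have continuous_pd_one := (contDiff_pd hu 1).continuous
  have continuous_u := hu.continuous
  refine Continuous.integrable_of_hasCompactSupport (by fun_prop) ?_
  exact (((hasCompactSupport_pd hc 0).norm.add (hasCompactSupport_pd hc 1).norm).add
    (hc.norm.mul_left (f := fun _ => 2 * C))).comp_left (g := fun t : ℝ => t ^ 2) (by simp)

theorem integrable_norm_sq_dz_sub {a : Plane → Plane} (ham : AEStronglyMeasurable a) {C : ℝ}
    (haC : ∀ᵐ x, ‖a x‖ ≤ C) {u : Plane → ℂ} (hu : ContDiff ℝ ∞ u) (hc : HasCompactSupport u) :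
    Integrable fun x => ‖dz u x - Complex.I * (a x 0 - Complex.I * a x 1) * u x‖ ^ 2 := by
  have coord (j : Fin 2) : AEStronglyMeasurable fun x => ((a x j : ℝ) : ℂ) :=
    Complex.continuous_ofReal.comp_aestronglyMeasurable
      ((EuclideanSpace.proj (𝕜 := ℝ) j).continuous.comp_aestronglyMeasurable ham)
  have dz_u : AEStronglyMeasurable (dz u) :=
    (continuous_dz (hu.of_le one_le_infty)).aestronglyMeasurable
  refine (integrable_dz_sub_majorant C hu hc).mono' ?_ ?_
  · exact ((dz_u.sub ((((coord 0).sub ((coord 1).const_mul Complex.I)).const_mul Complex.I).mul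
      hu.continuous.aestronglyMeasurable)).norm.pow 2)
  · filter_upwards [haC] with x hx
    rw [norm_pow, norm_norm]
    exact norm_sq_dz_sub_le hx u x

theorem integrable_im_conj_pd_mul_pd {u : Plane → ℂ} (hu : ContDiff ℝ ∞ u)
    (hc : HasCompactSupport u) :
    Integrable fun x => ((starRingEnd ℂ) (pd 0 u x) * pd 1 u x).im :=
  (Continuous.integrable_of_hasCompactSupport
    ((Complex.continuous_conj.comp (contDiff_pd hu 0).continuous).mul
      (contDiff_pd hu 1).continuous)
        ((hasCompactSupport_pd hc 1).mul_left)).im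

theorem formDensity_eq (a : Plane → Plane) {u : Plane → ℂ} (hu : ContDiff ℝ ∞ u) (x : Plane) :
    formDensity a u x = ‖dz u x - Complex.I * (a x 0 - Complex.I * a x 1) * u x‖ ^ 2 -
      2 * ((starRingEnd ℂ) (pd 0 u x) * pd 1 u x).im := by
  rw [norm_sq_dz_sub u (hu.differentiable (by simp) x), formDensity]; ring

theorem integrable_formDensity {a : Plane → Plane} (ham : AEStronglyMeasurable a) {C : ℝ}
    (haC : ∀ᵐ x, ‖a x‖ ≤ C) {u : Plane → ℂ} (hu : ContDiff ℝ ∞ u) (hc : HasCompactSupport u) :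
    Integrable (formDensity a u) := by
  rw [funext (formDensity_eq a hu)]
  exact (integrable_norm_sq_dz_sub ham haC hu hc).sub
    ((integrable_im_conj_pd_mul_pd hu hc).const_mul 2)

theorem integral_formDensity {a : Plane → Plane} (ham : AEStronglyMeasurable a) {C : ℝ}
    (haC : ∀ᵐ x, ‖a x‖ ≤ C) {u : Plane → ℂ} (hu : ContDiff ℝ ∞ u) (hc : HasCompactSupport u) :
    ∫ x, formDensity a u x =
      ∫ x, ‖dz u x - Complex.I * (a x 0 - Complex.I * a x 1) * u x‖ ^ 2 := by
  simp_rw [formDensity_eq a hu]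
  rw [integral_sub (integrable_norm_sq_dz_sub ham haC hu hc)
    ((integrable_im_conj_pd_mul_pd hu hc).const_mul 2), integral_const_mul,
    integral_im_conj_pd_mul_pd hu hc]
  simp

theorem mul_integral_le_of_lintegral_mul_le {X : Type*} [MeasurableSpace X] {μ : Measure X}
    {V E w : X → ℝ} {m M : ℝ} (hm : 0 ≤ m) (hmw : ∀ x, m ≤ w x) (hwM : ∀ x, w x ≤ M)
    (hV : Integrable V μ) (hE : Integrable E μ) (hV₀ : ∀ x, 0 ≤ V x) (hE₀ : ∀ x, 0 ≤ E x)
    (hVE : ∫⁻ x, ENNReal.ofReal (w x * V x) ∂μ ≤ ∫⁻ x, ENNReal.ofReal (w x * E x) ∂μ) :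
    m * ∫ x, V x ∂μ ≤ M * ∫ x, E x ∂μ := by
  have hME (x : X) : 0 ≤ M * E x :=
    mul_nonneg ((hm.trans (hmw x)).trans (hwM x)) (hE₀ x)
  rw [← integral_const_mul, ← integral_const_mul,
    ← ENNReal.ofReal_le_ofReal_iff (integral_nonneg hME),
    ofReal_integral_eq_lintegral_ofReal (hV.const_mul m)
      (Eventually.of_forall fun x => mul_nonneg hm (hV₀ x)),
    ofReal_integral_eq_lintegral_ofReal (hE.const_mul M) (Eventually.of_forall hME)]
  calc ∫⁻ x, ENNReal.ofReal (m * V x) ∂μ ≤ ∫⁻ x, ENNReal.ofReal (w x * V x) ∂μ :=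
        lintegral_mono fun x =>
          ENNReal.ofReal_le_ofReal (mul_le_mul_of_nonneg_right (hmw x) (hV₀ x))
    _ ≤ ∫⁻ x, ENNReal.ofReal (w x * E x) ∂μ := hVE
    _ ≤ ∫⁻ x, ENNReal.ofReal (M * E x) ∂μ := lintegral_mono fun x =>
          ENNReal.ofReal_le_ofReal (mul_le_mul_of_nonneg_right (hwM x) (hE₀ x))

theorem dz_exp_mul {Ψ u : Plane → ℂ} {x : Plane} (hΨ : DifferentiableAt ℝ Ψ x)
    (hu : DifferentiableAt ℝ u x) :
    dz (fun x => Complex.exp (Ψ x) * u x) x = Complex.exp (Ψ x) * (dz u x + dz Ψ x * u x) := by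
  rw [dz, (hΨ.hasFDerivAt.cexp.fun_mul hu.hasFDerivAt).fderiv]
  simp only [add_apply, smul_apply, smul_eq_mul, dz]
  ring

theorem lintegral_hardyProfile_le_ground_state {a : Plane → Plane} {h : Plane → ℝ}
    (ha : ∀ j, ContDiff ℝ ∞ fun x => a x j) (hh : ContDiff ℝ ∞ h)
    (hcurl : ∀ x, pd 0 (fun y => a y 1) x - pd 1 (fun y => a y 0) x +
      (pd 0 (pd 0 h) x + pd 1 (pd 1 h) x) = 0)
    {α ρ : ℝ} (hρ : 0 < ρ) (hα : 0 ≤ α)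
    {u : Plane → ℂ} (hu : ContDiff ℝ 1 u) (hc : HasCompactSupport u) :
    ∫⁻ x, ENNReal.ofReal ((gPlus α ρ ‖x‖ / Real.exp (-h x)) ^ 2 *
        (hardyProfile α ρ ‖x‖ * ‖u x‖ ^ 2)) ≤
      ∫⁻ x, ENNReal.ofReal ((gPlus α ρ ‖x‖ / Real.exp (-h x)) ^ 2 *
        ‖dz u x - Complex.I * (a x 0 - Complex.I * a x 1) * u x‖ ^ 2) := by
  obtain ⟨Ψ, contDiff_Ψ, re_Ψ, dz_Ψ⟩ := exists_complex_potential ha hh hcurl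
  have hardy := lintegral_hardyProfile_le_dz (contDiff_Ψ.cexp.mul hu) (hc.mul_left) hρ hα
  have norm_exp_Ψ (x : Plane) : ‖Complex.exp (Ψ x)‖ = (Real.exp (-h x))⁻¹ := by
    rw [Complex.norm_exp, re_Ψ, Real.exp_neg, inv_inv]
  have dz_f (x : Plane) : dz (fun y => Complex.exp (Ψ y) * u y) x =
      Complex.exp (Ψ x) * (dz u x - Complex.I * (a x 0 - Complex.I * a x 1) * u x) := by
    rw [dz_exp_mul (contDiff_Ψ.differentiable one_ne_zero x) (hu.differentiable one_ne_zero x),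
      dz_Ψ]
    ring
  calc _ = _ := lintegral_congr fun x => by rw [norm_mul, norm_exp_Ψ]; ring_nf
    _ ≤ _ := hardy
    _ = _ := lintegral_congr fun x => by rw [dz_f, norm_mul, norm_exp_Ψ]; ring_nf

theorem hardy_smooth {a : Plane → Plane} {h : Plane → ℝ}
    (ha : ∀ j, ContDiff ℝ ∞ fun x => a x j) (hh : ContDiff ℝ ∞ h)
    (hcurl : ∀ x, pd 0 (fun y => a y 1) x - pd 1 (fun y => a y 0) x +
      (pd 0 (pd 0 h) x + pd 1 (pd 1 h) x) = 0)
    (ham : AEStronglyMeasurable a) {C : ℝ} (haC : ∀ᵐ x, ‖a x‖ ≤ C)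
    {α ρ k K : ℝ} (hρ : 0 < ρ) (hα : 0 ≤ α) (hk : 0 < k) (hK : 0 < K)
    (hkg : ∀ x, k * gPlus α ρ ‖x‖ ≤ Real.exp (-h x))
    (hKg : ∀ x, Real.exp (-h x) ≤ K * gPlus α ρ ‖x‖)
    {u : Plane → ℂ} (hu : ContDiff ℝ ∞ u) (hc : HasCompactSupport u) :
    (k / K) ^ 2 * ∫ x, hardyProfile α ρ ‖x‖ * ‖u x‖ ^ 2 ≤ ∫ x, formDensity a u x := by
  have inv_le (x : Plane) : K⁻¹ ≤ gPlus α ρ ‖x‖ / Real.exp (-h x) := by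
    rw [inv_eq_one_div, div_le_div_iff₀ hK (Real.exp_pos _)]
    linarith [hKg x]
  have le_inv (x : Plane) : gPlus α ρ ‖x‖ / Real.exp (-h x) ≤ k⁻¹ := by
    rw [inv_eq_one_div, div_le_div_iff₀ (Real.exp_pos _) hk]
    linarith [hkg x]
  have transfer := mul_integral_le_of_lintegral_mul_le (sq_nonneg K⁻¹)
    (fun x => pow_le_pow_left₀ (inv_nonneg.2 hK.le) (inv_le x) 2)
    (fun x => pow_le_pow_left₀ ((inv_nonneg.2 hK.le).trans (inv_le x)) (le_inv x) 2)
    (integrable_hardyProfile_mul hρ (integrable_norm_sq hu.continuous hc))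
    (integrable_norm_sq_dz_sub ham haC hu hc)
    (fun x => mul_nonneg (hardyProfile_nonneg _ _ _) (sq_nonneg _)) (fun x => sq_nonneg _)
    (lintegral_hardyProfile_le_ground_state ha hh hcurl hρ hα (hu.of_le one_le_infty) hc)
  rw [integral_formDensity ham haC hu hc]
  calc _ = k ^ 2 * (K⁻¹ ^ 2 * ∫ x, hardyProfile α ρ ‖x‖ * ‖u x‖ ^ 2) := by field_simp
    _ ≤ k ^ 2 * (k⁻¹ ^ 2 *
        ∫ x, ‖dz u x - Complex.I * (a x 0 - Complex.I * a x 1) * u x‖ ^ 2) := by gcongr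
    _ = _ := by field_simp

/-! ### The fundamental solution of the Laplacian in the plane -/

theorem integral_polarPt {E : Type*} [NormedAddCommGroup E] [NormedSpace ℝ E] (F : Plane → E) :
    ∫ x, F x = ∫ p in Ioi 0 ×ˢ Ioo (-Real.pi) Real.pi, p.1 • F (polarPt p.1 p.2) := by
  let toPlane : ℂ ≃ₗᵢ[ℝ] Plane := Complex.orthonormalBasisOneI.repr
  calc ∫ x, F x = ∫ z, F (toPlane z) :=
        (toPlane.measurePreserving.integral_comp
          toPlane.toHomeomorph.measurableEmbedding F).symm
    _ = _ := by
      rw [← Complex.integral_comp_polarCoord_symm, polarCoord_target]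
      rfl

theorem polarPt_eq_smul (r θ : ℝ) : polarPt r θ = r • polarPt 1 θ := by
  simp [polarPt_eq, smul_smul]

section radialDerivative

variable {E : Type*} [NormedAddCommGroup E] [NormedSpace ℝ E] {f : Plane → E}

theorem integral_Ioi_fderiv_polarPt [CompleteSpace E] (hf : ContDiff ℝ 1 f)
    (hc : HasCompactSupport f) (θ : ℝ) :
    ∫ r in Ioi 0, fderiv ℝ f (polarPt r θ) (polarPt 1 θ) = -f 0 := by
  have ray_eq : (fun r => polarPt r θ) = fun r => r • polarPt 1 θ :=
    funext fun r => polarPt_eq_smul r θ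
  have contDiff_ray : ContDiff ℝ 1 fun r => polarPt r θ :=
    ray_eq ▸ contDiff_id.smul contDiff_const
  have deriv_ray (r : ℝ) :
      deriv (fun r => f (polarPt r θ)) r = fderiv ℝ f (polarPt r θ) (polarPt 1 θ) :=
    ((hf.differentiable one_ne_zero _).hasFDerivAt.comp_hasDerivAt r
      (hasDerivAt_polarPt_radius r θ)).deriv
  have isometry_ray : Isometry fun r => polarPt r θ := Isometry.of_dist_eq fun r s => by
    rw [polarPt_eq_smul r, polarPt_eq_smul s, dist_eq_norm, ← sub_smul, norm_smul, norm_polarPt,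
      abs_one, mul_one, Real.dist_eq, Real.norm_eq_abs]
  have fundamental : ∫ r in Ioi 0, deriv (fun r => f (polarPt r θ)) r = -f (polarPt 0 θ) :=
    HasCompactSupport.integral_Ioi_deriv_eq (hf.comp contDiff_ray)
      (hc.comp_isClosedEmbedding isometry_ray.isClosedEmbedding) 0
  rw [polarPt_eq_smul, zero_smul] at fundamental
  simpa only [deriv_ray] using fundamental

theorem integrableOn_fderiv_polarPt (hf : ContDiff ℝ 1 f) (hc : HasCompactSupport f) :
    IntegrableOn (fun p : ℝ × ℝ => fderiv ℝ f (polarPt p.1 p.2) (polarPt 1 p.2))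
      (Ioi 0 ×ˢ Ioo (-Real.pi) Real.pi) := by
  obtain ⟨R, hR⟩ := (hc.fderiv (𝕜 := ℝ)).isCompact.isBounded.subset_closedBall (0 : Plane)
  have continuous_integrand :
      Continuous fun p : ℝ × ℝ => fderiv ℝ f (polarPt p.1 p.2) (polarPt 1 p.2) :=
    ((hf.continuous_fderiv one_ne_zero).comp continuous_polarPt).clm_apply
      (continuous_polarPt.comp (by fun_prop : Continuous fun p : ℝ × ℝ => ((1 : ℝ), p.2)))
  refine IntegrableOn.of_forall_sdiff_eq_zero (s := Icc 0 R ×ˢ Icc (-Real.pi) Real.pi)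
    (continuous_integrand.continuousOn.integrableOn_compact (isCompact_Icc.prod isCompact_Icc))
    (measurableSet_Ioi.prod measurableSet_Ioo) ?_
  rintro ⟨r, θ⟩ ⟨⟨hr, hθ⟩, hout⟩
  have lt_r : R < r := by
    by_contra! hle
    exact hout ⟨⟨(mem_Ioi.1 hr).le, hle⟩, Ioo_subset_Icc_self hθ⟩
  have vanish : fderiv ℝ f (polarPt r θ) = 0 := image_eq_zero_of_notMem_tsupport fun hmem => by
    have := hR hmem
    rw [mem_closedBall_zero_iff, norm_polarPt] at this
    linarith [le_abs_self r]
  simp [vanish]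

theorem integral_radial_deriv [CompleteSpace E] (hf : ContDiff ℝ 1 f) (hc : HasCompactSupport f) :
    ∫ x : Plane, (‖x‖ ^ 2)⁻¹ • fderiv ℝ f x x = -(2 * Real.pi) • f 0 := by
  have polar_integrand : ∀ p ∈ Ioi (0 : ℝ) ×ˢ Ioo (-Real.pi) Real.pi,
      p.1 • (‖polarPt p.1 p.2‖ ^ 2)⁻¹ • fderiv ℝ f (polarPt p.1 p.2) (polarPt p.1 p.2) =
        fderiv ℝ f (polarPt p.1 p.2) (polarPt 1 p.2) := by
    rintro ⟨r, θ⟩ ⟨hr, -⟩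
    have r_ne_zero : r ≠ 0 := (mem_Ioi.1 hr).ne'
    calc r • (‖polarPt r θ‖ ^ 2)⁻¹ • fderiv ℝ f (polarPt r θ) (polarPt r θ) =
          r • (r ^ 2)⁻¹ • fderiv ℝ f (polarPt r θ) (r • polarPt 1 θ) := by
          rw [norm_polarPt, sq_abs, ← polarPt_eq_smul]
      _ = (r * (r ^ 2)⁻¹ * r) • fderiv ℝ f (polarPt r θ) (polarPt 1 θ) := by
          rw [map_smul, smul_smul, smul_smul]
      _ = _ := by
          rw [show r * (r ^ 2)⁻¹ * r = 1 by field_simp, one_smul]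
  have integrable := integrableOn_fderiv_polarPt hf hc
  rw [integral_polarPt, setIntegral_congr_fun (measurableSet_Ioi.prod measurableSet_Ioo)
    polar_integrand]
  rw [IntegrableOn, Measure.volume_eq_prod, ← Measure.prod_restrict] at integrable
  rw [Measure.volume_eq_prod, ← Measure.prod_restrict, integral_prod_symm _ integrable]
  simp only [integral_Ioi_fderiv_polarPt hf hc, integral_const, smul_neg, neg_smul]
  congr 2
  rw [measureReal_restrict_apply MeasurableSet.univ, univ_inter, Real.volume_real_Ioo_of_le
    (by linarith [Real.pi_pos])]
  ring

theorem norm_radial_le (f : Plane → E) (x : Plane) {δ : ℝ} (hδ : 0 ≤ δ) :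
    ‖(‖x‖ ^ 2 + δ)⁻¹ • fderiv ℝ f x x‖ ≤ ‖x‖⁻¹ * ‖fderiv ℝ f x‖ := by
  rcases eq_or_ne x 0 with rfl | hx
  · simp
  · have : 0 < ‖x‖ := norm_pos_iff.2 hx
    rw [norm_smul, Real.norm_of_nonneg (by positivity)]
    calc _ ≤ (‖x‖ ^ 2)⁻¹ * (‖fderiv ℝ f x‖ * ‖x‖) := by
          gcongr
          · linarith
          · exact (fderiv ℝ f x).le_opNorm x
      _ = _ := by field_simp

end radialDerivative

theorem integrableOn_inv_norm (R : ℝ) :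
    IntegrableOn (fun x : Plane => ‖x‖⁻¹) (Metric.closedBall 0 R) := by
  rw [← integrable_indicator_iff Metric.isClosed_closedBall.measurableSet]
  have radial : (Metric.closedBall (0 : Plane) R).indicator (fun x => ‖x‖⁻¹) =
      fun x => (Iic R).indicator (fun r : ℝ => r⁻¹) ‖x‖ := by
    ext x
    simp [indicator]
  rw [radial, integrable_fun_norm_addHaar]
  simp only [finrank_euclideanSpace, Fintype.card_fin, Nat.add_one_sub_one, pow_one, smul_eq_mul]
  have : IntegrableOn (fun _ : ℝ => (1 : ℝ)) (Ioc 0 R) := by simp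
  refine (this.integrable_indicator measurableSet_Ioc).integrableOn.congr_fun
    (fun r hr => ?_) measurableSet_Ioi
  have r_pos : 0 < r := hr
  by_cases hrR : r ≤ R <;> simp [indicator, hrR, r_pos, r_pos.ne']

theorem integrable_inv_norm_mul {g : Plane → ℝ} (hg : Continuous g) (hc : HasCompactSupport g) :
    Integrable fun x : Plane => ‖x‖⁻¹ * g x := by
  obtain ⟨M, hM⟩ := hc.exists_bound_of_continuous hg
  obtain ⟨R, hR⟩ := hc.isCompact.isBounded.subset_closedBall (0 : Plane)
  rw [← integrableOn_iff_integrable_of_support_subset (s := Metric.closedBall (0 : Plane) R)]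
  · exact (integrableOn_inv_norm R).mul_bdd (c := M) hg.aestronglyMeasurable
      (Eventually.of_forall hM)
  · exact (Function.support_mul_subset_right _ _).trans ((subset_tsupport _).trans hR)

theorem ae_ne_zero : ∀ᵐ x : Plane, x ≠ 0 := by
  simp [ae_iff, measure_singleton]

theorem tendsto_integral_radial_deriv {f : Plane → ℝ} (hf : ContDiff ℝ 1 f)
    (hc : HasCompactSupport f) :
    Tendsto (fun δ : ℝ => ∫ x : Plane, (‖x‖ ^ 2 + δ)⁻¹ • fderiv ℝ f x x) (nhdsWithin 0 (Ioi 0))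
      (nhds (∫ x : Plane, (‖x‖ ^ 2)⁻¹ • fderiv ℝ f x x)) := by
  refine tendsto_integral_filter_of_dominated_convergence (fun x => ‖x‖⁻¹ * ‖fderiv ℝ f x‖)
    (Eventually.of_forall fun δ => ?_) ?_
    (integrable_inv_norm_mul (hf.continuous_fderiv one_ne_zero).norm (hc.fderiv (𝕜 := ℝ)).norm) ?_
  · have weight : Measurable fun x : Plane => (‖x‖ ^ 2 + δ)⁻¹ := by fun_prop
    exact (weight.smul ((hf.continuous_fderiv one_ne_zero).clm_apply
      continuous_id).measurable).aestronglyMeasurable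
  · filter_upwards [self_mem_nhdsWithin] with δ hδ
    exact Eventually.of_forall fun x => norm_radial_le f x (mem_Ioi.1 hδ).le
  · filter_upwards [ae_ne_zero] with x hx
    have sq_ne_zero : ‖x‖ ^ 2 + 0 ≠ 0 := by simpa using hx
    have cont : ContinuousAt (fun δ : ℝ => (‖x‖ ^ 2 + δ)⁻¹ • fderiv ℝ f x x) 0 :=
      ((continuousAt_const.add continuousAt_id).inv₀ sq_ne_zero).smul continuousAt_const
    simpa only [add_zero] using cont.tendsto.mono_left nhdsWithin_le_nhds

/-- The Laplacian in the plane. -/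
def lap {F : Type*} [NormedAddCommGroup F] [NormedSpace ℝ F] (u : Plane → F) (x : Plane) : F :=
  pd 0 (pd 0 u) x + pd 1 (pd 1 u) x

theorem hasCompactSupport_lap {F : Type*} [NormedAddCommGroup F] [NormedSpace ℝ F]
    {u : Plane → F} (hc : HasCompactSupport u) : HasCompactSupport (lap u) :=
  (hasCompactSupport_pd (hasCompactSupport_pd hc 0) 0).add
    (hasCompactSupport_pd (hasCompactSupport_pd hc 1) 1)

theorem contDiff_lap {F : Type*} [NormedAddCommGroup F] [NormedSpace ℝ F]
    {u : Plane → F} (hu : ContDiff ℝ ∞ u) : ContDiff ℝ ∞ (lap u) :=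
  (contDiff_pd (contDiff_pd hu 0) 0).add (contDiff_pd (contDiff_pd hu 1) 1)

theorem pd_log_norm_sq_add {δ : ℝ} (hδ : 0 < δ) (j : Fin 2) (x : Plane) :
    pd j (fun x : Plane => Real.log (‖x‖ ^ 2 + δ) / 2) x = x j * (‖x‖ ^ 2 + δ)⁻¹ := by
  have ne_zero : ‖x‖ ^ 2 + δ ≠ 0 := by positivity
  have hasFDerivAt_sq : HasFDerivAt (fun x : Plane => ‖x‖ ^ 2 + δ) (2 • innerSL ℝ x) x := by
    simpa using (hasFDerivAt_id (𝕜 := ℝ) x).norm_sq.add_const δ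
  have inner_single : inner ℝ x (EuclideanSpace.single j 1) = x j := by
    simp [EuclideanSpace.inner_single_right]
  simp only [div_eq_mul_inv]
  rw [pd, ((hasFDerivAt_sq.log ne_zero).mul_const (2 : ℝ)⁻¹).fderiv]
  simp [inner_single]
  field_simp

theorem contDiff_log_norm_sq_add {δ : ℝ} (hδ : 0 < δ) :
    ContDiff ℝ ∞ fun x : Plane => Real.log (‖x‖ ^ 2 + δ) / 2 := by
  refine ContDiff.div_const (ContDiff.log
    ((contDiff_norm_sq ℝ).add contDiff_const) fun x => ?_) 2
  positivity

theorem integral_log_reg_mul_lap {f : Plane → ℝ} (hf : ContDiff ℝ ∞ f) (hc : HasCompactSupport f)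
    {δ : ℝ} (hδ : 0 < δ) :
    ∫ x : Plane, Real.log (‖x‖ ^ 2 + δ) / 2 * lap f x =
      -∫ x : Plane, (‖x‖ ^ 2 + δ)⁻¹ • fderiv ℝ f x x := by
  set L : Plane → ℝ := fun x => Real.log (‖x‖ ^ 2 + δ) / 2 with hL
  have contDiff_L : ContDiff ℝ ∞ L := contDiff_log_norm_sq_add hδ
  have by_parts (j : Fin 2) : ∫ x, L x * pd j (pd j f) x = -∫ x, pd j L x * pd j f x := by
    have := integral_mul_pd (contDiff_pd hf j) contDiff_L (hasCompactSupport_pd hc j) j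
    simp_rw [mul_comm (pd j f _), mul_comm (pd j (pd j f) _)] at this
    rw [this, neg_neg]
  have integrable_left (j : Fin 2) : Integrable fun x => L x * pd j (pd j f) x :=
    (contDiff_L.continuous.mul
      (contDiff_pd (contDiff_pd hf j) j).continuous).integrable_of_hasCompactSupport
        (hasCompactSupport_pd (hasCompactSupport_pd hc j) j).mul_left
  have integrable_right (j : Fin 2) : Integrable fun x => pd j L x * pd j f x :=
    ((contDiff_pd contDiff_L j).continuous.mul
      (contDiff_pd hf j).continuous).integrable_of_hasCompactSupport
        (hasCompactSupport_pd hc j).mul_left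
  simp only [lap, mul_add]
  rw [integral_add (integrable_left 0) (integrable_left 1), by_parts, by_parts, ← neg_add,
    ← integral_add (integrable_right 0) (integrable_right 1)]
  congr 1
  refine integral_congr_ae (Eventually.of_forall fun x => ?_)
  simp only [hL]
  rw [pd_log_norm_sq_add hδ, pd_log_norm_sq_add hδ, fderiv_apply_eq_pd]
  simp only [smul_eq_mul]
  ring

theorem abs_log_le_inv_add {t : ℝ} (ht : 0 < t) : |Real.log t| ≤ t⁻¹ + t := by
  have log_le := Real.log_le_sub_one_of_pos ht
  have neg_log_le := Real.log_le_sub_one_of_pos (inv_pos.2 ht)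
  rw [Real.log_inv] at neg_log_le
  have := inv_pos.2 ht
  rw [abs_le]; constructor <;> linarith

theorem abs_log_reg_le {t δ : ℝ} (ht : 0 < t) (hδ : 0 < δ) (hδ1 : δ ≤ 1) :
    |Real.log (t ^ 2 + δ) / 2| ≤ t⁻¹ * (1 + t ^ 2 + t ^ 3) := by
  have expand : t⁻¹ * (1 + t ^ 2 + t ^ 3) = t⁻¹ + t + t ^ 2 := by field_simp
  have log_lower := (abs_le.1 (abs_log_le_inv_add ht)).1
  have log_mono : 2 * Real.log t ≤ Real.log (t ^ 2 + δ) := by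
    rw [← Nat.cast_ofNat, ← Real.log_pow]
    exact Real.log_le_log (by positivity) (by linarith)
  have log_upper := Real.log_le_sub_one_of_pos (show 0 < t ^ 2 + δ by positivity)
  have := inv_pos.2 ht
  have := sq_nonneg t
  rw [expand, abs_le]; constructor <;> linarith

theorem tendsto_integral_log_reg_mul {g : Plane → ℝ} (hg : Continuous g)
    (hc : HasCompactSupport g) :
    Tendsto (fun δ : ℝ => ∫ x : Plane, Real.log (‖x‖ ^ 2 + δ) / 2 * g x) (nhdsWithin 0 (Ioi 0))
      (nhds (∫ x : Plane, Real.log ‖x‖ * g x)) := by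
  have compact_bound : HasCompactSupport fun x => (1 + ‖x‖ ^ 2 + ‖x‖ ^ 3) * ‖g x‖ :=
    HasCompactSupport.mul_left (f := fun x => 1 + ‖x‖ ^ 2 + ‖x‖ ^ 3) hc.norm
  refine tendsto_integral_filter_of_dominated_convergence
    (fun x => ‖x‖⁻¹ * ((1 + ‖x‖ ^ 2 + ‖x‖ ^ 3) * ‖g x‖)) ?_ ?_
    (integrable_inv_norm_mul (by fun_prop) compact_bound) ?_
  · filter_upwards [self_mem_nhdsWithin] with δ hδ
    exact ((contDiff_log_norm_sq_add (mem_Ioi.1 hδ)).continuous.mul hg).aestronglyMeasurable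
  · filter_upwards [Ioc_mem_nhdsGT (zero_lt_one' ℝ)] with δ hδ
    filter_upwards [ae_ne_zero] with x hx
    rw [norm_mul, Real.norm_eq_abs, ← mul_assoc]
    exact mul_le_mul_of_nonneg_right (abs_log_reg_le (norm_pos_iff.2 hx) hδ.1 hδ.2) (norm_nonneg _)
  · filter_upwards [ae_ne_zero] with x hx
    have sq_ne_zero : ‖x‖ ^ 2 + 0 ≠ 0 := by simpa using hx
    have cont : ContinuousAt (fun δ : ℝ => Real.log (‖x‖ ^ 2 + δ) / 2 * g x) 0 :=
      (((continuousAt_const.add continuousAt_id).log sq_ne_zero).div_const 2).mul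
        continuousAt_const
    have limit := cont.tendsto.mono_left (nhdsWithin_le_nhds (s := Ioi 0))
    simpa using limit

theorem integral_log_norm_mul_lap {f : Plane → ℝ} (hf : ContDiff ℝ ∞ f)
    (hc : HasCompactSupport f) :
    ∫ x : Plane, Real.log ‖x‖ * lap f x = 2 * Real.pi * f 0 := by
  have hf₁ := hf.of_le one_le_infty
  have limit : Tendsto (fun δ : ℝ => ∫ x : Plane, Real.log (‖x‖ ^ 2 + δ) / 2 * lap f x)
      (nhdsWithin 0 (Ioi 0)) (nhds (-∫ x : Plane, (‖x‖ ^ 2)⁻¹ • fderiv ℝ f x x)) := by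
    refine (tendsto_integral_radial_deriv hf₁ hc).neg.congr' ?_
    filter_upwards [self_mem_nhdsWithin] with δ hδ
    exact (integral_log_reg_mul_lap hf hc hδ).symm
  rw [tendsto_nhds_unique (tendsto_integral_log_reg_mul (contDiff_lap hf).continuous
    (hasCompactSupport_lap hc)) limit, integral_radial_deriv hf₁ hc, smul_eq_mul]
  ring

/-! ### Admissible magnetic fields and their superpotentials -/

theorem abs_log_max_div_sub_le {ρ r : ℝ} (hρ : 0 < ρ) (hr : 0 ≤ r) :
    |Real.log (max r ρ / ρ) - Real.log (1 + r)| ≤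
      |Real.log ρ| + Real.log (1 + ρ) + Real.log (1 + ρ⁻¹) := by
  have max_pos : 0 < max r ρ := lt_max_of_lt_right hρ
  have := inv_pos.2 hρ
  rw [Real.log_div max_pos.ne' hρ.ne']
  have upper : Real.log (max r ρ) ≤ Real.log (1 + r) + Real.log (1 + ρ) := by
    rw [← Real.log_mul (by positivity) (by positivity)]
    refine Real.log_le_log max_pos (max_le ?_ ?_) <;> nlinarith
  have lower : Real.log (1 + r) ≤ Real.log (max r ρ) + Real.log (1 + ρ⁻¹) := by
    rw [← Real.log_mul (by positivity) (by positivity)]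
    refine Real.log_le_log (by positivity) ?_
    have one_le : 1 ≤ max r ρ * ρ⁻¹ := by
      rw [← div_eq_mul_inv, one_le_div hρ]; exact le_max_right _ _
    nlinarith [le_max_left r ρ]
  have log_nonneg : 0 ≤ Real.log (1 + ρ) := Real.log_nonneg (by linarith)
  have log_inv_nonneg : 0 ≤ Real.log (1 + ρ⁻¹) := Real.log_nonneg (by linarith)
  have neg_abs_le_log := neg_abs_le (Real.log ρ)
  have log_le_abs := le_abs_self (Real.log ρ)
  rw [abs_le]; constructor <;> linarith

theorem log_one_add_le_two_sqrt {t : ℝ} (ht : 0 ≤ t) : Real.log (1 + t) ≤ 2 * Real.sqrt t := by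
  have := Real.sqrt_nonneg t
  calc Real.log (1 + t) ≤ Real.log ((1 + Real.sqrt t) ^ 2) :=
        Real.log_le_log (by positivity) (by nlinarith [Real.sq_sqrt ht])
    _ = 2 * Real.log (1 + Real.sqrt t) := by rw [Real.log_pow, Nat.cast_ofNat]
    _ ≤ 2 * Real.sqrt t := by
      linarith [Real.log_le_sub_one_of_pos (show 0 < 1 + Real.sqrt t by positivity)]

theorem abs_log_norm_sub_sub_le (x y : Plane) :
    |Real.log ‖x - y‖ - Real.log (1 + ‖x‖)| ≤
      Real.log (1 + ‖y‖) + Real.log (1 + ‖x - y‖⁻¹) := by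
  have := norm_nonneg x
  have := norm_nonneg y
  rcases eq_or_ne x y with rfl | hxy
  · have : 0 ≤ Real.log (1 + ‖x‖) := Real.log_nonneg (by linarith)
    simp [abs_of_nonneg this]
  have dist_pos : 0 < ‖x - y‖ := norm_pos_iff.2 (sub_ne_zero.2 hxy)
  have := inv_pos.2 dist_pos
  have log_inv_nonneg : 0 ≤ Real.log (1 + ‖x - y‖⁻¹) := Real.log_nonneg (by linarith)
  have upper : Real.log ‖x - y‖ ≤ Real.log (1 + ‖x‖) + Real.log (1 + ‖y‖) := by
    rw [← Real.log_mul (by positivity) (by positivity)]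
    refine Real.log_le_log dist_pos ((norm_sub_le x y).trans ?_)
    nlinarith
  have lower : Real.log (1 + ‖x‖) ≤
      Real.log (1 + ‖y‖) + (Real.log (1 + ‖x - y‖⁻¹) + Real.log ‖x - y‖) := by
    rw [← Real.log_mul (by positivity) (by positivity),
      ← Real.log_mul (by positivity) (by positivity)]
    refine Real.log_le_log (by positivity) ?_
    have expand : (1 + ‖x - y‖⁻¹) * ‖x - y‖ = ‖x - y‖ + 1 := by field_simp
    rw [expand]
    have := norm_sub_norm_le x y
    nlinarith
  rw [abs_le]; constructor <;> linarith

/-- The function `|x|⁻¹` cut off at the unit disc: an integrable majorant of the singularity of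
`log²` at the origin. -/
def nearKernel (x : Plane) : ℝ := (Metric.closedBall (0 : Plane) 1).indicator (fun x => ‖x‖⁻¹) x

theorem integrable_nearKernel : Integrable nearKernel :=
  (integrableOn_inv_norm 1).integrable_indicator Metric.isClosed_closedBall.measurableSet

theorem nearKernel_nonneg (x : Plane) : 0 ≤ nearKernel x :=
  indicator_nonneg (fun _ _ => by positivity) _

theorem abs_mul_log_one_add_inv_le (b : ℝ) (z : Plane) :
    |b| * Real.log (1 + ‖z‖⁻¹) ≤ |b| + b ^ 2 + nearKernel z := by
  by_cases hz : ‖z‖ ≤ 1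
  · have near : nearKernel z = ‖z‖⁻¹ := by simp [nearKernel, indicator, hz]
    have inv_nonneg : 0 ≤ ‖z‖⁻¹ := by positivity
    calc |b| * Real.log (1 + ‖z‖⁻¹) ≤ |b| * (2 * Real.sqrt ‖z‖⁻¹) := by
          gcongr
          exact log_one_add_le_two_sqrt inv_nonneg
      _ ≤ |b| ^ 2 + Real.sqrt ‖z‖⁻¹ ^ 2 := by linarith [two_mul_le_add_sq |b| (Real.sqrt ‖z‖⁻¹)]
      _ ≤ |b| + b ^ 2 + nearKernel z := by
        rw [sq_abs, Real.sq_sqrt inv_nonneg, near]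
        linarith [abs_nonneg b]
  · have inv_le : ‖z‖⁻¹ ≤ 1 := inv_le_one_of_one_le₀ (not_le.1 hz).le
    have log_le := Real.log_le_sub_one_of_pos (show 0 < 1 + ‖z‖⁻¹ by positivity)
    calc |b| * Real.log (1 + ‖z‖⁻¹) ≤ |b| * 1 := by gcongr; linarith
      _ ≤ |b| + b ^ 2 + nearKernel z := by linarith [nearKernel_nonneg z, sq_nonneg b]

theorem isFiniteMeasure_restrict_closedBall (R : ℝ) :
    IsFiniteMeasure (volume.restrict (Metric.closedBall (0 : Plane) R)) :=
  ⟨by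
    rw [Measure.restrict_apply_univ]
    exact measure_closedBall_lt_top⟩

namespace IsAdmissibleField

variable {B : Plane → ℝ}

theorem exists_bound (hB : IsAdmissibleField B) : ∃ R C τ : ℝ, 2 < τ ∧ 0 ≤ C ∧
    MemLp B 2 (volume.restrict (Metric.closedBall 0 R)) ∧
    ∀ᵐ x, x ∈ (Metric.closedBall (0 : Plane) R)ᶜ → |B x| ≤ C * (1 + ‖x‖) ^ (-τ) := by
  obtain ⟨p, hp, hloc⟩ := hB.locLp
  obtain ⟨τ, hτ, C, R, decay⟩ := hB.decay
  refine ⟨max R 1, |C| * 2 ^ τ, τ, hτ, by positivity, ?_, ?_⟩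
  · have : IsFiniteMeasure (volume.restrict (Metric.closedBall (0 : Plane) (max R 1))) :=
      isFiniteMeasure_restrict_closedBall _
    exact (hloc _ (isCompact_closedBall _ _)).mono_exponent hp.le
  · filter_upwards [decay] with x hx hxR
    simp only [mem_compl_iff, mem_closedBall_zero_iff, not_le, max_lt_iff] at hxR
    refine (hx hxR.1.le).trans ?_
    rw [mul_assoc]
    have norm_pos : 0 < ‖x‖ := by linarith
    have rpow_le : ‖x‖ ^ (-τ) ≤ 2 ^ τ * (1 + ‖x‖) ^ (-τ) := by
      have half_rpow : (2 : ℝ) ^ τ * (1 + ‖x‖) ^ (-τ) = ((1 + ‖x‖) / 2) ^ (-τ) := by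
        rw [Real.div_rpow (by positivity) (by norm_num), Real.rpow_neg (by norm_num : (0:ℝ) ≤ 2)]
        field_simp
      rw [half_rpow]
      exact Real.rpow_le_rpow_of_nonpos (by positivity) (by linarith) (by linarith)
    exact mul_le_mul (le_abs_self C) rpow_le (by positivity) (abs_nonneg C)

theorem aestronglyMeasurable (hB : IsAdmissibleField B) : AEStronglyMeasurable B := by
  obtain ⟨p, -, hloc⟩ := hB.locLp
  rw [← Measure.restrict_univ (μ := volume), ← Metric.iUnion_closedBall_nat (0 : Plane)]
  exact AEStronglyMeasurable.iUnion fun n => (hloc _ (isCompact_closedBall _ _)).1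

theorem integrable_mul (hB : IsAdmissibleField B) :
    ∃ s : ℝ, 0 < s ∧ Integrable fun x => B x * (1 + ‖x‖) ^ s := by
  obtain ⟨R, C, τ, hτ, -, local_memLp, decay⟩ := hB.exists_bound
  have : IsFiniteMeasure (volume.restrict (Metric.closedBall (0 : Plane) R)) :=
    isFiniteMeasure_restrict_closedBall _
  have continuous_weight : Continuous fun x : Plane => (1 + ‖x‖) ^ ((τ - 2) / 2) :=
    Continuous.rpow_const (by fun_prop) fun x => Or.inr (by linarith)
  refine ⟨(τ - 2) / 2, by linarith, ?_⟩
  rw [← integrableOn_univ, ← union_compl_self (Metric.closedBall (0 : Plane) R)]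
  refine IntegrableOn.union ?_ ?_
  · obtain ⟨M, hM⟩ := (isCompact_closedBall (0 : Plane) R).exists_bound_of_continuousOn
      continuous_weight.continuousOn
    refine (local_memLp.integrable (by norm_num)).mul_bdd (c := M)
      continuous_weight.aestronglyMeasurable ?_
    filter_upwards [self_mem_ae_restrict Metric.isClosed_closedBall.measurableSet] with x hx
      using hM x hx
  · have integrable_tail : Integrable fun x : Plane => C * (1 + ‖x‖) ^ (-((τ + 2) / 2)) := by
      refine Integrable.const_mul (integrable_one_add_norm ?_) C
      rw [finrank_euclideanSpace_fin]
      norm_num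
      linarith
    refine Integrable.mono' integrable_tail.integrableOn
      ((hB.aestronglyMeasurable.mul continuous_weight.aestronglyMeasurable).restrict) ?_
    rw [ae_restrict_iff' Metric.isClosed_closedBall.measurableSet.compl]
    filter_upwards [decay] with x hx hxR
    have hp : 0 < 1 + ‖x‖ := by positivity
    rw [norm_mul, Real.norm_eq_abs, Real.norm_of_nonneg (by positivity)]
    calc _ ≤ C * (1 + ‖x‖) ^ (-τ) * (1 + ‖x‖) ^ ((τ - 2) / 2) := by gcongr; exact hx hxR
      _ = _ := by
        rw [mul_assoc, ← Real.rpow_add hp]; congr 2; ring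

theorem integrable (hB : IsAdmissibleField B) : Integrable B := by
  obtain ⟨s, hs, integrable_weighted⟩ := hB.integrable_mul
  refine integrable_weighted.mono hB.aestronglyMeasurable (Eventually.of_forall fun x => ?_)
  have one_le_weight : 1 ≤ (1 + ‖x‖) ^ s := Real.one_le_rpow (by linarith [norm_nonneg x]) hs.le
  rw [norm_mul, Real.norm_of_nonneg (by positivity : 0 ≤ (1 + ‖x‖) ^ s)]
  nlinarith [norm_nonneg (B x)]

theorem integrable_mul_log_one_add (hB : IsAdmissibleField B) :
    Integrable fun x => |B x| * Real.log (1 + ‖x‖) := by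
  obtain ⟨s, hs, integrable_weighted⟩ := hB.integrable_mul
  have measurable_log : Measurable fun x : Plane => Real.log (1 + ‖x‖) := by fun_prop
  refine (integrable_weighted.const_mul s⁻¹).mono
    (hB.aestronglyMeasurable.norm.mul measurable_log.aestronglyMeasurable)
    (Eventually.of_forall fun x => ?_)
  have log_nonneg : 0 ≤ Real.log (1 + ‖x‖) := Real.log_nonneg (by linarith [norm_nonneg x])
  have log_le := Real.log_le_rpow_div (show 0 ≤ 1 + ‖x‖ by positivity) hs
  rw [norm_mul, norm_mul, norm_mul, Real.norm_of_nonneg log_nonneg,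
    Real.norm_of_nonneg (by positivity : 0 ≤ (1 + ‖x‖) ^ s), Real.norm_of_nonneg (by positivity),
    Real.norm_of_nonneg (inv_nonneg.2 hs.le), Real.norm_eq_abs]
  calc _ ≤ |B x| * ((1 + ‖x‖) ^ s / s) := by gcongr
    _ = _ := by ring

theorem memLp_two (hB : IsAdmissibleField B) : MemLp B 2 := by
  obtain ⟨R, C, τ, hτ, -, local_memLp, decay⟩ := hB.exists_bound
  rw [memLp_two_iff_integrable_sq hB.aestronglyMeasurable, ← integrableOn_univ,
    ← union_compl_self (Metric.closedBall (0 : Plane) R)]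
  refine IntegrableOn.union local_memLp.integrable_sq ?_
  have integrable_tail : Integrable fun x : Plane => C ^ 2 * (1 + ‖x‖) ^ (-(2 * τ)) := by
    refine Integrable.const_mul (integrable_one_add_norm ?_) _
    rw [finrank_euclideanSpace_fin]
    norm_num
    linarith
  refine Integrable.mono' integrable_tail.integrableOn (hB.aestronglyMeasurable.pow 2).restrict ?_
  rw [ae_restrict_iff' Metric.isClosed_closedBall.measurableSet.compl]
  filter_upwards [decay] with x hx hxR
  have hp : 0 < 1 + ‖x‖ := by positivity
  rw [norm_pow, Real.norm_eq_abs]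
  calc _ ≤ (C * (1 + ‖x‖) ^ (-τ)) ^ 2 := pow_le_pow_left₀ (abs_nonneg _) (hx hxR) 2
    _ = _ := by
      rw [mul_pow, ← Real.rpow_natCast, ← Real.rpow_natCast, ← Real.rpow_mul hp.le]
      congr 2; push_cast; ring

theorem neg (hB : IsAdmissibleField B) : IsAdmissibleField (fun x => -B x) where
  locLp :=
    let ⟨p, hp, hloc⟩ := hB.locLp
    ⟨p, hp, fun K hK => (hloc K hK).neg⟩
  decay := by simpa using hB.decay

theorem integrable_majorant (hB : IsAdmissibleField B) (x : Plane) :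
    Integrable fun y => |B y| * Real.log (1 + ‖y‖) + (|B y| + B y ^ 2 + nearKernel (x - y)) :=
  hB.integrable_mul_log_one_add.add
    ((hB.integrable.abs.add hB.memLp_two.integrable_sq).add (integrable_nearKernel.comp_sub_left x))

theorem norm_mul_log_sub_le (B : Plane → ℝ) (x y : Plane) :
    ‖B y * (Real.log ‖x - y‖ - Real.log (1 + ‖x‖))‖ ≤
      |B y| * Real.log (1 + ‖y‖) + (|B y| + B y ^ 2 + nearKernel (x - y)) := by
  rw [norm_mul, Real.norm_eq_abs, Real.norm_eq_abs]
  have split_log := mul_le_mul_of_nonneg_left (abs_log_norm_sub_sub_le x y) (abs_nonneg (B y))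
  have near_bound := abs_mul_log_one_add_inv_le (B y) (x - y)
  rw [mul_add] at split_log
  linarith

theorem integrable_mul_log_sub (hB : IsAdmissibleField B) (x : Plane) :
    Integrable fun y => B y * (Real.log ‖x - y‖ - Real.log (1 + ‖x‖)) := by
  refine (hB.integrable_majorant x).mono' ?_ (Eventually.of_forall (norm_mul_log_sub_le B x))
  have measurable_log : Measurable fun y : Plane => Real.log ‖x - y‖ - Real.log (1 + ‖x‖) := by
    fun_prop
  exact hB.aestronglyMeasurable.mul measurable_log.aestronglyMeasurable

theorem integrable_mul_log (hB : IsAdmissibleField B) (x : Plane) :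
    Integrable fun y => B y * Real.log ‖x - y‖ := by
  have := (hB.integrable_mul_log_sub x).add (hB.integrable.mul_const (Real.log (1 + ‖x‖)))
  refine this.congr (Eventually.of_forall fun y => ?_)
  simp only [Pi.add_apply]; ring

theorem exists_integral_norm_mul_log_sub_le (hB : IsAdmissibleField B) : ∃ C : ℝ, ∀ x,
    ∫ y, ‖B y * (Real.log ‖x - y‖ - Real.log (1 + ‖x‖))‖ ≤ C := by
  refine ⟨∫ y, (|B y| * Real.log (1 + ‖y‖) + (|B y| + B y ^ 2 + nearKernel (0 - y))),
    fun x => ?_⟩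
  refine (integral_mono (hB.integrable_mul_log_sub x).norm (hB.integrable_majorant x)
    (norm_mul_log_sub_le B x)).trans (le_of_eq ?_)
  have integrable_far := hB.integrable_mul_log_one_add
  have integrable_local : Integrable fun y => |B y| + B y ^ 2 :=
    hB.integrable.abs.add hB.memLp_two.integrable_sq
  have integral_majorant (z : Plane) : ∫ y, (|B y| * Real.log (1 + ‖y‖) +
      (|B y| + B y ^ 2 + nearKernel (z - y))) = (∫ y, |B y| * Real.log (1 + ‖y‖)) +
      ((∫ y, (|B y| + B y ^ 2)) + ∫ y, nearKernel y) := by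
    have integrable_near : Integrable fun y => |B y| + B y ^ 2 + nearKernel (z - y) :=
      integrable_local.add (integrable_nearKernel.comp_sub_left z)
    rw [integral_add integrable_far integrable_near,
      integral_add integrable_local (integrable_nearKernel.comp_sub_left z),
      integral_sub_left_eq_self nearKernel volume z]
  rw [integral_majorant, integral_majorant]

theorem exists_integral_norm_mul_log_le (hB : IsAdmissibleField B) : ∃ C : ℝ, ∀ x,
    ∫ y, ‖B y * Real.log ‖x - y‖‖ ≤ C + (∫ y, |B y|) * Real.log (1 + ‖x‖) := by
  obtain ⟨C, hC⟩ := hB.exists_integral_norm_mul_log_sub_le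
  refine ⟨C, fun x => ?_⟩
  have log_nonneg : 0 ≤ Real.log (1 + ‖x‖) := Real.log_nonneg (by linarith [norm_nonneg x])
  have norm_le (y : Plane) : ‖B y * Real.log ‖x - y‖‖ ≤
      ‖B y * (Real.log ‖x - y‖ - Real.log (1 + ‖x‖))‖ + |B y| * Real.log (1 + ‖x‖) := by
    calc _ = ‖B y * (Real.log ‖x - y‖ - Real.log (1 + ‖x‖)) + B y * Real.log (1 + ‖x‖)‖ := by
          congr 1; ring
      _ ≤ _ := (norm_add_le _ _).trans_eq (by
        rw [norm_mul (B y) (Real.log (1 + ‖x‖)), Real.norm_eq_abs (B y),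
          Real.norm_of_nonneg log_nonneg])
  calc _ ≤ ∫ y, (‖B y * (Real.log ‖x - y‖ - Real.log (1 + ‖x‖))‖ +
        |B y| * Real.log (1 + ‖x‖)) :=
        integral_mono (hB.integrable_mul_log x).norm
          ((hB.integrable_mul_log_sub x).norm.add (hB.integrable.abs.mul_const _)) norm_le
    _ ≤ _ := by
      rw [integral_add (hB.integrable_mul_log_sub x).norm (hB.integrable.abs.mul_const _),
        integral_mul_const]
      gcongr
      exact hC x

theorem superpotential_add_eq (hB : IsAdmissibleField B) (x : Plane) :
    superpotential B x + flux B * Real.log (1 + ‖x‖) =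
      -(2 * Real.pi)⁻¹ * ∫ y, B y * (Real.log ‖x - y‖ - Real.log (1 + ‖x‖)) := by
  simp only [mul_sub]
  rw [integral_sub (hB.integrable_mul_log x) (hB.integrable.mul_const _), integral_mul_const,
    superpotential, flux]
  ring

theorem exists_abs_superpotential_add_le (hB : IsAdmissibleField B) : ∃ C : ℝ, ∀ x,
    |superpotential B x + flux B * Real.log (1 + ‖x‖)| ≤ C := by
  obtain ⟨C, hC⟩ := hB.exists_integral_norm_mul_log_sub_le
  refine ⟨(2 * Real.pi)⁻¹ * C, fun x => ?_⟩
  have := Real.pi_pos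
  rw [hB.superpotential_add_eq, abs_mul, abs_neg, abs_of_pos (by positivity)]
  gcongr
  exact (norm_integral_le_integral_norm _).trans (hC x)

theorem exists_ratioPlus_bounds (hB : IsAdmissibleField B) {ρ : ℝ} (hρ : 0 < ρ) :
    ∃ c C : ℝ, 0 < c ∧ ∀ x, c ≤ ratioPlus B ρ x ∧ ratioPlus B ρ x ≤ C := by
  obtain ⟨M, hM⟩ := hB.exists_abs_superpotential_add_le
  set N := M + |flux B| * (|Real.log ρ| + Real.log (1 + ρ) + Real.log (1 + ρ⁻¹))
  refine ⟨Real.exp (-N), Real.exp N, Real.exp_pos _, fun x => ?_⟩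
  have ratioPlus_eq : ratioPlus B ρ x =
      Real.exp (-superpotential B x - flux B * Real.log (max ‖x‖ ρ / ρ)) := by
    rw [ratioPlus, gPlus_eq_exp hρ, ← Real.exp_sub]
  have superpotential_bound := hM x
  have log_bound : |flux B * (Real.log (max ‖x‖ ρ / ρ) - Real.log (1 + ‖x‖))| ≤
      |flux B| * (|Real.log ρ| + Real.log (1 + ρ) + Real.log (1 + ρ⁻¹)) := by
    rw [abs_mul]
    exact mul_le_mul_of_nonneg_left (abs_log_max_div_sub_le hρ (norm_nonneg x)) (abs_nonneg _)
  rw [abs_le] at superpotential_bound log_bound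
  rw [ratioPlus_eq, Real.exp_le_exp, Real.exp_le_exp]
  constructor <;> linarith

end IsAdmissibleField

/-! ### Mollification -/

section mollify

variable {F : Type*} [NormedAddCommGroup F] [NormedSpace ℝ F]

/-- The convolution of a scalar kernel with a vector-valued function. -/
def mollify (η : Plane → ℝ) (g : Plane → F) (x : Plane) : F := ∫ y, η (x - y) • g y

theorem mollify_eq_convolution (η : Plane → ℝ) (g : Plane → F) :
    mollify η g = convolution η g (ContinuousLinearMap.lsmul ℝ ℝ) volume := by
  ext x
  rw [convolution_lsmul_swap, mollify]

variable {η : Plane → ℝ} {g : Plane → F}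

theorem integrable_mollify (hη : Continuous η) (hc : HasCompactSupport η)
    (hg : LocallyIntegrable g) (x : Plane) : Integrable fun y => η (x - y) • g y :=
  ((hc.convolutionExists_left (ContinuousLinearMap.lsmul ℝ ℝ) hη hg) x).integrable_swap

theorem contDiff_mollify (hη : ContDiff ℝ ∞ η) (hc : HasCompactSupport η)
    (hg : LocallyIntegrable g) : ContDiff ℝ ∞ (mollify η g) := by
  rw [mollify_eq_convolution]
  exact hc.contDiff_convolution_left _ hη hg

theorem pd_mollify (hη : ContDiff ℝ ∞ η) (hc : HasCompactSupport η)
    (hg : LocallyIntegrable g) (j : Fin 2) : pd j (mollify η g) = mollify (pd j η) g := by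
  ext x
  have hasFDerivAt := hc.hasFDerivAt_convolution_left (ContinuousLinearMap.lsmul ℝ ℝ)
    (hη.of_le one_le_infty) hg x
  have convolutionExists := (hc.fderiv (𝕜 := ℝ)).convolutionExists_left
    ((ContinuousLinearMap.lsmul ℝ ℝ : ℝ →L[ℝ] F →L[ℝ] F).precompL Plane)
    (hη.continuous_fderiv (by simp)) hg x
  rw [← mollify_eq_convolution] at hasFDerivAt
  rw [pd, hasFDerivAt.fderiv, convolution_eq_swap,
    ContinuousLinearMap.integral_apply convolutionExists.integrable_swap]
  rfl

theorem pd_comp_const_sub {c : Plane} (hη : Differentiable ℝ η) (j : Fin 2) (y : Plane) :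
    pd j (fun y => η (c - y)) y = -pd j η (c - y) := by
  have hasFDerivAt : HasFDerivAt (fun y => η (c - y)) _ y :=
    (hη (c - y)).hasFDerivAt.comp y ((hasFDerivAt_id y).const_sub c)
  rw [pd, hasFDerivAt.fderiv]
  simp [pd]

theorem contDiff_comp_const_sub (hη : ContDiff ℝ ∞ η) (c : Plane) :
    ContDiff ℝ ∞ fun y => η (c - y) := hη.comp (contDiff_const.sub contDiff_id)

theorem hasCompactSupport_comp_const_sub {E : Type*} [Zero E] {k : Plane → E}
    (hc : HasCompactSupport k) (c : Plane) : HasCompactSupport fun y => k (c - y) :=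
  hc.comp_homeomorph (Homeomorph.subLeft c)

theorem lap_mollify (hη : ContDiff ℝ ∞ η) (hc : HasCompactSupport η) (hg : LocallyIntegrable g) :
    lap (mollify η g) = mollify (lap η) g := by
  have integrable (j : Fin 2) (x : Plane) : Integrable fun y => pd j (pd j η) (x - y) • g y :=
    integrable_mollify (contDiff_pd (contDiff_pd hη j) j).continuous
      (hasCompactSupport_pd (hasCompactSupport_pd hc j) j) hg x
  ext x
  rw [lap, pd_mollify hη hc hg, pd_mollify hη hc hg,
    pd_mollify (contDiff_pd hη 0) (hasCompactSupport_pd hc 0) hg,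
    pd_mollify (contDiff_pd hη 1) (hasCompactSupport_pd hc 1) hg]
  simp only [mollify, lap, add_smul]
  rw [integral_add (integrable 0 x) (integrable 1 x)]

theorem lap_comp_const_sub (hη : ContDiff ℝ ∞ η) (c y : Plane) :
    lap (fun y => η (c - y)) y = lap η (c - y) := by
  have first (j : Fin 2) : pd j (fun y => η (c - y)) = fun y => -pd j η (c - y) :=
    funext fun y => pd_comp_const_sub (hη.differentiable (by simp)) j y
  have second (j : Fin 2) : pd j (fun y => -pd j η (c - y)) y = pd j (pd j η) (c - y) := by
    have neg_pd : pd j (fun y => -pd j η (c - y)) y = -pd j (fun y => pd j η (c - y)) y := by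
      rw [pd, pd, fderiv_fun_neg, neg_apply]
    rw [neg_pd, pd_comp_const_sub ((contDiff_pd hη j).differentiable (by simp)), neg_neg]
  simp only [lap, first, second]

end mollify

theorem isTest_comp_const_sub {η : Plane → ℝ} (hη : ContDiff ℝ ∞ η) (hc : HasCompactSupport η)
    (c : Plane) : IsTest fun y => η (c - y) :=
  ⟨contDiff_comp_const_sub hη c, hasCompactSupport_comp_const_sub hc c⟩

section superpotential

variable {B : Plane → ℝ} {η : Plane → ℝ}

theorem IsAdmissibleField.aestronglyMeasurable_kernel (hB : IsAdmissibleField B) :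
    AEStronglyMeasurable (fun p : Plane × Plane => B p.2 * Real.log ‖p.1 - p.2‖)
      (volume.prod volume) := by
  have measurable_log : Measurable fun p : Plane × Plane => Real.log ‖p.1 - p.2‖ := by fun_prop
  exact hB.aestronglyMeasurable.comp_snd.mul measurable_log.aestronglyMeasurable

theorem IsAdmissibleField.aestronglyMeasurable_superpotential (hB : IsAdmissibleField B) :
    AEStronglyMeasurable (superpotential B) :=
  (hB.aestronglyMeasurable_kernel.integral_prod_right').const_mul _

theorem continuous_add_mul_log_one_add (a b : ℝ) :
    Continuous fun x : Plane => a + b * Real.log (1 + ‖x‖) :=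
  continuous_const.add (continuous_const.mul (Continuous.log (by fun_prop) fun x => by positivity))

theorem IsAdmissibleField.locallyIntegrable_superpotential (hB : IsAdmissibleField B) :
    LocallyIntegrable (superpotential B) := by
  obtain ⟨C, hC⟩ := hB.exists_abs_superpotential_add_le
  refine (continuous_add_mul_log_one_add C |flux B|).locallyIntegrable.mono
    hB.aestronglyMeasurable_superpotential (Eventually.of_forall fun x => ?_)
  have log_nonneg : 0 ≤ Real.log (1 + ‖x‖) := Real.log_nonneg (by linarith [norm_nonneg x])
  calc |superpotential B x|
      = |(superpotential B x + flux B * Real.log (1 + ‖x‖)) - flux B * Real.log (1 + ‖x‖)| := by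
        rw [add_sub_cancel_right]
    _ ≤ C + |flux B| * Real.log (1 + ‖x‖) :=
      (abs_sub _ _).trans (add_le_add (hC x) (by rw [abs_mul, abs_of_nonneg log_nonneg]))
    _ ≤ _ := le_abs_self _

theorem IsAdmissibleField.integrable_mul_kernel (hB : IsAdmissibleField B) {l : Plane → ℝ}
    (hl : Continuous l) (hc : HasCompactSupport l) :
    Integrable (fun p : Plane × Plane => l p.1 * (B p.2 * Real.log ‖p.1 - p.2‖))
      (volume.prod volume) := by
  have measurable_kernel : AEStronglyMeasurable
      (fun p : Plane × Plane => l p.1 * (B p.2 * Real.log ‖p.1 - p.2‖)) (volume.prod volume) :=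
    (hl.comp continuous_fst).aestronglyMeasurable.mul hB.aestronglyMeasurable_kernel
  obtain ⟨C, hC⟩ := hB.exists_integral_norm_mul_log_le
  rw [integrable_prod_iff measurable_kernel]
  refine ⟨Eventually.of_forall fun y => (hB.integrable_mul_log y).const_mul (l y), ?_⟩
  have integrable_bound :
      Integrable fun y => ‖l y‖ * (C + (∫ z, |B z|) * Real.log (1 + ‖y‖)) :=
    (hl.norm.mul (continuous_add_mul_log_one_add _ _)).integrable_of_hasCompactSupport
      hc.norm.mul_right
  refine integrable_bound.mono' measurable_kernel.norm.integral_prod_right'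
    (Eventually.of_forall fun y => ?_)
  rw [Real.norm_of_nonneg (integral_nonneg fun z => norm_nonneg _)]
  simp only [norm_mul (l y)]
  rw [integral_const_mul]
  exact mul_le_mul_of_nonneg_left (hC y) (norm_nonneg _)

theorem IsAdmissibleField.integral_mul_superpotential (hB : IsAdmissibleField B) {l : Plane → ℝ}
    (hl : Continuous l) (hc : HasCompactSupport l) :
    ∫ y, l y * superpotential B y =
      -(2 * Real.pi)⁻¹ * ∫ z, B z * ∫ y, Real.log ‖y - z‖ * l y := by
  calc _ = -(2 * Real.pi)⁻¹ * ∫ y, ∫ z, l y * (B z * Real.log ‖y - z‖) := by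
        rw [← integral_const_mul]
        refine integral_congr_ae (Eventually.of_forall fun y => ?_)
        simp only [superpotential]
        rw [integral_const_mul]
        ring
    _ = _ := by
      rw [integral_integral_swap (hB.integrable_mul_kernel hl hc)]
      congr 1
      refine integral_congr_ae (Eventually.of_forall fun z => ?_)
      simp only
      rw [← integral_const_mul]
      exact integral_congr_ae (Eventually.of_forall fun y => by ring)

theorem integral_log_norm_sub_mul_lap {f : Plane → ℝ} (hf : ContDiff ℝ ∞ f)
    (hc : HasCompactSupport f) (x z : Plane) :
    ∫ y, Real.log ‖y - z‖ * lap f (x - y) = 2 * Real.pi * f (x - z) := by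
  have at_zero := integral_log_norm_mul_lap (contDiff_comp_const_sub hf (x - z))
    (hasCompactSupport_comp_const_sub hc (x - z))
  simp_rw [lap_comp_const_sub hf] at at_zero
  rw [← integral_sub_right_eq_self _ z, sub_zero] at at_zero
  simpa only [sub_sub_sub_cancel_right] using at_zero

theorem IsAdmissibleField.lap_mollify_superpotential (hB : IsAdmissibleField B)
    (hη : ContDiff ℝ ∞ η) (hc : HasCompactSupport η) (x : Plane) :
    lap (mollify η (superpotential B)) x = -mollify η B x := by
  have pi_ne_zero := Real.pi_ne_zero
  rw [lap_mollify hη hc hB.locallyIntegrable_superpotential]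
  calc ∫ y, lap η (x - y) • superpotential B y
      = -(2 * Real.pi)⁻¹ * ∫ z, B z * ∫ y, Real.log ‖y - z‖ * lap η (x - y) :=
        hB.integral_mul_superpotential ((contDiff_lap hη).continuous.comp (by fun_prop))
          (hasCompactSupport_comp_const_sub (hasCompactSupport_lap hc) x)
    _ = -(2 * Real.pi)⁻¹ * ∫ z, 2 * Real.pi * (η (x - z) • B z) := by
      simp_rw [integral_log_norm_sub_mul_lap hη hc, smul_eq_mul]
      congr 2
      ext z
      ring
    _ = -mollify η B x := by
      rw [integral_const_mul, mollify]
      field_simp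

theorem mollify_apply {A : Plane → Plane} (hη : Continuous η) (hc : HasCompactSupport η)
    (hA : LocallyIntegrable A) (i : Fin 2) (x : Plane) :
    mollify η A x i = mollify η (fun y => A y i) x :=
  ((EuclideanSpace.proj i : Plane →L[ℝ] ℝ).integral_comp_comm
    (integrable_mollify hη hc hA x)).symm

theorem locallyIntegrable_apply {A : Plane → Plane} (hA : LocallyIntegrable A) (i : Fin 2) :
    LocallyIntegrable fun y => A y i :=
  hA.mono ((EuclideanSpace.proj (𝕜 := ℝ) i).continuous.comp_aestronglyMeasurable
    hA.aestronglyMeasurable) (Eventually.of_forall fun x => PiLp.norm_apply_le (A x) i)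

theorem contDiff_mollify_apply {A : Plane → Plane} (hη : ContDiff ℝ ∞ η)
    (hc : HasCompactSupport η) (hA : LocallyIntegrable A) (i : Fin 2) :
    ContDiff ℝ ∞ fun x => mollify η A x i := by
  simp_rw [mollify_apply hη.continuous hc hA]
  exact contDiff_mollify hη hc (locallyIntegrable_apply hA i)

theorem curl_mollify {A : Plane → Plane} (hη : ContDiff ℝ ∞ η) (hc : HasCompactSupport η)
    (hA : LocallyIntegrable A) (hAB : HasDistribCurl A B) (x : Plane) :
    pd 0 (fun y => mollify η A y 1) x - pd 1 (fun y => mollify η A y 0) x = mollify η B x := by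
  simp_rw [mollify_apply hη.continuous hc hA]
  have locallyIntegrable_comp := locallyIntegrable_apply hA
  rw [pd_mollify hη hc (locallyIntegrable_comp 1), pd_mollify hη hc (locallyIntegrable_comp 0)]
  have weak_curl := hAB _ (isTest_comp_const_sub hη hc x)
  simp_rw [partialDeriv_eq_pd, pd_comp_const_sub (hη.differentiable (by simp))] at weak_curl
  simp only [mollify]
  rw [← integral_sub
    (integrable_mollify (contDiff_pd hη 0).continuous (hasCompactSupport_pd hc 0)
      (locallyIntegrable_comp 1) x)
    (integrable_mollify (contDiff_pd hη 1).continuous (hasCompactSupport_pd hc 1)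
      (locallyIntegrable_comp 0) x)]
  simp only [smul_eq_mul]
  calc _ = ∫ y, (A y 0 * -pd 1 η (x - y) - A y 1 * -pd 0 η (x - y)) := by
        refine integral_congr_ae (Eventually.of_forall fun y => ?_)
        simp only; ring
    _ = _ := by rw [weak_curl]; simp_rw [mul_comm]

end superpotential

/-! ### Passing to the limit in the mollification -/

section bump

variable (φ : ContDiffBump (0 : Plane))

theorem integral_normed_comp_sub (x : Plane) : ∫ y, φ.normed volume (x - y) = 1 := by
  rw [integral_sub_left_eq_self (φ.normed volume) volume x, φ.integral_normed]

theorem norm_mollify_normed_le {F : Type*} [NormedAddCommGroup F] [NormedSpace ℝ F]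
    {g : Plane → F} {C : ℝ} (hg : ∀ᵐ y, ‖g y‖ ≤ C) (x : Plane) :
    ‖mollify (φ.normed volume) g x‖ ≤ C := by
  have integrable_kernel : Integrable fun y => φ.normed volume (x - y) :=
    φ.integrable_normed.comp_sub_left x
  calc ‖mollify (φ.normed volume) g x‖ ≤ ∫ y, φ.normed volume (x - y) * C := by
        refine norm_integral_le_of_norm_le (integrable_kernel.mul_const C) ?_
        filter_upwards [hg] with y hy
        rw [norm_smul, Real.norm_of_nonneg (φ.nonneg_normed _)]
        exact mul_le_mul_of_nonneg_left hy (φ.nonneg_normed _)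
    _ = C := by rw [integral_mul_const, integral_normed_comp_sub, one_mul]

theorem le_mollify_normed {g : Plane → ℝ} (hg : LocallyIntegrable g) {c : ℝ} {x : Plane}
    (h : ∀ y, ‖x - y‖ < φ.rOut → c ≤ g y) : c ≤ mollify (φ.normed volume) g x := by
  have integrable_kernel : Integrable fun y => φ.normed volume (x - y) :=
    φ.integrable_normed.comp_sub_left x
  calc c = ∫ y, φ.normed volume (x - y) * c := by
        rw [integral_mul_const, integral_normed_comp_sub, one_mul]
    _ ≤ _ := by
      refine integral_mono (integrable_kernel.mul_const c)
        (integrable_mollify φ.continuous_normed φ.hasCompactSupport_normed hg x) fun y => ?_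
      simp only [smul_eq_mul]
      by_cases hy : ‖x - y‖ < φ.rOut
      · exact mul_le_mul_of_nonneg_left (h y hy) (φ.nonneg_normed _)
      · have : φ.normed volume (x - y) = 0 := by
          rw [← Function.notMem_support, φ.support_normed_eq]
          simpa using hy
        simp [this]

theorem mollify_normed_le {g : Plane → ℝ} (hg : LocallyIntegrable g) {c : ℝ} {x : Plane}
    (h : ∀ y, ‖x - y‖ < φ.rOut → g y ≤ c) : mollify (φ.normed volume) g x ≤ c := by
  have neg_bound := le_mollify_normed φ (g := fun y => -g y) hg.neg (c := -c) (x := x)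
    fun y hy => neg_le_neg (h y hy)
  have mollify_neg :
      mollify (φ.normed volume) (fun y => -g y) x = -mollify (φ.normed volume) g x := by
    simp only [mollify, smul_neg, integral_neg]
  linarith

end bump

theorem log_max_div_sub_log_max_div_le {ρ : ℝ} (hρ : 0 < ρ) (r s : ℝ) :
    Real.log (max r ρ / ρ) - Real.log (max s ρ / ρ) ≤ |r - s| / ρ := by
  have max_r_pos : 0 < max r ρ := lt_max_of_lt_right hρ
  have max_s_pos : 0 < max s ρ := lt_max_of_lt_right hρ
  have max_sub_le : max r ρ - max s ρ ≤ |r - s| :=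
    (le_abs_self _).trans ((abs_max_sub_max_le_max r ρ s ρ).trans (by simp))
  calc Real.log (max r ρ / ρ) - Real.log (max s ρ / ρ)
      = Real.log (max r ρ / max s ρ) := by
        rw [Real.log_div max_r_pos.ne' hρ.ne', Real.log_div max_s_pos.ne' hρ.ne',
          sub_sub_sub_cancel_right, Real.log_div max_r_pos.ne' max_s_pos.ne']
    _ ≤ (max r ρ - max s ρ) / max s ρ := by
      rw [sub_div, div_self max_s_pos.ne']
      exact Real.log_le_sub_one_of_pos (by positivity)
    _ ≤ |r - s| / max s ρ := by gcongr
    _ ≤ |r - s| / ρ := by gcongr; exact le_max_right _ _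

theorem gPlus_le_exp_mul {α ρ : ℝ} (hρ : 0 < ρ) (hα : 0 ≤ α) {x y : Plane} {ε : ℝ}
    (hxy : ‖x - y‖ ≤ ε) :
    gPlus α ρ ‖x‖ ≤ Real.exp (α * (ε / ρ)) * gPlus α ρ ‖y‖ := by
  rw [gPlus_eq_exp hρ, gPlus_eq_exp hρ, ← Real.exp_add, Real.exp_le_exp, ← mul_add]
  refine mul_le_mul_of_nonneg_left ?_ hα
  rw [← sub_le_iff_le_add]
  refine (log_max_div_sub_log_max_div_le hρ ‖x‖ ‖y‖).trans ?_
  gcongr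
  exact (abs_norm_sub_norm_le x y).trans hxy

theorem mul_gPlus_le_exp_neg_mollify {h : Plane → ℝ} (hh : LocallyIntegrable h) {α ρ k : ℝ}
    (hρ : 0 < ρ) (hα : 0 ≤ α) (hk : 0 < k)
    (lower : ∀ x, k * gPlus α ρ ‖x‖ ≤ Real.exp (-h x)) (φ : ContDiffBump (0 : Plane)) (x : Plane) :
    k * Real.exp (-(α * (φ.rOut / ρ))) * gPlus α ρ ‖x‖ ≤
      Real.exp (-mollify (φ.normed volume) h x) := by
  have gPlus_x_pos := gPlus_pos hρ α ‖x‖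
  rw [← Real.log_le_iff_le_exp (by positivity), le_neg]
  refine mollify_normed_le φ hh fun y hy => ?_
  rw [le_neg, Real.log_le_iff_le_exp (by positivity)]
  refine le_trans ?_ (lower y)
  rw [mul_assoc, Real.exp_neg, inv_mul_eq_div]
  gcongr
  rw [div_le_iff₀' (Real.exp_pos _)]
  exact gPlus_le_exp_mul hρ hα hy.le

theorem exp_neg_mollify_le_mul_gPlus {h : Plane → ℝ} (hh : LocallyIntegrable h) {α ρ K : ℝ}
    (hρ : 0 < ρ) (hα : 0 ≤ α) (hK : 0 < K)
    (upper : ∀ x, Real.exp (-h x) ≤ K * gPlus α ρ ‖x‖) (φ : ContDiffBump (0 : Plane)) (x : Plane) :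
    Real.exp (-mollify (φ.normed volume) h x) ≤
      K * Real.exp (α * (φ.rOut / ρ)) * gPlus α ρ ‖x‖ := by
  have gPlus_x_pos := gPlus_pos hρ α ‖x‖
  rw [← Real.le_log_iff_exp_le (by positivity), neg_le]
  refine le_mollify_normed φ hh fun y hy => ?_
  rw [neg_le, Real.le_log_iff_exp_le (by positivity)]
  refine (upper y).trans ?_
  rw [mul_assoc]
  gcongr
  exact gPlus_le_exp_mul hρ hα ((norm_sub_rev y x).trans_le hy.le)

section limit

variable {B : Plane → ℝ} {A : Plane → Plane}

theorem hardy_mollified (hB : IsAdmissibleField B) {CA : ℝ} (hA : LocallyIntegrable A)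
    (hCA : ∀ᵐ x, ‖A x‖ ≤ CA) (hAB : HasDistribCurl A B) {α ρ k K : ℝ} (hρ : 0 < ρ)
    (hα : 0 ≤ α) (hk : 0 < k) (hK : 0 < K)
    (hkg : ∀ x, k * gPlus α ρ ‖x‖ ≤ Real.exp (-superpotential B x))
    (hKg : ∀ x, Real.exp (-superpotential B x) ≤ K * gPlus α ρ ‖x‖)
    {u : Plane → ℂ} (hu : ContDiff ℝ ∞ u) (hc : HasCompactSupport u)
    (φ : ContDiffBump (0 : Plane)) :
    (k * Real.exp (-(α * (φ.rOut / ρ))) / (K * Real.exp (α * (φ.rOut / ρ)))) ^ 2 *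
      ∫ x, hardyProfile α ρ ‖x‖ * ‖u x‖ ^ 2 ≤
        ∫ x, formDensity (mollify (φ.normed volume) A) u x := by
  have smooth : ContDiff ℝ ∞ (φ.normed volume) := φ.contDiff_normed
  have compact := φ.hasCompactSupport_normed (μ := volume)
  have hh := hB.locallyIntegrable_superpotential
  refine hardy_smooth (h := mollify (φ.normed volume) (superpotential B))
    (contDiff_mollify_apply smooth compact hA) (contDiff_mollify smooth compact hh) (fun x => ?_)
    (contDiff_mollify smooth compact hA).continuous.aestronglyMeasurable
    (Eventually.of_forall (norm_mollify_normed_le φ hCA)) hρ hα (by positivity) (by positivity)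
    (mul_gPlus_le_exp_neg_mollify hh hρ hα hk hkg φ)
    (exp_neg_mollify_le_mul_gPlus hh hρ hα hK hKg φ) hu hc
  have poisson := hB.lap_mollify_superpotential smooth compact x
  rw [lap] at poisson
  rw [curl_mollify smooth compact hA hAB, poisson]
  exact add_neg_cancel _

/-- The bump functions at the origin with outer radius `1 / (n + 1)`, along which fields and
potentials are mollified. -/
def shrinkingBump (n : ℕ) : ContDiffBump (0 : Plane) where
  rIn := 1 / ((n : ℝ) + 1) / 2
  rOut := 1 / ((n : ℝ) + 1)
  rIn_pos := by positivity
  rIn_lt_rOut := half_lt_self (by positivity)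

theorem tendsto_rOut_shrinkingBump :
    Tendsto (fun n => (shrinkingBump n).rOut) atTop (nhds 0) :=
  tendsto_one_div_add_atTop_nhds_zero_nat

theorem ae_tendsto_mollify_shrinkingBump {F : Type*} [NormedAddCommGroup F] [NormedSpace ℝ F]
    [CompleteSpace F] {g : Plane → F} (hg : LocallyIntegrable g) :
    ∀ᵐ x, Tendsto (fun n => mollify ((shrinkingBump n).normed volume) g x) atTop (nhds (g x)) := by
  simp_rw [mollify_eq_convolution]
  refine ContDiffBump.ae_convolution_tendsto_right_of_locallyIntegrable (K := 2)
    tendsto_rOut_shrinkingBump (Eventually.of_forall fun n => ?_) hg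
  simp only [shrinkingBump]
  linarith

theorem tendsto_integral_formDensity_mollify (hA : LocallyIntegrable A) {CA : ℝ}
    (hCA : ∀ᵐ x, ‖A x‖ ≤ CA) {u : Plane → ℂ} (hu : ContDiff ℝ ∞ u) (hc : HasCompactSupport u) :
    Tendsto (fun n => ∫ x, formDensity (mollify ((shrinkingBump n).normed volume) A) u x) atTop
      (nhds (∫ x, formDensity A u x)) := by
  have smooth (n : ℕ) : ContDiff ℝ ∞ (mollify ((shrinkingBump n).normed volume) A) :=
    contDiff_mollify (shrinkingBump n).contDiff_normed (shrinkingBump n).hasCompactSupport_normed hA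
  have bounded := fun n => norm_mollify_normed_le (shrinkingBump n) hCA
  rw [integral_formDensity hA.aestronglyMeasurable hCA hu hc]
  simp_rw [fun n => integral_formDensity (smooth n).continuous.aestronglyMeasurable
    (Eventually.of_forall (bounded n)) hu hc]
  refine tendsto_integral_of_dominated_convergence _ (fun n =>
    (integrable_norm_sq_dz_sub (smooth n).continuous.aestronglyMeasurable
    (Eventually.of_forall (bounded n)) hu hc).1) (integrable_dz_sub_majorant CA hu hc)
    (fun n => Eventually.of_forall fun x => ?_) ?_
  · rw [norm_pow, norm_norm]
    exact norm_sq_dz_sub_le (bounded n x) u x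
  · filter_upwards [ae_tendsto_mollify_shrinkingBump hA] with x hx
    have tendsto_comp (i : Fin 2) : Tendsto (fun n =>
        ((mollify ((shrinkingBump n).normed volume) A x i : ℝ) : ℂ)) atTop
        (nhds ((A x i : ℝ) : ℂ)) :=
      (Complex.continuous_ofReal.tendsto _).comp
        (((EuclideanSpace.proj i : Plane →L[ℝ] ℝ).continuous.tendsto _).comp hx)
    exact ((tendsto_const_nhds.sub ((((tendsto_comp 0).sub
      ((tendsto_comp 1).const_mul Complex.I)).const_mul Complex.I).mul_const (u x))).norm).pow 2

theorem hardy_test (hB : IsAdmissibleField B) (hA : LocallyIntegrable A) {CA : ℝ}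
    (hCA : ∀ᵐ x, ‖A x‖ ≤ CA) (hAB : HasDistribCurl A B) {α ρ k K : ℝ} (hρ : 0 < ρ)
    (hα : 0 ≤ α) (hk : 0 < k) (hK : 0 < K)
    (hkg : ∀ x, k * gPlus α ρ ‖x‖ ≤ Real.exp (-superpotential B x))
    (hKg : ∀ x, Real.exp (-superpotential B x) ≤ K * gPlus α ρ ‖x‖)
    {u : Plane → ℂ} (hu : ContDiff ℝ ∞ u) (hc : HasCompactSupport u) :
    (k / K) ^ 2 * ∫ x, hardyProfile α ρ ‖x‖ * ‖u x‖ ^ 2 ≤ ∫ x, formDensity A u x := by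
  refine le_of_tendsto_of_tendsto' ?_ (tendsto_integral_formDensity_mollify hA hCA hu hc)
    fun n => hardy_mollified hB hA hCA hAB hρ hα hk hK hkg hKg hu hc (shrinkingBump n)
  refine Tendsto.mul_const _ (Tendsto.pow ?_ 2)
  have exponent : Tendsto (fun n => α * ((shrinkingBump n).rOut / ρ)) atTop (nhds 0) := by
    simpa using (tendsto_rOut_shrinkingBump.div_const ρ).const_mul α
  have ratio : ContinuousAt (fun t => k * Real.exp (-t) / (K * Real.exp t)) 0 := by
    fun_prop (disch := positivity)
  simpa [Function.comp_def] using ratio.tendsto.comp exponent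

end limit

/-! ### Square integrable functions -/

section l2

variable {X F : Type*} [NormedAddCommGroup F]

/-- The defect in the inequality `‖f - g‖² ≤ 2 ‖f‖² + 2 ‖g‖²`, to which Fatou's lemma is applied
in order to upgrade almost everywhere convergence to convergence in `L²`. -/
def sqDefect (f g : X → F) (x : X) : ℝ≥0∞ := 2 * ‖f x‖ₑ ^ 2 + 2 * ‖g x‖ₑ ^ 2 - ‖f x - g x‖ₑ ^ 2

theorem tendsto_sqDefect {f : X → F} {f' : ℕ → X → F} {x : X}
    (hx : Tendsto (fun n => f' n x) atTop (nhds (f x))) :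
    Tendsto (fun n => sqDefect (f' n) f x) atTop (nhds (2 * ‖f x‖ₑ ^ 2 + 2 * ‖f x‖ₑ ^ 2)) := by
  have sum : Tendsto (fun n => 2 * ‖f' n x‖ₑ ^ 2 + 2 * ‖f x‖ₑ ^ 2) atTop
      (nhds (2 * ‖f x‖ₑ ^ 2 + 2 * ‖f x‖ₑ ^ 2)) :=
    (ENNReal.Tendsto.const_mul (ENNReal.Tendsto.pow hx.enorm) (Or.inr (by simp))).add
      tendsto_const_nhds
  have difference : Tendsto (fun n => ‖f' n x - f x‖ₑ ^ 2) atTop (nhds 0) := by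
    simpa using ENNReal.Tendsto.pow (n := 2) (hx.sub_const (f x)).enorm
  simpa only [sqDefect, tsub_zero] using ENNReal.Tendsto.sub sum difference (Or.inr (by simp))

variable [MeasurableSpace X] {μ : Measure X}

/-- The square of the `L²` norm; extended-valued, so that no integrability is presupposed. -/
def l2sq (f : X → F) (μ : Measure X := by volume_tac) : ℝ≥0∞ := ∫⁻ x, ‖f x‖ₑ ^ 2 ∂μ

theorem memLp_two_iff_l2sq {f : X → F} :
    MemLp f 2 μ ↔ AEStronglyMeasurable f μ ∧ l2sq f μ < ⊤ := by
  have eLpNorm_sq : eLpNorm f 2 μ ^ 2 = l2sq f μ := by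
    simpa [l2sq] using eLpNorm_nnreal_pow_eq_lintegral (f := f) (μ := μ) (p := 2) two_ne_zero
  rw [MemLp, ← eLpNorm_sq]
  simp

theorem ennreal_add_sq_le (a b : ℝ≥0∞) : (a + b) ^ 2 ≤ 2 * a ^ 2 + 2 * b ^ 2 := by
  have := ENNReal.rpow_add_le_mul_rpow_add_rpow a b (p := 2) (by norm_num)
  norm_num at this
  rwa [mul_add] at this

theorem l2sq_add_le {f g : X → F} (hf : AEStronglyMeasurable f μ) :
    l2sq (fun x => f x + g x) μ ≤ 2 * l2sq f μ + 2 * l2sq g μ := by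
  rw [l2sq, l2sq, l2sq, ← lintegral_const_mul' _ _ (by simp), ← lintegral_const_mul' _ _ (by simp),
    ← lintegral_add_left' ((hf.enorm.pow_const 2).const_mul 2)]
  refine lintegral_mono fun x => ?_
  exact (pow_le_pow_left' (enorm_add_le _ _) 2).trans (ennreal_add_sq_le _ _)

theorem l2sq_neg (f : X → F) : l2sq (fun x => -f x) μ = l2sq f μ := by simp [l2sq]

theorem l2sq_le_mul {G : Type*} [NormedAddCommGroup G] {f : X → F} {g : X → G} {C : ℝ}
    (hfg : ∀ᵐ x ∂μ, ‖f x‖ ≤ C * ‖g x‖) : l2sq f μ ≤ ENNReal.ofReal C ^ 2 * l2sq g μ := by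
  rw [l2sq, l2sq, ← lintegral_const_mul' _ _ (by simp)]
  refine lintegral_mono_ae ?_
  filter_upwards [hfg] with x hx
  rw [← mul_pow]
  refine pow_le_pow_left' ?_ 2
  rw [← ofReal_norm, ← ofReal_norm, ← ENNReal.ofReal_mul' (norm_nonneg _)]
  exact ENNReal.ofReal_le_ofReal hx

theorem aemeasurable_sqDefect {f g : X → F} (hf : AEStronglyMeasurable f μ)
    (hg : AEStronglyMeasurable g μ) : AEMeasurable (sqDefect f g) μ :=
  (((hf.enorm.pow_const 2).const_mul 2).add ((hg.enorm.pow_const 2).const_mul 2)).sub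
    ((hf.sub hg).enorm.pow_const 2)

theorem l2sq_sub_add_lintegral_sqDefect {f g : X → F} (hf : AEStronglyMeasurable f μ)
    (hg : AEStronglyMeasurable g μ) :
    l2sq (fun x => f x - g x) μ + ∫⁻ x, sqDefect f g x ∂μ = 2 * l2sq f μ + 2 * l2sq g μ := by
  have sq_sub_le (x : X) : ‖f x - g x‖ₑ ^ 2 ≤ 2 * ‖f x‖ₑ ^ 2 + 2 * ‖g x‖ₑ ^ 2 :=
    (pow_le_pow_left' enorm_sub_le 2).trans (ennreal_add_sq_le _ _)
  rw [l2sq, ← lintegral_add_right' _ (aemeasurable_sqDefect hf hg)]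
  simp only [sqDefect, add_tsub_cancel_of_le (sq_sub_le _)]
  rw [lintegral_add_left' ((hf.enorm.pow_const 2).const_mul 2),
    lintegral_const_mul' _ _ (by simp), lintegral_const_mul' _ _ (by simp), l2sq, l2sq]

theorem ennreal_tendsto_zero_of_add_le {a b : ℕ → ℝ≥0∞} {c : ℝ≥0∞} (hc : c ≠ ⊤)
    (hab : ∀ n, a n + b n ≤ c) (hb : c ≤ liminf b atTop) : Tendsto a atTop (nhds 0) := by
  rw [ENNReal.tendsto_nhds_zero]
  intro ε hε
  rcases eq_or_ne c 0 with rfl | hc₀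
  · exact Eventually.of_forall fun n => (le_self_add.trans (hab n)).trans bot_le
  · filter_upwards [eventually_lt_of_lt_liminf ((ENNReal.sub_lt_self hc hc₀ hε.ne').trans_le hb)]
      with n hn
    have add_le : a n + (c - ε) ≤ c := (add_le_add le_rfl hn.le).trans (hab n)
    exact (ENNReal.le_sub_of_add_le_right (tsub_le_self.trans_lt hc.lt_top).ne add_le).trans
      tsub_tsub_le

theorem tendsto_l2sq_sub_of_ae {f : X → F} {f' : ℕ → X → F} (hf : MemLp f 2 μ)
    (hf' : ∀ n, AEStronglyMeasurable (f' n) μ) (hle : ∀ n, l2sq (f' n) μ ≤ l2sq f μ)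
    (hlim : ∀ᵐ x ∂μ, Tendsto (fun n => f' n x) atTop (nhds (f x))) :
    Tendsto (fun n => l2sq (fun x => f' n x - f x) μ) atTop (nhds 0) := by
  refine ennreal_tendsto_zero_of_add_le (b := fun n => ∫⁻ x, sqDefect (f' n) f x ∂μ)
    (c := 2 * l2sq f μ + 2 * l2sq f μ) ?_ (fun n => ?_) ?_
  · simpa [ENNReal.mul_eq_top] using (memLp_two_iff_l2sq.1 hf).2.ne
  · rw [l2sq_sub_add_lintegral_sqDefect (hf' n) hf.1]
    gcongr
    exact hle n
  · calc 2 * l2sq f μ + 2 * l2sq f μ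
        = ∫⁻ x, liminf (fun n => sqDefect (f' n) f x) atTop ∂μ := by
          rw [l2sq, ← lintegral_const_mul' _ _ (by simp),
            ← lintegral_add_left' ((hf.1.enorm.pow_const 2).const_mul 2)]
          refine lintegral_congr_ae ?_
          filter_upwards [hlim] with x hx using (tendsto_sqDefect hx).liminf_eq.symm
      _ ≤ _ := lintegral_liminf_le' fun n => aemeasurable_sqDefect (hf' n) hf.1

theorem sq_lintegral_mul_le {f g : X → ℝ≥0∞} (hf : AEMeasurable f μ) (hg : AEMeasurable g μ) :
    (∫⁻ x, f x * g x ∂μ) ^ 2 ≤ (∫⁻ x, f x ^ 2 ∂μ) * ∫⁻ x, g x ^ 2 ∂μ := by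
  refine (pow_le_pow_left' (ENNReal.lintegral_mul_le_Lp_mul_Lq μ Real.HolderConjugate.two_two
    hf hg) 2).trans (le_of_eq ?_)
  rw [mul_pow, ← ENNReal.rpow_natCast, ← ENNReal.rpow_natCast, ← ENNReal.rpow_mul,
    ← ENNReal.rpow_mul]
  norm_num

theorem abs_norm_sq_sub_norm_sq_le (a b : F) :
    |‖a‖ ^ 2 - ‖b‖ ^ 2| ≤ ‖a - b‖ ^ 2 + 2 * (‖a - b‖ * ‖b‖) := by
  have norm_sub_le := abs_norm_sub_norm_le a b
  have norm_add_le : ‖a‖ + ‖b‖ ≤ ‖a - b‖ + 2 * ‖b‖ := by linarith [le_abs_self (‖a‖ - ‖b‖)]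
  calc |‖a‖ ^ 2 - ‖b‖ ^ 2| = (‖a‖ + ‖b‖) * |‖a‖ - ‖b‖| := by
        rw [sq_sub_sq, abs_mul, abs_of_nonneg (by positivity)]
    _ ≤ (‖a - b‖ + 2 * ‖b‖) * ‖a - b‖ :=
      mul_le_mul norm_add_le norm_sub_le (abs_nonneg _) (by positivity)
    _ = _ := by ring

theorem enorm_norm_sq_sub_norm_sq_le (a b : F) :
    ‖‖a‖ ^ 2 - ‖b‖ ^ 2‖ₑ ≤ ‖a - b‖ₑ ^ 2 + 2 * (‖a - b‖ₑ * ‖b‖ₑ) := by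
  calc _ = ENNReal.ofReal |‖a‖ ^ 2 - ‖b‖ ^ 2| := Real.enorm_eq_ofReal_abs _
    _ ≤ ENNReal.ofReal (‖a - b‖ ^ 2 + 2 * (‖a - b‖ * ‖b‖)) :=
      ENNReal.ofReal_le_ofReal (abs_norm_sq_sub_norm_sq_le a b)
    _ = _ := by
      rw [ENNReal.ofReal_add (by positivity) (by positivity), ENNReal.ofReal_pow (norm_nonneg _),
        ENNReal.ofReal_mul zero_le_two, ENNReal.ofReal_mul (norm_nonneg _), ofReal_norm,
        ofReal_norm, ENNReal.ofReal_ofNat]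

theorem lintegral_enorm_mul_norm_sq_sub_le {b : X → ℝ} {M : ℝ} (hM : ∀ x, |b x| ≤ M)
    {f g : X → F} (hf : AEStronglyMeasurable f μ) (hg : AEStronglyMeasurable g μ) :
    ∫⁻ x, ‖b x * ‖f x‖ ^ 2 - b x * ‖g x‖ ^ 2‖ₑ ∂μ ≤ ENNReal.ofReal M *
      (l2sq (fun x => f x - g x) μ +
        2 * (l2sq (fun x => f x - g x) μ * l2sq g μ) ^ (1 / 2 : ℝ)) := by
  have pointwise (x : X) : ‖b x * ‖f x‖ ^ 2 - b x * ‖g x‖ ^ 2‖ₑ ≤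
      ENNReal.ofReal M * (‖f x - g x‖ₑ ^ 2 + 2 * (‖f x - g x‖ₑ * ‖g x‖ₑ)) := by
    rw [← mul_sub, enorm_mul, Real.enorm_eq_ofReal_abs]
    exact mul_le_mul' (ENNReal.ofReal_le_ofReal (hM x)) (enorm_norm_sq_sub_norm_sq_le _ _)
  have cauchy_schwarz : ∫⁻ x, ‖f x - g x‖ₑ * ‖g x‖ₑ ∂μ ≤
      (l2sq (fun x => f x - g x) μ * l2sq g μ) ^ (1 / 2 : ℝ) := by
    rw [one_div, ENNReal.le_rpow_inv_iff zero_lt_two]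
    exact_mod_cast sq_lintegral_mul_le (hf.sub hg).enorm hg.enorm
  refine (lintegral_mono pointwise).trans ?_
  rw [lintegral_const_mul' _ _ (by simp),
    lintegral_add_left' (f := fun x => ‖f x - g x‖ₑ ^ 2) ((hf.sub hg).enorm.pow_const 2),
    lintegral_const_mul' _ _ (by simp)]
  gcongr
  exact le_rfl

theorem tendsto_integral_mul_norm_sq {b : X → ℝ} (hb : AEStronglyMeasurable b μ) {M : ℝ}
    (hM : ∀ x, |b x| ≤ M) {f : X → F} {f' : ℕ → X → F} (hf : MemLp f 2 μ)
    (hf' : ∀ n, MemLp (f' n) 2 μ)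
    (hlim : Tendsto (fun n => l2sq (fun x => f' n x - f x) μ) atTop (nhds 0)) :
    Tendsto (fun n => ∫ x, b x * ‖f' n x‖ ^ 2 ∂μ) atTop (nhds (∫ x, b x * ‖f x‖ ^ 2 ∂μ)) := by
  have integrable {g : X → F} (hg : MemLp g 2 μ) : Integrable (fun x => b x * ‖g x‖ ^ 2) μ :=
    (hg.integrable_norm_pow two_ne_zero).bdd_mul (c := M) hb (Eventually.of_forall hM)
  have product : Tendsto (fun n => l2sq (fun x => f' n x - f x) μ * l2sq f μ) atTop (nhds 0) := by
    simpa using ENNReal.Tendsto.mul_const hlim (Or.inr (memLp_two_iff_l2sq.1 hf).2.ne)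
  have bound : Tendsto (fun n => ENNReal.ofReal M * (l2sq (fun x => f' n x - f x) μ +
      2 * (l2sq (fun x => f' n x - f x) μ * l2sq f μ) ^ (1 / 2 : ℝ))) atTop (nhds 0) := by
    simpa using ENNReal.Tendsto.const_mul (a := ENNReal.ofReal M) (hlim.add
      (ENNReal.Tendsto.const_mul (a := 2) (product.ennrpow_const (1 / 2 : ℝ))
        (Or.inr (by simp)))) (Or.inr (by simp))
  refine tendsto_integral_of_L1 _ (integrable hf).1
    (Eventually.of_forall fun n => integrable (hf' n)) ?_
  exact tendsto_of_tendsto_of_tendsto_of_le_of_le tendsto_const_nhds bound (fun _ => bot_le)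
    fun n => lintegral_enorm_mul_norm_sq_sub_le hM (hf' n).1 hf.1

end l2

/-! ### Approximation in `H¹` -/

section mollify

variable {F : Type*} [NormedAddCommGroup F] [NormedSpace ℝ F]

theorem lintegral_ofReal_normed_comp_sub_left (φ : ContDiffBump (0 : Plane)) (x : Plane) :
    ∫⁻ y, ENNReal.ofReal (φ.normed volume (x - y)) = 1 := by
  rw [← ofReal_integral_eq_lintegral_ofReal (φ.integrable_normed.comp_sub_left x)
    (Eventually.of_forall fun _ => φ.nonneg_normed _), integral_normed_comp_sub, ENNReal.ofReal_one]

theorem lintegral_ofReal_normed_comp_sub_right (φ : ContDiffBump (0 : Plane)) (y : Plane) :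
    ∫⁻ x, ENNReal.ofReal (φ.normed volume (x - y)) = 1 := by
  refine (lintegral_congr fun x => ?_).trans (lintegral_ofReal_normed_comp_sub_left φ y)
  rw [← φ.normed_neg, neg_sub]

theorem enorm_mollify_normed_sq_le (φ : ContDiffBump (0 : Plane)) {g : Plane → F}
    (hg : AEStronglyMeasurable g) (x : Plane) :
    ‖mollify (φ.normed volume) g x‖ₑ ^ 2 ≤
      ∫⁻ y, ENNReal.ofReal (φ.normed volume (x - y)) * ‖g y‖ₑ ^ 2 := by
  set η := φ.normed (volume : Measure Plane)
  have η_nonneg (z : Plane) : 0 ≤ η z := φ.nonneg_normed z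
  have sqrt_measurable : AEMeasurable fun y => ENNReal.ofReal √(η (x - y)) :=
    (φ.continuous_normed.measurable.comp
      (measurable_const.sub measurable_id)).sqrt.ennreal_ofReal.aemeasurable
  have sqrt_mul_sqrt (y : Plane) : ENNReal.ofReal √(η (x - y)) * ENNReal.ofReal √(η (x - y)) =
      ENNReal.ofReal (η (x - y)) := by
    rw [← ENNReal.ofReal_mul (Real.sqrt_nonneg _), Real.mul_self_sqrt (η_nonneg _)]
  calc ‖mollify η g x‖ₑ ^ 2 ≤ (∫⁻ y, ‖η (x - y) • g y‖ₑ) ^ 2 :=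
        pow_le_pow_left' (enorm_integral_le_lintegral_enorm _) 2
    _ = (∫⁻ y, ENNReal.ofReal √(η (x - y)) * (ENNReal.ofReal √(η (x - y)) * ‖g y‖ₑ)) ^ 2 := by
        congr 1
        refine lintegral_congr fun y => ?_
        rw [← mul_assoc, sqrt_mul_sqrt, enorm_smul, Real.enorm_eq_ofReal (η_nonneg _)]
    _ ≤ _ := sq_lintegral_mul_le sqrt_measurable (sqrt_measurable.mul hg.enorm)
    _ = _ := by
        simp_rw [mul_pow, sq (ENNReal.ofReal _), sqrt_mul_sqrt]
        rw [lintegral_ofReal_normed_comp_sub_left, one_mul]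

theorem l2sq_mollify_le (φ : ContDiffBump (0 : Plane)) {g : Plane → F}
    (hg : AEStronglyMeasurable g) : l2sq (mollify (φ.normed volume) g) ≤ l2sq g := by
  set η := φ.normed (volume : Measure Plane)
  have kernel_measurable : Measurable fun z : Plane × Plane => ENNReal.ofReal (η (z.1 - z.2)) :=
    (φ.continuous_normed.measurable.comp (measurable_fst.sub measurable_snd)).ennreal_ofReal
  rw [l2sq]
  calc ∫⁻ x, ‖mollify η g x‖ₑ ^ 2 ≤ ∫⁻ x, ∫⁻ y, ENNReal.ofReal (η (x - y)) * ‖g y‖ₑ ^ 2 :=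
        lintegral_mono (enorm_mollify_normed_sq_le φ hg)
    _ = ∫⁻ y, ∫⁻ x, ENNReal.ofReal (η (x - y)) * ‖g y‖ₑ ^ 2 :=
        lintegral_lintegral_swap
          (AEMeasurable.mul (g := fun z : Plane × Plane => ‖g z.2‖ₑ ^ 2)
            kernel_measurable.aemeasurable (hg.enorm.pow_const 2).comp_snd)
    _ = ∫⁻ y, ‖g y‖ₑ ^ 2 := lintegral_congr fun y => by
        rw [lintegral_mul_const' _ _ (by simp), lintegral_ofReal_normed_comp_sub_right, one_mul]

end mollify

/-- A bump function equal to one on the unit ball; dilating it gives the cut-offs. -/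
def unitBump : ContDiffBump (0 : Plane) := ⟨1, 2, one_pos, one_lt_two⟩

/-- Cut-off functions exhausting the plane: `cutoff n` is one on the ball of radius `n + 1`, and
its gradient is of order `1 / (n + 1)`. -/
def cutoff (n : ℕ) (x : Plane) : ℝ := unitBump (((n : ℝ) + 1)⁻¹ • x)

theorem contDiff_cutoff (n : ℕ) : ContDiff ℝ ∞ (cutoff n) :=
  unitBump.contDiff.comp (contDiff_const_smul _)

theorem hasCompactSupport_cutoff (n : ℕ) : HasCompactSupport (cutoff n) :=
  unitBump.hasCompactSupport.comp_smul (by positivity)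

theorem abs_cutoff_le (n : ℕ) (x : Plane) : |cutoff n x| ≤ 1 := by
  rw [cutoff, abs_of_nonneg unitBump.nonneg]
  exact unitBump.le_one

theorem tendsto_cutoff (x : Plane) : Tendsto (fun n => cutoff n x) atTop (nhds 1) := by
  refine tendsto_const_nhds.congr' ?_
  filter_upwards [eventually_ge_atTop ⌈‖x‖⌉₊] with n hn
  refine (unitBump.one_of_mem_closedBall ?_).symm
  have norm_le : ‖x‖ ≤ n := (Nat.le_ceil _).trans (by exact_mod_cast hn)
  rw [mem_closedBall_zero_iff, norm_smul, Real.norm_of_nonneg (by positivity), inv_mul_eq_div]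
  exact div_le_one_of_le₀ (by linarith) (by positivity)

theorem pd_cutoff (j : Fin 2) (n : ℕ) (x : Plane) :
    pd j (cutoff n) x = ((n : ℝ) + 1)⁻¹ * pd j unitBump (((n : ℝ) + 1)⁻¹ • x) := by
  have hasFDerivAt : HasFDerivAt (cutoff n) _ x :=
    ((unitBump.contDiff (n := 1)).differentiable one_ne_zero
      (((n : ℝ) + 1)⁻¹ • x)).hasFDerivAt.comp x ((hasFDerivAt_id x).const_smul (((n : ℝ) + 1)⁻¹))
  rw [pd, hasFDerivAt.fderiv]
  simp [pd]

theorem exists_abs_pd_cutoff_le (j : Fin 2) :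
    ∃ C, ∀ n x, |pd j (cutoff n) x| ≤ C * ((n : ℝ) + 1)⁻¹ := by
  obtain ⟨C, hC⟩ := (hasCompactSupport_pd unitBump.hasCompactSupport j).exists_bound_of_continuous
    (contDiff_pd unitBump.contDiff j).continuous
  refine ⟨C, fun n x => ?_⟩
  rw [pd_cutoff, abs_mul, abs_of_nonneg (by positivity), mul_comm]
  gcongr
  exact hC _

section approx

variable {F : Type*} [NormedAddCommGroup F] [NormedSpace ℝ F] {v : Plane → F}
  {E : Fin 2 → Plane → F}

theorem IsH1.locallyIntegrable (h : IsH1 v E) : LocallyIntegrable v :=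
  h.memLp.locallyIntegrable one_le_two

theorem IsH1.locallyIntegrable_deriv (h : IsH1 v E) (j : Fin 2) : LocallyIntegrable (E j) :=
  (h.memLp_deriv j).locallyIntegrable one_le_two

theorem IsH1.pd_mollify (h : IsH1 v E) {η : Plane → ℝ} (hη : ContDiff ℝ ∞ η)
    (hc : HasCompactSupport η) (j : Fin 2) : pd j (mollify η v) = mollify η (E j) := by
  rw [PauliHardy.pd_mollify hη hc h.locallyIntegrable]
  funext x
  have weak_deriv := h.weakDeriv j _ (isTest_comp_const_sub hη hc x)
  simp_rw [partialDeriv_eq_pd, pd_comp_const_sub (hη.differentiable (by simp)), neg_smul,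
    integral_neg] at weak_deriv
  exact neg_injective weak_deriv

/-- The smooth compactly supported approximations of an `H¹` function, used to extend form
inequalities from test functions to `H¹`. -/
def approx (v : Plane → F) (n : ℕ) (x : Plane) : F :=
  cutoff n x • mollify ((shrinkingBump n).normed volume) v x

theorem contDiff_approx (hv : LocallyIntegrable v) (n : ℕ) : ContDiff ℝ ∞ (approx v n) :=
  (contDiff_cutoff n).smul (contDiff_mollify (shrinkingBump n).contDiff_normed
    (shrinkingBump n).hasCompactSupport_normed hv)

theorem hasCompactSupport_approx (n : ℕ) : HasCompactSupport (approx v n) :=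
  (hasCompactSupport_cutoff n).smul_right

theorem ae_tendsto_approx [CompleteSpace F] (hv : LocallyIntegrable v) :
    ∀ᵐ x, Tendsto (fun n => approx v n x) atTop (nhds (v x)) := by
  filter_upwards [ae_tendsto_mollify_shrinkingBump hv] with x hx
  simpa only [approx, one_smul] using (tendsto_cutoff x).smul hx

theorem l2sq_approx_le (hv : AEStronglyMeasurable v) (n : ℕ) : l2sq (approx v n) ≤ l2sq v := by
  have approx_le (x : Plane) :
      ‖approx v n x‖ ≤ 1 * ‖mollify ((shrinkingBump n).normed volume) v x‖ := by
    rw [approx, norm_smul]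
    exact mul_le_mul_of_nonneg_right (abs_cutoff_le n x) (norm_nonneg _)
  refine le_trans ?_ (l2sq_mollify_le (shrinkingBump n) hv)
  simpa using l2sq_le_mul (μ := volume) (Eventually.of_forall approx_le)

theorem tendsto_l2sq_approx_sub [CompleteSpace F] (hv : MemLp v 2) :
    Tendsto (fun n => l2sq (fun x => approx v n x - v x)) atTop (nhds 0) :=
  have hl := hv.locallyIntegrable one_le_two
  tendsto_l2sq_sub_of_ae hv (fun n => (contDiff_approx hl n).continuous.aestronglyMeasurable)
    (l2sq_approx_le hv.1) (ae_tendsto_approx hl)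

theorem IsH1.pd_approx (h : IsH1 v E) (j : Fin 2) (n : ℕ) (x : Plane) :
    pd j (approx v n) x = approx (E j) n x +
      pd j (cutoff n) x • mollify ((shrinkingBump n).normed volume) v x := by
  have bump_smooth := (shrinkingBump n).contDiff_normed (μ := (volume : Measure Plane)) (n := ⊤)
  have bump_compact := (shrinkingBump n).hasCompactSupport_normed (μ := volume)
  have hasFDerivAt : HasFDerivAt (approx v n) _ x :=
    ((contDiff_cutoff n).differentiable (by simp) x).hasFDerivAt.smul
      ((contDiff_mollify bump_smooth bump_compact h.locallyIntegrable).differentiable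
        (by simp) x).hasFDerivAt
  rw [approx, ← h.pd_mollify bump_smooth bump_compact j, pd, hasFDerivAt.fderiv]
  simp [pd]

theorem IsH1.l2sq_pd_approx_sub_le (h : IsH1 v E) (j : Fin 2) {n : ℕ} {c : ℝ}
    (hc : ∀ x, |pd j (cutoff n) x| ≤ c) :
    l2sq (fun x => pd j (approx v n) x - E j x) ≤
      2 * l2sq (fun x => approx (E j) n x - E j x) + 2 * (ENNReal.ofReal c ^ 2 * l2sq v) := by
  have hE := h.locallyIntegrable_deriv j
  have product_rule : (fun x => pd j (approx v n) x - E j x) = fun x =>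
      (approx (E j) n x - E j x) +
        pd j (cutoff n) x • mollify ((shrinkingBump n).normed volume) v x := by
    funext x
    rw [h.pd_approx, add_sub_right_comm]
  have cutoff_error : l2sq (fun x => pd j (cutoff n) x •
      mollify ((shrinkingBump n).normed volume) v x) ≤ ENNReal.ofReal c ^ 2 * l2sq v := by
    refine (l2sq_le_mul (C := c) (g := mollify ((shrinkingBump n).normed volume) v)
      (Eventually.of_forall fun x => ?_)).trans
      (mul_le_mul' le_rfl (l2sq_mollify_le _ h.memLp.1))
    rw [norm_smul]
    exact mul_le_mul_of_nonneg_right (hc x) (norm_nonneg _)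
  rw [product_rule]
  refine (l2sq_add_le ((contDiff_approx hE n).continuous.aestronglyMeasurable.sub
    hE.aestronglyMeasurable)).trans ?_
  gcongr
  exact le_rfl

theorem IsH1.tendsto_l2sq_pd_approx_sub [CompleteSpace F] (h : IsH1 v E) (j : Fin 2) :
    Tendsto (fun n => l2sq (fun x => pd j (approx v n) x - E j x)) atTop (nhds 0) := by
  obtain ⟨C, hC⟩ := exists_abs_pd_cutoff_le j
  have gradient_small : Tendsto (fun n : ℕ => C * ((n : ℝ) + 1)⁻¹) atTop (nhds 0) := by
    simpa [one_div] using (tendsto_one_div_add_atTop_nhds_zero_nat (𝕜 := ℝ)).const_mul C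
  have cutoff_error :
      Tendsto (fun n : ℕ => ENNReal.ofReal (C * ((n : ℝ) + 1)⁻¹) ^ 2 * l2sq v) atTop (nhds 0) := by
    simpa using ENNReal.Tendsto.mul_const
      (ENNReal.Tendsto.pow (n := 2) (ENNReal.tendsto_ofReal gradient_small))
      (Or.inr (memLp_two_iff_l2sq.1 h.memLp).2.ne)
  refine tendsto_of_tendsto_of_tendsto_of_le_of_le tendsto_const_nhds ?_ (fun _ => bot_le)
    fun n => h.l2sq_pd_approx_sub_le j (hC n)
  simpa using (ENNReal.Tendsto.const_mul (a := 2) (tendsto_l2sq_approx_sub (h.memLp_deriv j))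
    (Or.inr (by simp))).add (ENNReal.Tendsto.const_mul (a := 2) cutoff_error (Or.inr (by simp)))

end approx

/-! ### The magnetic field as a form-bounded perturbation -/

/-- A quantity equivalent to the square of the `H¹` norm of a function `v` with gradient `E`; the
factor two is what the product rule for `v²` produces in Ladyzhenskaya's inequality. -/
def energy (v : Plane → ℂ) (E : Fin 2 → Plane → ℂ) : ℝ≥0∞ := 2 * l2sq v + ∑ j, l2sq (E j)

theorem energy_sub_le {v w : Plane → ℂ} {E G : Fin 2 → Plane → ℂ} (hv : AEStronglyMeasurable v)
    (hE : ∀ j, AEStronglyMeasurable (E j)) :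
    energy (fun x => v x - w x) (fun j x => E j x - G j x) ≤ 2 * energy v E + 2 * energy w G := by
  have l2sq_sub_le (f g : Plane → ℂ) (hf : AEStronglyMeasurable f) :
      l2sq (fun x => f x - g x) ≤ 2 * l2sq f + 2 * l2sq g := by
    simp_rw [sub_eq_add_neg]
    exact (l2sq_add_le hf).trans_eq (by rw [l2sq_neg])
  simp only [energy, Fin.sum_univ_two]
  calc _ ≤ 2 * (2 * l2sq v + 2 * l2sq w) + ((2 * l2sq (E 0) + 2 * l2sq (G 0)) +
        (2 * l2sq (E 1) + 2 * l2sq (G 1))) := by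
        gcongr
        exacts [l2sq_sub_le _ _ hv, l2sq_sub_le _ _ (hE 0), l2sq_sub_le _ _ (hE 1)]
    _ = _ := by ring

theorem energy_eq_lintegral {v : Plane → ℂ} {E : Fin 2 → Plane → ℂ}
    (hv : AEStronglyMeasurable v) (hE : AEStronglyMeasurable (E 0)) :
    energy v E = ∫⁻ x, (2 * ‖v x‖ₑ ^ 2 + (‖E 0 x‖ₑ ^ 2 + ‖E 1 x‖ₑ ^ 2)) := by
  rw [lintegral_add_left' ((hv.enorm.pow_const 2).const_mul 2),
    lintegral_add_left' (hE.enorm.pow_const 2), lintegral_const_mul' _ _ (by simp)]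
  simp only [energy, l2sq, Fin.sum_univ_two]

theorem norm_fderiv_le_norm_pd_add_norm_pd {F : Type*} [NormedAddCommGroup F] [NormedSpace ℝ F]
    (w : Plane → F) (x : Plane) : ‖fderiv ℝ w x‖ ≤ ‖pd 0 w x‖ + ‖pd 1 w x‖ := by
  refine ContinuousLinearMap.opNorm_le_bound _ (by positivity) fun y => ?_
  rw [fderiv_apply_eq_pd, add_mul]
  refine (norm_add_le _ _).trans (add_le_add ?_ ?_) <;>
  · rw [norm_smul, mul_comm]
    gcongr
    exact PiLp.norm_apply_le y _

theorem norm_fderiv_mul_self_le {w : Plane → ℂ} {x : Plane} (hw : DifferentiableAt ℝ w x) :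
    ‖fderiv ℝ (fun y => w y * w y) x‖ ≤ 2 * ‖w x‖ ^ 2 + (‖pd 0 w x‖ ^ 2 + ‖pd 1 w x‖ ^ 2) := by
  rw [fderiv_fun_mul hw hw]
  refine (norm_add_le _ _).trans ?_
  rw [norm_smul]
  nlinarith [sq_nonneg (‖w x‖ - ‖pd 0 w x‖), sq_nonneg (‖w x‖ - ‖pd 1 w x‖),
    mul_le_mul_of_nonneg_left (norm_fderiv_le_norm_pd_add_norm_pd w x) (norm_nonneg (w x))]

theorem enorm_fderiv_mul_self_le {w : Plane → ℂ} {x : Plane} (hw : DifferentiableAt ℝ w x) :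
    ‖fderiv ℝ (fun y => w y * w y) x‖ₑ ≤
      2 * ‖w x‖ₑ ^ 2 + (‖pd 0 w x‖ₑ ^ 2 + ‖pd 1 w x‖ₑ ^ 2) := by
  simp only [← ofReal_norm, ← ENNReal.ofReal_pow (norm_nonneg _)]
  have two_mul_ofReal := ENNReal.ofReal_mul (p := 2) (q := ‖w x‖ ^ 2) zero_le_two
  rw [ENNReal.ofReal_ofNat] at two_mul_ofReal
  rw [← two_mul_ofReal, ← ENNReal.ofReal_add (by positivity) (by positivity),
    ← ENNReal.ofReal_add (by positivity) (by positivity)]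
  exact ENNReal.ofReal_le_ofReal (norm_fderiv_mul_self_le hw)

/-- Ladyzhenskaya's inequality, obtained by applying the Sobolev inequality for `W¹,¹` to `w²`. -/
theorem exists_lintegral_pow_four_le :
    ∃ C : ℝ≥0∞, C ≠ ⊤ ∧ ∀ w : Plane → ℂ, ContDiff ℝ ∞ w → HasCompactSupport w →
      ∫⁻ x, ‖w x‖ₑ ^ 4 ≤ C * energy w (fun j => pd j w) ^ 2 := by
  have conjugate : Real.HolderConjugate (Module.finrank ℝ Plane) 2 := by
    rw [finrank_euclideanSpace_fin]
    exact_mod_cast Real.HolderConjugate.two_two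
  refine ⟨lintegralPowLePowLIntegralFDerivConst (volume : Measure Plane) 2, ENNReal.coe_ne_top,
    fun w hw hc => ?_⟩
  have hw₁ : ContDiff ℝ 1 w := hw.of_le one_le_infty
  have enorm_mul_self_sq (x : Plane) : ‖w x * w x‖ₑ ^ (2 : ℝ) = ‖w x‖ₑ ^ 4 := by
    rw [enorm_mul, ← sq, ENNReal.rpow_ofNat, ← pow_mul]
  have sobolev := lintegral_pow_le_pow_lintegral_fderiv (volume : Measure Plane)
    (u := fun x => w x * w x) (hw₁.mul hw₁) hc.mul_right conjugate
  simp_rw [enorm_mul_self_sq, ENNReal.rpow_ofNat] at sobolev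
  refine sobolev.trans (mul_le_mul' le_rfl (pow_le_pow_left' ?_ 2))
  rw [energy_eq_lintegral hw.continuous.aestronglyMeasurable
    (contDiff_pd hw 0).continuous.aestronglyMeasurable]
  exact lintegral_mono fun x => enorm_fderiv_mul_self_le (hw₁.differentiable one_ne_zero x)

section potential

variable {B : Plane → ℝ} {v : Plane → ℂ} {E : Fin 2 → Plane → ℂ}

theorem exists_lintegral_mul_sq_le_energy_of_test (hB : MemLp B 2) :
    ∃ C : ℝ≥0∞, C ≠ ⊤ ∧ ∀ w : Plane → ℂ, ContDiff ℝ ∞ w → HasCompactSupport w →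
      ∫⁻ x, ‖B x‖ₑ * ‖w x‖ₑ ^ 2 ≤ C * energy w (fun j => pd j w) := by
  obtain ⟨C, hC, ladyzhenskaya⟩ := exists_lintegral_pow_four_le
  refine ⟨(l2sq B * C) ^ (1 / 2 : ℝ), ENNReal.rpow_ne_top_of_nonneg (by norm_num)
    (ENNReal.mul_ne_top (memLp_two_iff_l2sq.1 hB).2.ne hC), fun w hw hc => ?_⟩
  have sqrt_sq : ((l2sq B * C) ^ (1 / 2 : ℝ)) ^ 2 = l2sq B * C := by
    rw [← ENNReal.rpow_natCast, ← ENNReal.rpow_mul]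
    norm_num
  refine (ENNReal.pow_le_pow_left_iff two_ne_zero).1 ?_
  calc (∫⁻ x, ‖B x‖ₑ * ‖w x‖ₑ ^ 2) ^ 2
      ≤ (∫⁻ x, ‖B x‖ₑ ^ 2) * ∫⁻ x, (‖w x‖ₑ ^ 2) ^ 2 :=
        sq_lintegral_mul_le hB.1.enorm (hw.continuous.aestronglyMeasurable.enorm.pow_const 2)
    _ = (∫⁻ x, ‖B x‖ₑ ^ 2) * ∫⁻ x, ‖w x‖ₑ ^ 4 := by simp_rw [← pow_mul]
    _ ≤ (∫⁻ x, ‖B x‖ₑ ^ 2) * (C * energy w (fun j => pd j w) ^ 2) :=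
        mul_le_mul' le_rfl (ladyzhenskaya w hw hc)
    _ = _ := by rw [mul_pow, sqrt_sq, mul_assoc, l2sq]

theorem aestronglyMeasurable_pd {w : Plane → ℂ} (hw : ContDiff ℝ ∞ w) (j : Fin 2) :
    AEStronglyMeasurable (pd j w) := (contDiff_pd hw j).continuous.aestronglyMeasurable

/-- The energy of the error of the `n`-th approximation of an `H¹` function. -/
def approxError (v : Plane → ℂ) (E : Fin 2 → Plane → ℂ) (n : ℕ) : ℝ≥0∞ :=
  energy (fun x => approx v n x - v x) (fun j x => pd j (approx v n) x - E j x)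

theorem IsH1.tendsto_approxError (h : IsH1 v E) : Tendsto (approxError v E) atTop (nhds 0) := by
  have := (ENNReal.Tendsto.const_mul (a := 2) (tendsto_l2sq_approx_sub h.memLp)
    (Or.inr (by simp))).add (tendsto_finsetSum Finset.univ fun j _ =>
      h.tendsto_l2sq_pd_approx_sub j)
  simpa only [mul_zero, Finset.sum_const_zero, add_zero] using! this

theorem IsH1.energy_approx_sub_approx_le (h : IsH1 v E) (n m : ℕ) :
    energy (fun x => approx v n x - approx v m x)
      (fun j => pd j fun x => approx v n x - approx v m x) ≤
      2 * approxError v E n + 2 * approxError v E m := by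
  have smooth := contDiff_approx h.locallyIntegrable
  have pd_sub_approx : (fun j => pd j fun x => approx v n x - approx v m x) =
      fun j x => pd j (approx v n) x - pd j (approx v m) x := by
    funext j x
    exact pd_sub ((smooth n).differentiable (by simp)) ((smooth m).differentiable (by simp)) j x
  have triangle := energy_sub_le (v := fun x => approx v n x - v x)
    (w := fun x => approx v m x - v x) (E := fun j x => pd j (approx v n) x - E j x)
    (G := fun j x => pd j (approx v m) x - E j x)
    ((smooth n).continuous.aestronglyMeasurable.sub h.memLp.1)
    fun j => (aestronglyMeasurable_pd (smooth n) j).sub (h.memLp_deriv j).1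
  simpa only [approxError, pd_sub_approx, sub_sub_sub_cancel_right] using triangle

theorem memLp_approx (hv : LocallyIntegrable v) (n : ℕ) : MemLp (approx v n) 2 :=
  (contDiff_approx hv n).continuous.memLp_of_hasCompactSupport (hasCompactSupport_approx n)

theorem memLp_pd_approx (hv : LocallyIntegrable v) (j : Fin 2) (n : ℕ) :
    MemLp (pd j (approx v n)) 2 :=
  (contDiff_pd (contDiff_approx hv n) j).continuous.memLp_of_hasCompactSupport
    (hasCompactSupport_pd (hasCompactSupport_approx n) j)

/-- The square root of `|B|` times a function: the form domain of the potential `|B|`. -/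
def rootMul (B : Plane → ℝ) (v : Plane → ℂ) (x : Plane) : ℂ := (√|B x| : ℝ) * v x

theorem enorm_rootMul_sq (B : Plane → ℝ) (v : Plane → ℂ) (x : Plane) :
    ‖rootMul B v x‖ₑ ^ 2 = ‖B x‖ₑ * ‖v x‖ₑ ^ 2 := by
  rw [rootMul, enorm_mul, mul_pow]
  congr 1
  rw [← ofReal_norm, Complex.norm_real, Real.norm_of_nonneg (Real.sqrt_nonneg _),
    ← ENNReal.ofReal_pow (Real.sqrt_nonneg _), Real.sq_sqrt (abs_nonneg _), ← Real.norm_eq_abs,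
    ofReal_norm]

theorem norm_rootMul_sq (B : Plane → ℝ) (v : Plane → ℂ) (x : Plane) :
    ‖rootMul B v x‖ ^ 2 = |B x| * ‖v x‖ ^ 2 := by
  rw [rootMul, norm_mul, mul_pow, Complex.norm_real, Real.norm_of_nonneg (Real.sqrt_nonneg _),
    Real.sq_sqrt (abs_nonneg _)]

theorem aestronglyMeasurable_rootMul (hB : AEStronglyMeasurable B) (hv : AEStronglyMeasurable v) :
    AEStronglyMeasurable (rootMul B v) :=
  (Complex.continuous_ofReal.comp_aestronglyMeasurable
    ((Real.continuous_sqrt.comp continuous_abs).comp_aestronglyMeasurable hB)).mul hv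

theorem l2sq_rootMul_sub_rootMul (B : Plane → ℝ) (v w : Plane → ℂ) :
    l2sq (fun x => rootMul B v x - rootMul B w x) = ∫⁻ x, ‖B x‖ₑ * ‖v x - w x‖ₑ ^ 2 := by
  refine lintegral_congr fun x => ?_
  rw [← enorm_rootMul_sq B (fun x => v x - w x)]
  simp only [rootMul, mul_sub]

theorem IsH1.l2sq_rootMul_approx_sub_le (h : IsH1 v E) (hB : AEStronglyMeasurable B) {C : ℝ≥0∞}
    (hC : C ≠ ⊤) (hle : ∀ w : Plane → ℂ, ContDiff ℝ ∞ w → HasCompactSupport w →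
      ∫⁻ x, ‖B x‖ₑ * ‖w x‖ₑ ^ 2 ≤ C * energy w (fun j => pd j w)) (n : ℕ) :
    l2sq (fun x => rootMul B (approx v n) x - rootMul B v x) ≤ C * (2 * approxError v E n) := by
  have smooth := contDiff_approx h.locallyIntegrable
  have measurable (m : ℕ) : AEStronglyMeasurable (approx v m) :=
    (smooth m).continuous.aestronglyMeasurable
  have error_limit : Tendsto (fun m => C * (2 * approxError v E n + 2 * approxError v E m)) atTop
      (nhds (C * (2 * approxError v E n))) := by
    simpa using ENNReal.Tendsto.const_mul (a := C) (tendsto_const_nhds (x := 2 * approxError v E n)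
      |>.add (ENNReal.Tendsto.const_mul (a := 2) h.tendsto_approxError (Or.inr (by simp))))
      (Or.inr hC)
  rw [l2sq_rootMul_sub_rootMul]
  calc ∫⁻ x, ‖B x‖ₑ * ‖approx v n x - v x‖ₑ ^ 2
      ≤ ∫⁻ x, liminf (fun m => ‖B x‖ₑ * ‖approx v n x - approx v m x‖ₑ ^ 2) atTop := by
        refine lintegral_mono_ae ?_
        filter_upwards [ae_tendsto_approx h.locallyIntegrable] with x hx
        exact (ENNReal.Tendsto.const_mul (ENNReal.Tendsto.pow (hx.const_sub _).enorm)
          (Or.inr (by simp))).liminf_eq.ge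
    _ ≤ liminf (fun m => ∫⁻ x, ‖B x‖ₑ * ‖approx v n x - approx v m x‖ₑ ^ 2) atTop :=
        lintegral_liminf_le' fun m =>
          hB.enorm.mul (((measurable n).sub (measurable m)).enorm.pow_const 2)
    _ ≤ liminf (fun m => C * (2 * approxError v E n + 2 * approxError v E m)) atTop :=
        liminf_le_liminf (Eventually.of_forall fun m =>
          (hle _ ((smooth n).sub (smooth m))
            ((hasCompactSupport_approx n).sub (hasCompactSupport_approx m))).trans
            (mul_le_mul' le_rfl (h.energy_approx_sub_approx_le n m)))
    _ = _ := error_limit.liminf_eq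

theorem IsH1.tendsto_l2sq_rootMul_sub (h : IsH1 v E) (hB : MemLp B 2) :
    Tendsto (fun n => l2sq (fun x => rootMul B (approx v n) x - rootMul B v x)) atTop
      (nhds 0) := by
  obtain ⟨C, hC, hle⟩ := exists_lintegral_mul_sq_le_energy_of_test hB
  refine tendsto_of_tendsto_of_tendsto_of_le_of_le tendsto_const_nhds ?_ (fun _ => bot_le)
    (h.l2sq_rootMul_approx_sub_le hB.1 hC hle)
  simpa using ENNReal.Tendsto.const_mul (a := C)
    (ENNReal.Tendsto.const_mul (a := 2) h.tendsto_approxError (Or.inr (by simp))) (Or.inr hC)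

end potential

/-! ### The quadratic form on `H¹` -/

section form

variable {A : Plane → Plane} {B : Plane → ℝ} {v : Plane → ℂ} {E : Fin 2 → Plane → ℂ} {CA : ℝ}

/-- The component `(i ∂_j + A_j) v` of the magnetic gradient, where `E` is the weak gradient of
`v`. -/
def magneticDeriv (A : Plane → Plane) (v : Plane → ℂ) (E : Fin 2 → Plane → ℂ) (j : Fin 2)
    (x : Plane) : ℂ := Complex.I * E j x + (A x j : ℂ) * v x

theorem aestronglyMeasurable_ofReal_apply (hA : AEStronglyMeasurable A) (j : Fin 2) :
    AEStronglyMeasurable fun x => (A x j : ℂ) :=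
  (Complex.continuous_ofReal.comp
    (EuclideanSpace.proj j : Plane →L[ℝ] ℝ).continuous).comp_aestronglyMeasurable hA

theorem memLp_apply_mul (hA : AEStronglyMeasurable A) (hCA : ∀ᵐ x, ‖A x‖ ≤ CA) (hv : MemLp v 2)
    (j : Fin 2) : MemLp (fun x => (A x j : ℂ) * v x) 2 := by
  refine hv.of_le_mul (c := CA) ((aestronglyMeasurable_ofReal_apply hA j).mul hv.1) ?_
  filter_upwards [hCA] with x hx
  rw [norm_mul, Complex.norm_real]
  gcongr
  exact (PiLp.norm_apply_le (A x) j).trans hx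

theorem memLp_magneticDeriv (hA : AEStronglyMeasurable A) (hCA : ∀ᵐ x, ‖A x‖ ≤ CA)
    (hv : MemLp v 2) {j : Fin 2} (hE : MemLp (E j) 2) : MemLp (magneticDeriv A v E j) 2 :=
  (hE.const_mul Complex.I).add (memLp_apply_mul hA hCA hv j)

theorem integrable_mul_norm_sq_of_memLp_rootMul (hB : AEStronglyMeasurable B)
    (hv : AEStronglyMeasurable v) (h : MemLp (rootMul B v) 2) :
    Integrable fun x => B x * ‖v x‖ ^ 2 := by
  refine (h.integrable_norm_pow two_ne_zero).mono (hB.mul (hv.norm.pow 2))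
    (Eventually.of_forall fun x => ?_)
  rw [norm_rootMul_sq, norm_mul, norm_mul, Real.norm_eq_abs, Real.norm_eq_abs,
    Real.norm_eq_abs, abs_abs]

theorem integrable_norm_sq_magneticDeriv (hA : AEStronglyMeasurable A) (hCA : ∀ᵐ x, ‖A x‖ ≤ CA)
    (hv : MemLp v 2) {j : Fin 2} (hE : MemLp (E j) 2) :
    Integrable fun x => ‖magneticDeriv A v E j x‖ ^ 2 :=
  (memLp_magneticDeriv hA hCA hv hE).integrable_norm_pow two_ne_zero

theorem scalarDensity_eq (s : ℝ) (A : Plane → Plane) (B : Plane → ℝ) (v : Plane → ℂ)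
    (E : Fin 2 → Plane → ℂ) :
    scalarDensity s A B v E =
      fun x => (∑ j, ‖magneticDeriv A v E j x‖ ^ 2) + s * (B x * ‖v x‖ ^ 2) := by
  funext x
  simp only [scalarDensity, magneticDeriv, mul_assoc]

theorem integrable_scalarDensity_of_memLp (hA : AEStronglyMeasurable A)
    (hCA : ∀ᵐ x, ‖A x‖ ≤ CA) (hB : AEStronglyMeasurable B) (hv : MemLp v 2)
    (hE : ∀ j, MemLp (E j) 2) (hr : MemLp (rootMul B v) 2) (s : ℝ) :
    Integrable (scalarDensity s A B v E) := by
  rw [scalarDensity_eq]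
  exact (integrable_finsetSum Finset.univ fun j _ =>
    integrable_norm_sq_magneticDeriv hA hCA hv (hE j)).add
      ((integrable_mul_norm_sq_of_memLp_rootMul hB hv.1 hr).const_mul s)

theorem integral_scalarDensity_of_memLp (hA : AEStronglyMeasurable A)
    (hCA : ∀ᵐ x, ‖A x‖ ≤ CA) (hB : AEStronglyMeasurable B) (hv : MemLp v 2)
    (hE : ∀ j, MemLp (E j) 2) (hr : MemLp (rootMul B v) 2) (s : ℝ) :
    ∫ x, scalarDensity s A B v E x =
      (∑ j, ∫ x, ‖magneticDeriv A v E j x‖ ^ 2) + s * ∫ x, B x * ‖v x‖ ^ 2 := by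
  have kinetic (j : Fin 2) (_ : j ∈ Finset.univ) :
      Integrable fun x => ‖magneticDeriv A v E j x‖ ^ 2 :=
    integrable_norm_sq_magneticDeriv hA hCA hv (hE j)
  have potential := (integrable_mul_norm_sq_of_memLp_rootMul hB hv.1 hr).const_mul s
  rw [scalarDensity_eq, integral_add (integrable_finsetSum _ kinetic) potential,
    integral_finsetSum _ kinetic, integral_const_mul]

theorem memLp_rootMul_of_test (hB : MemLp B 2) {w : Plane → ℂ} (hw : ContDiff ℝ ∞ w)
    (hc : HasCompactSupport w) : MemLp (rootMul B w) 2 := by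
  obtain ⟨C, hC, hle⟩ := exists_lintegral_mul_sq_le_energy_of_test hB
  have l2sq_lt_top : l2sq w < ⊤ :=
    (memLp_two_iff_l2sq.1 (hw.continuous.memLp_of_hasCompactSupport hc)).2
  have l2sq_pd_lt_top (j : Fin 2) : l2sq (pd j w) < ⊤ :=
    (memLp_two_iff_l2sq.1 ((contDiff_pd hw j).continuous.memLp_of_hasCompactSupport
      (hasCompactSupport_pd hc j))).2
  refine memLp_two_iff_l2sq.2
    ⟨aestronglyMeasurable_rootMul hB.1 hw.continuous.aestronglyMeasurable, ?_⟩
  simp_rw [l2sq, enorm_rootMul_sq]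
  refine (hle w hw hc).trans_lt (ENNReal.mul_lt_top hC.lt_top ?_)
  exact ENNReal.add_lt_top.2 ⟨ENNReal.mul_lt_top (by simp) l2sq_lt_top,
    ENNReal.sum_lt_top.2 fun j _ => l2sq_pd_lt_top j⟩

theorem IsH1.memLp_rootMul (h : IsH1 v E) (hB : MemLp B 2) : MemLp (rootMul B v) 2 := by
  obtain ⟨n, hn⟩ := ((h.tendsto_l2sq_rootMul_sub hB).eventually (gt_mem_nhds zero_lt_one)).exists
  have memLp_approximation := memLp_rootMul_of_test hB (contDiff_approx h.locallyIntegrable n)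
    (hasCompactSupport_approx n)
  have memLp_error : MemLp (fun x => rootMul B (approx v n) x - rootMul B v x) 2 :=
    memLp_two_iff_l2sq.2 ⟨memLp_approximation.1.sub (aestronglyMeasurable_rootMul hB.1 h.memLp.1),
      hn.trans ENNReal.one_lt_top⟩
  exact (memLp_approximation.sub memLp_error).ae_eq
    (Eventually.of_forall fun _ => sub_sub_cancel ..)

theorem IsH1.integrable_scalarDensity (h : IsH1 v E) (hA : AEStronglyMeasurable A)
    (hCA : ∀ᵐ x, ‖A x‖ ≤ CA) (hB : MemLp B 2) (s : ℝ) : Integrable (scalarDensity s A B v E) :=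
  integrable_scalarDensity_of_memLp hA hCA hB.1 h.memLp h.memLp_deriv (h.memLp_rootMul hB) s

/-- The sign of a real number, with value one at zero; it recovers the potential `B` from `|B|`. -/
def signOne (t : ℝ) : ℝ := if 0 ≤ t then 1 else -1

theorem measurable_signOne : Measurable signOne :=
  Measurable.ite measurableSet_Ici measurable_const measurable_const

theorem abs_signOne (t : ℝ) : |signOne t| ≤ 1 := by
  rw [signOne]; split_ifs <;> simp

theorem signOne_mul_abs (t : ℝ) : signOne t * |t| = t := by
  rw [signOne]
  split_ifs with h
  · rw [abs_of_nonneg h, one_mul]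
  · rw [abs_of_neg (not_le.1 h)]; ring

theorem IsH1.tendsto_integral_mul_norm_sq (h : IsH1 v E) (hB : MemLp B 2) :
    Tendsto (fun n => ∫ x, B x * ‖approx v n x‖ ^ 2) atTop (nhds (∫ x, B x * ‖v x‖ ^ 2)) := by
  have hl := h.locallyIntegrable
  have mul_norm_sq (w : Plane → ℂ) (x : Plane) :
      B x * ‖w x‖ ^ 2 = signOne (B x) * ‖rootMul B w x‖ ^ 2 := by
    rw [norm_rootMul_sq, ← mul_assoc, signOne_mul_abs]
  simp_rw [fun n x => mul_norm_sq (approx v n) x, mul_norm_sq v]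
  exact PauliHardy.tendsto_integral_mul_norm_sq
    (measurable_signOne.comp_aemeasurable hB.1.aemeasurable).aestronglyMeasurable
    (fun x => abs_signOne (B x)) (h.memLp_rootMul hB)
    (fun n => memLp_rootMul_of_test hB (contDiff_approx hl n) (hasCompactSupport_approx n))
    (h.tendsto_l2sq_rootMul_sub hB)

theorem l2sq_magneticDeriv_sub_le (hCA : ∀ᵐ x, ‖A x‖ ≤ CA) {w : Plane → ℂ}
    {G : Fin 2 → Plane → ℂ} {j : Fin 2} (hE : AEStronglyMeasurable (E j))
    (hG : AEStronglyMeasurable (G j)) :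
    l2sq (fun x => magneticDeriv A v E j x - magneticDeriv A w G j x) ≤
      2 * l2sq (fun x => E j x - G j x) +
        2 * (ENNReal.ofReal CA ^ 2 * l2sq (fun x => v x - w x)) := by
  have difference : (fun x => magneticDeriv A v E j x - magneticDeriv A w G j x) = fun x =>
      Complex.I * (E j x - G j x) + (A x j : ℂ) * (v x - w x) := by
    funext x
    simp only [magneticDeriv]
    ring
  have gradient_error :
      l2sq (fun x => Complex.I * (E j x - G j x)) = l2sq (fun x => E j x - G j x) := by
    simp [l2sq, enorm_mul, ← ofReal_norm (Complex.I)]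
  have potential_error : l2sq (fun x => (A x j : ℂ) * (v x - w x)) ≤
      ENNReal.ofReal CA ^ 2 * l2sq (fun x => v x - w x) := by
    refine l2sq_le_mul ?_
    filter_upwards [hCA] with x hx
    rw [norm_mul, Complex.norm_real]
    gcongr
    exact (PiLp.norm_apply_le (A x) j).trans hx
  rw [difference]
  exact (l2sq_add_le ((hE.sub hG).const_mul _)).trans
    (add_le_add (mul_le_mul' le_rfl gradient_error.le) (mul_le_mul' le_rfl potential_error))

theorem IsH1.tendsto_l2sq_magneticDeriv_sub (h : IsH1 v E) (hCA : ∀ᵐ x, ‖A x‖ ≤ CA) (j : Fin 2) :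
    Tendsto (fun n => l2sq (fun x => magneticDeriv A (approx v n)
      (fun j => pd j (approx v n)) j x - magneticDeriv A v E j x)) atTop (nhds 0) := by
  refine tendsto_of_tendsto_of_tendsto_of_le_of_le tendsto_const_nhds ?_ (fun _ => bot_le)
    fun n => l2sq_magneticDeriv_sub_le hCA (memLp_pd_approx h.locallyIntegrable j n).1
      (h.memLp_deriv j).1
  simpa using (ENNReal.Tendsto.const_mul (a := 2) (h.tendsto_l2sq_pd_approx_sub j)
    (Or.inr (by simp))).add (ENNReal.Tendsto.const_mul (a := 2) (ENNReal.Tendsto.const_mul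
    (a := ENNReal.ofReal CA ^ 2) (tendsto_l2sq_approx_sub h.memLp) (Or.inr (by simp)))
    (Or.inr (by simp)))

theorem IsH1.tendsto_integral_norm_sq_magneticDeriv (h : IsH1 v E) (hA : AEStronglyMeasurable A)
    (hCA : ∀ᵐ x, ‖A x‖ ≤ CA) (j : Fin 2) :
    Tendsto (fun n => ∫ x, ‖magneticDeriv A (approx v n) (fun j => pd j (approx v n)) j x‖ ^ 2)
      atTop (nhds (∫ x, ‖magneticDeriv A v E j x‖ ^ 2)) := by
  have hv := h.locallyIntegrable
  simpa using PauliHardy.tendsto_integral_mul_norm_sq (b := fun _ => 1)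
    aestronglyMeasurable_const (M := 1) (by simp)
    (memLp_magneticDeriv hA hCA h.memLp (h.memLp_deriv j))
    (fun n => memLp_magneticDeriv (E := fun j => pd j (approx v n)) hA hCA (memLp_approx hv n)
      (memLp_pd_approx hv j n)) (h.tendsto_l2sq_magneticDeriv_sub hCA j)

theorem IsH1.tendsto_integral_scalarDensity (h : IsH1 v E) (hA : AEStronglyMeasurable A)
    (hCA : ∀ᵐ x, ‖A x‖ ≤ CA) (hB : MemLp B 2) (s : ℝ) :
    Tendsto (fun n => ∫ x, scalarDensity s A B (approx v n) (fun j => pd j (approx v n)) x) atTop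
      (nhds (∫ x, scalarDensity s A B v E x)) := by
  have hl := h.locallyIntegrable
  rw [integral_scalarDensity_of_memLp hA hCA hB.1 h.memLp h.memLp_deriv (h.memLp_rootMul hB)]
  simp_rw [fun n => integral_scalarDensity_of_memLp hA hCA hB.1 (memLp_approx hl n)
    (fun j => memLp_pd_approx hl j n)
    (memLp_rootMul_of_test hB (contDiff_approx hl n) (hasCompactSupport_approx n)) s]
  exact (tendsto_finsetSum _ fun j _ => h.tendsto_integral_norm_sq_magneticDeriv hA hCA j).add
    ((h.tendsto_integral_mul_norm_sq hB).const_mul s)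

theorem integral_formDensity_eq_integral_scalarDensity (hA : AEStronglyMeasurable A)
    (hCA : ∀ᵐ x, ‖A x‖ ≤ CA) (hB : MemLp B 2) (hAB : HasDistribCurl A B) {w : Plane → ℂ}
    (hw : ContDiff ℝ ∞ w) (hc : HasCompactSupport w) :
    ∫ x, formDensity A w x = ∫ x, scalarDensity 1 A B w (fun j => pd j w) x := by
  have memLp_w := hw.continuous.memLp_of_hasCompactSupport hc (μ := volume) (p := 2)
  have memLp_pd (j : Fin 2) := (contDiff_pd hw j).continuous.memLp_of_hasCompactSupport
    (hasCompactSupport_pd hc j) (μ := volume) (p := 2)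
  have kinetic (j : Fin 2) (_ : j ∈ Finset.univ) :
      Integrable fun x => ‖magneticDeriv A w (fun j => pd j w) j x‖ ^ 2 :=
    integrable_norm_sq_magneticDeriv (E := fun j => pd j w) hA hCA memLp_w (memLp_pd j)
  have weak_curl := hAB (fun y => ‖w y‖ ^ 2) ⟨hw.norm_sq ℝ, hasCompactSupport_norm_sq hc⟩
  rw [integral_scalarDensity_of_memLp hA hCA hB.1 memLp_w memLp_pd
    (memLp_rootMul_of_test hB hw hc), one_mul, ← integral_finsetSum _ kinetic, ← weak_curl,
    ← sub_eq_iff_eq_add',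
    ← integral_sub (integrable_formDensity hA hCA hw hc) (integrable_finsetSum _ kinetic)]
  refine integral_congr_ae (Eventually.of_forall fun x => ?_)
  simp only [formDensity, magneticDeriv, partialDeriv_eq_pd]
  ring

theorem IsH1.le_integral_scalarDensity (h : IsH1 v E) (hA : AEStronglyMeasurable A)
    (hCA : ∀ᵐ x, ‖A x‖ ≤ CA) (hB : MemLp B 2) (hAB : HasDistribCurl A B) {V : Plane → ℝ}
    (hV : AEStronglyMeasurable V) {M : ℝ} (hM : ∀ x, |V x| ≤ M)
    (htest : ∀ w : Plane → ℂ, ContDiff ℝ ∞ w → HasCompactSupport w →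
      ∫ x, V x * ‖w x‖ ^ 2 ≤ ∫ x, formDensity A w x) :
    ∫ x, V x * ‖v x‖ ^ 2 ≤ ∫ x, scalarDensity 1 A B v E x := by
  have hl := h.locallyIntegrable
  refine le_of_tendsto_of_tendsto' (PauliHardy.tendsto_integral_mul_norm_sq hV hM h.memLp
    (memLp_approx hl) (tendsto_l2sq_approx_sub h.memLp))
    (h.tendsto_integral_scalarDensity hA hCA hB 1) fun n => ?_
  rw [← integral_formDensity_eq_integral_scalarDensity hA hCA hB hAB (contDiff_approx hl n)
    (hasCompactSupport_approx n)]
  exact htest _ (contDiff_approx hl n) (hasCompactSupport_approx n)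

end form

/-! ### Components, and reversal of the magnetic field -/

section components

variable {F G : Type*} [NormedAddCommGroup F] [NormedSpace ℝ F] [CompleteSpace F]
  [NormedAddCommGroup G] [NormedSpace ℝ G] [CompleteSpace G]

theorem IsH1.clm_comp {u : Plane → F} {D : Fin 2 → Plane → F} (h : IsH1 u D) (L : F →L[ℝ] G) :
    IsH1 (fun x => L (u x)) (fun j x => L (D j x)) where
  memLp := L.comp_memLp' h.memLp
  memLp_deriv j := L.comp_memLp' (h.memLp_deriv j)
  weakDeriv j φ hφ := by
    have integrable_left : Integrable fun x => partialDeriv j φ x • u x :=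
      h.locallyIntegrable.integrable_smul_left_of_hasCompactSupport
        (contDiff_pd hφ.smooth j).continuous (hasCompactSupport_pd hφ.compact j)
    have integrable_right : Integrable fun x => φ x • D j x :=
      (h.locallyIntegrable_deriv j).integrable_smul_left_of_hasCompactSupport
        hφ.smooth.continuous hφ.compact
    simp_rw [← map_smul]
    rw [L.integral_comp_comm integrable_left, L.integral_comp_comm integrable_right,
      h.weakDeriv j φ hφ, map_neg]

end components

theorem IsH1.apply {u : Plane → Spinor} {D : Fin 2 → Plane → Spinor} (h : IsH1 u D) (i : Fin 2) :
    IsH1 (fun x => u x i) (fun j x => D j x i) :=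
  h.clm_comp ((EuclideanSpace.proj i : Spinor →L[ℂ] ℂ).restrictScalars ℝ)

theorem IsH1.conj {v : Plane → ℂ} {E : Fin 2 → Plane → ℂ} (h : IsH1 v E) :
    IsH1 (fun x => (starRingEnd ℂ) (v x)) (fun j x => (starRingEnd ℂ) (E j x)) :=
  h.clm_comp (Complex.conjCLE : ℂ →L[ℝ] ℂ)

theorem scalarDensity_neg_one (A : Plane → Plane) (B : Plane → ℝ) (v : Plane → ℂ)
    (E : Fin 2 → Plane → ℂ) :
    scalarDensity (-1) A B v E = scalarDensity 1 (fun x => -A x) (fun x => -B x)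
      (fun x => (starRingEnd ℂ) (v x)) (fun j x => (starRingEnd ℂ) (E j x)) := by
  funext x
  have norm_conj (j : Fin 2) :
      ‖Complex.I * (starRingEnd ℂ) (E j x) + ((-A x) j : ℂ) * (starRingEnd ℂ) (v x)‖ =
        ‖Complex.I * E j x + (A x j : ℂ) * v x‖ := by
    rw [← norm_neg, ← Complex.norm_conj]
    congr 1
    simp only [PiLp.neg_apply, Complex.ofReal_neg, map_neg, map_add, map_mul, Complex.conj_I,
      Complex.conj_conj, Complex.conj_ofReal]
    ring
  simp only [scalarDensity, norm_conj, Complex.norm_conj]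
  ring

theorem HasDistribCurl.neg {A : Plane → Plane} {B : Plane → ℝ} (h : HasDistribCurl A B) :
    HasDistribCurl (fun x => -A x) (fun x => -B x) := by
  intro φ hφ
  have negated := congrArg Neg.neg (h φ hφ)
  rw [← integral_neg, ← integral_neg] at negated
  refine Eq.trans (integral_congr_ae (Eventually.of_forall fun x => ?_))
    (negated.trans (integral_congr_ae (Eventually.of_forall fun x => ?_)))
  · simp only [PiLp.neg_apply]
    ring
  · simp only
    ring

theorem flux_neg (B : Plane → ℝ) : flux (fun x => -B x) = -flux B := by
  simp [flux, integral_neg]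

theorem superpotential_neg (B : Plane → ℝ) (x : Plane) :
    superpotential (fun x => -B x) x = -superpotential B x := by
  simp [superpotential, integral_neg]

theorem gMinus_eq_gPlus_neg {ρ : ℝ} (hρ : 0 < ρ) (α r : ℝ) :
    gMinus α ρ r = gPlus (-α) ρ r := by
  rw [gMinus, gPlus_eq_exp hρ, gPlus_eq_exp hρ, one_div, ← Real.exp_neg, neg_mul]

theorem ratioMinus_eq_ratioPlus_neg {ρ : ℝ} (hρ : 0 < ρ) (B : Plane → ℝ) :
    ratioMinus B ρ = ratioPlus (fun x => -B x) ρ := by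
  funext x
  rw [ratioMinus, ratioPlus, gMinus_eq_gPlus_neg hρ, flux_neg, superpotential_neg, neg_neg]

theorem distToInt_neg (α : ℝ) : distToInt (-α) = distToInt α := by
  rw [distToInt, distToInt, ← (Equiv.neg ℤ).iInf_comp]
  refine iInf_congr fun m => ?_
  rw [← abs_neg]
  simp only [Equiv.neg_apply, Int.cast_neg]
  congr 1
  ring

theorem hardyProfile_neg (α ρ r : ℝ) : hardyProfile (-α) ρ r = hardyProfile α ρ r := by
  have neg_int_iff : (∃ m : ℤ, (m : ℝ) = -α) ↔ ∃ m : ℤ, (m : ℝ) = α :=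
    ⟨fun ⟨m, hm⟩ => ⟨-m, by push_cast; linarith⟩, fun ⟨m, hm⟩ => ⟨-m, by push_cast; linarith⟩⟩
  unfold hardyProfile
  by_cases hα : ∃ m : ℤ, (m : ℝ) = α
  · rw [if_pos hα, if_pos (neg_int_iff.2 hα), abs_neg]
  · rw [if_neg hα, if_neg (neg_int_iff.not.2 hα), distToInt_neg]

theorem wMinus_eq_wPlus_neg {ρ : ℝ} (hρ : 0 < ρ) (B : Plane → ℝ) :
    wMinus B ρ = wPlus (fun x => -B x) ρ := by
  funext x
  rw [wMinus, wPlus, flux_neg, hardyProfile_neg, betaMinus, betaPlus, kMinus, bigKMinus, kPlus,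
    bigKPlus, ratioMinus_eq_ratioPlus_neg hρ]

/-! ### The Hardy inequality for the components -/

section hardy

variable {A : Plane → Plane} {B : Plane → ℝ} {v : Plane → ℂ} {E : Fin 2 → Plane → ℂ} {ρ : ℝ}

theorem IsAdmissibleField.bddAbove_range_ratioPlus (hB : IsAdmissibleField B) (hρ : 0 < ρ) :
    BddAbove (range (ratioPlus B ρ)) := by
  obtain ⟨c, C, -, h⟩ := hB.exists_ratioPlus_bounds hρ
  exact ⟨C, forall_mem_range.2 fun x => (h x).2⟩

theorem IsAdmissibleField.bddBelow_range_ratioPlus (hB : IsAdmissibleField B) (hρ : 0 < ρ) :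
    BddBelow (range (ratioPlus B ρ)) := by
  obtain ⟨c, C, -, h⟩ := hB.exists_ratioPlus_bounds hρ
  exact ⟨c, forall_mem_range.2 fun x => (h x).1⟩

theorem IsAdmissibleField.kPlus_pos (hB : IsAdmissibleField B) (hρ : 0 < ρ) : 0 < kPlus B ρ := by
  obtain ⟨c, C, hc, h⟩ := hB.exists_ratioPlus_bounds hρ
  exact hc.trans_le (le_ciInf fun x => (h x).1)

theorem IsAdmissibleField.bigKPlus_pos (hB : IsAdmissibleField B) (hρ : 0 < ρ) :
    0 < bigKPlus B ρ :=
  (hB.kPlus_pos hρ).trans_le ((ciInf_le (hB.bddBelow_range_ratioPlus hρ) 0).trans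
    (le_ciSup (hB.bddAbove_range_ratioPlus hρ) 0))

theorem abs_wPlus_le (B : Plane → ℝ) (hρ : 0 < ρ) (x : Plane) :
    |wPlus B ρ x| ≤ betaPlus B ρ * (1 / ρ ^ 2) := by
  rw [wPlus, betaPlus, abs_mul, abs_of_nonneg (sq_nonneg _), abs_of_nonneg (hardyProfile_nonneg ..)]
  gcongr
  exact hardyProfile_le hρ

theorem measurable_wPlus (B : Plane → ℝ) (ρ : ℝ) : Measurable (wPlus B ρ) :=
  ((measurable_hardyProfile _ ρ).comp measurable_norm).const_mul _

theorem integrable_wPlus_mul (B : Plane → ℝ) (hρ : 0 < ρ) (hv : MemLp v 2) :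
    Integrable fun x => wPlus B ρ x * ‖v x‖ ^ 2 :=
  (hv.integrable_norm_pow two_ne_zero).bdd_mul (c := betaPlus B ρ * (1 / ρ ^ 2))
    (measurable_wPlus B ρ).aestronglyMeasurable (Eventually.of_forall (abs_wPlus_le B hρ))

theorem exists_ae_norm_le_of_memLp_top {X F : Type*} [MeasurableSpace X] {μ : Measure X}
    [NormedAddCommGroup F] {f : X → F} (hf : MemLp f ∞ μ) : ∃ C, ∀ᵐ x ∂μ, ‖f x‖ ≤ C := by
  have eLpNorm_ne_top : eLpNormEssSup f μ ≠ ⊤ := eLpNorm_exponent_top (f := f) ▸ hf.2.ne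
  refine ⟨(eLpNormEssSup f μ).toReal, ?_⟩
  filter_upwards [ae_le_eLpNormEssSup (f := f) (μ := μ)] with x hx
  rw [← toReal_enorm]
  exact ENNReal.toReal_mono eLpNorm_ne_top hx

theorem IsH1.integrable_scalarDensity_of_memLp_top (h : IsH1 v E) (hB : IsAdmissibleField B)
    (hA : MemLp A ∞) (s : ℝ) : Integrable (scalarDensity s A B v E) := by
  obtain ⟨CA, hCA⟩ := exists_ae_norm_le_of_memLp_top hA
  exact h.integrable_scalarDensity hA.1 hCA hB.memLp_two s

theorem IsH1.integral_scalarDensity_nonneg (h : IsH1 v E) (hB : IsAdmissibleField B)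
    (hA : MemLp A ∞) (hAB : HasDistribCurl A B) : 0 ≤ ∫ x, scalarDensity 1 A B v E x := by
  obtain ⟨CA, hCA⟩ := exists_ae_norm_le_of_memLp_top hA
  have form_nonneg (w : Plane → ℂ) (hw : ContDiff ℝ ∞ w) (hc : HasCompactSupport w) :
      ∫ x, 0 * ‖w x‖ ^ 2 ≤ ∫ x, formDensity A w x := by
    rw [integral_formDensity hA.1 hCA hw hc]
    simpa using integral_nonneg fun x => sq_nonneg _
  simpa using h.le_integral_scalarDensity hA.1 hCA hB.memLp_two hAB (V := fun _ => 0)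
    aestronglyMeasurable_const (M := 0) (by simp) form_nonneg

theorem IsH1.integral_wPlus_le (h : IsH1 v E) (hB : IsAdmissibleField B) (hA : MemLp A ∞)
    (hAB : HasDistribCurl A B) (hρ : 0 < ρ) (hα : 0 ≤ flux B) :
    ∫ x, wPlus B ρ x * ‖v x‖ ^ 2 ≤ ∫ x, scalarDensity 1 A B v E x := by
  obtain ⟨CA, hCA⟩ := exists_ae_norm_le_of_memLp_top hA
  have kPlus_mul_le (x : Plane) :
      kPlus B ρ * gPlus (flux B) ρ ‖x‖ ≤ Real.exp (-superpotential B x) :=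
    (le_div_iff₀ (gPlus_pos hρ _ _)).1 (ciInf_le (hB.bddBelow_range_ratioPlus hρ) x)
  have le_bigKPlus_mul (x : Plane) :
      Real.exp (-superpotential B x) ≤ bigKPlus B ρ * gPlus (flux B) ρ ‖x‖ :=
    (div_le_iff₀ (gPlus_pos hρ _ _)).1 (le_ciSup (hB.bddAbove_range_ratioPlus hρ) x)
  refine h.le_integral_scalarDensity hA.1 hCA hB.memLp_two hAB
    (measurable_wPlus B ρ).aestronglyMeasurable (abs_wPlus_le B hρ) fun w hw hc => ?_
  have hardy := hardy_test hB (hA.locallyIntegrable le_top) hCA hAB hρ hα (hB.kPlus_pos hρ)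
    (hB.bigKPlus_pos hρ) kPlus_mul_le le_bigKPlus_mul hw hc
  rw [← integral_const_mul] at hardy
  simpa only [wPlus, betaPlus, mul_assoc] using hardy

theorem conj_mul_ofReal_mul_re (z : ℂ) (a : ℝ) :
    ((starRingEnd ℂ) z * a * z).re = a * ‖z‖ ^ 2 := by
  rw [mul_right_comm, Complex.conj_mul', ← Complex.ofReal_pow, ← Complex.ofReal_mul,
    Complex.ofReal_re, mul_comm]

theorem weightDensity_up (f : Plane → ℝ) (u : Plane → Spinor) :
    weightDensity (fun x => !![f x, 0; 0, 0]) u = fun x => f x * ‖u x 0‖ ^ 2 := by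
  funext x
  rw [← conj_mul_ofReal_mul_re]
  simp only [weightDensity, Fin.sum_univ_two, Matrix.of_apply, Matrix.cons_val_zero,
    Matrix.cons_val_one, Matrix.cons_val', Matrix.cons_val_fin_one, Complex.ofReal_zero, mul_zero,
    zero_mul, add_zero]

theorem weightDensity_down (f : Plane → ℝ) (u : Plane → Spinor) :
    weightDensity (fun x => !![0, 0; 0, f x]) u = fun x => f x * ‖u x 1‖ ^ 2 := by
  funext x
  rw [← conj_mul_ofReal_mul_re]
  simp only [weightDensity, Fin.sum_univ_two, Matrix.of_apply, Matrix.cons_val_zero,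
    Matrix.cons_val_one, Matrix.cons_val', Matrix.cons_val_fin_one, Complex.ofReal_zero, mul_zero,
    zero_mul, add_zero, zero_add]

theorem pauliGE_wPlus (hB : IsAdmissibleField B) (hA : MemLp A ∞) (hAB : HasDistribCurl A B)
    (hρ : 0 < ρ) (hα : 0 ≤ flux B) : PauliGE A B (fun x => !![wPlus B ρ x, 0; 0, 0]) := by
  intro u D h
  have integrable_up := (h.apply 0).integrable_scalarDensity_of_memLp_top hB hA 1
  have integrable_down := (h.apply 1).integrable_scalarDensity_of_memLp_top hB hA (-1)
  have up_ge := (h.apply 0).integral_wPlus_le hB hA hAB hρ hα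
  have down_nonneg := (h.apply 1).conj.integral_scalarDensity_nonneg (A := fun x => -A x)
    hB.neg hA.neg hAB.neg
  rw [← scalarDensity_neg_one] at down_nonneg
  rw [weightDensity_up]
  refine ⟨integrable_up.add integrable_down, integrable_wPlus_mul B hρ (h.apply 0).memLp, ?_⟩
  exact (le_add_of_le_of_nonneg up_ge down_nonneg).trans_eq
    (integral_add integrable_up integrable_down).symm

theorem pauliGE_wMinus (hB : IsAdmissibleField B) (hA : MemLp A ∞) (hAB : HasDistribCurl A B)
    (hρ : 0 < ρ) (hα : flux B ≤ 0) : PauliGE A B (fun x => !![0, 0; 0, wMinus B ρ x]) := by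
  intro u D h
  have integrable_up := (h.apply 0).integrable_scalarDensity_of_memLp_top hB hA 1
  have integrable_down := (h.apply 1).integrable_scalarDensity_of_memLp_top hB hA (-1)
  have up_nonneg := (h.apply 0).integral_scalarDensity_nonneg hB hA hAB
  have down_ge := (h.apply 1).conj.integral_wPlus_le (A := fun x => -A x) hB.neg hA.neg hAB.neg
    hρ (by rw [flux_neg]; exact neg_nonneg.2 hα)
  rw [← scalarDensity_neg_one] at down_ge
  simp_rw [Complex.norm_conj] at down_ge
  rw [weightDensity_down, wMinus_eq_wPlus_neg hρ]
  refine ⟨integrable_up.add integrable_down, integrable_wPlus_mul _ hρ (h.apply 1).memLp, ?_⟩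
  exact (le_add_of_nonneg_of_le up_nonneg down_ge).trans_eq
    (integral_add integrable_up integrable_down).symm

end hardy

end PauliHardy

end

theorem corollary2p6 (B : PauliHardy.Plane → ℝ) (hB : PauliHardy.IsAdmissibleField B)
    (A : PauliHardy.Plane → PauliHardy.Plane) (hA : MemLp A ∞ volume)
    (hAB : PauliHardy.HasDistribCurl A B) :
    -- the flux and the superpotential are given by convergent integrals
    Integrable B ∧
    (∀ x, Integrable (fun y => B y * Real.log ‖x - y‖)) ∧
    ∀ ρ : ℝ, 0 < ρ →
      -- the constants entering the weights are positive and finite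
      (0 < PauliHardy.kPlus B ρ ∧ BddAbove (range (PauliHardy.ratioPlus B ρ))) ∧
      (0 < PauliHardy.kMinus B ρ ∧ BddAbove (range (PauliHardy.ratioMinus B ρ))) ∧
      -- the Hardy inequality
      (0 ≤ PauliHardy.flux B →
        PauliHardy.PauliGE A B (fun x => !![PauliHardy.wPlus B ρ x, 0; 0, 0])) ∧
      (PauliHardy.flux B ≤ 0 →
        PauliHardy.PauliGE A B (fun x => !![0, 0; 0, PauliHardy.wMinus B ρ x])) := by
  refine ⟨hB.integrable, hB.integrable_mul_log, fun ρ hρ =>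
    ⟨⟨hB.kPlus_pos hρ, hB.bddAbove_range_ratioPlus hρ⟩, ?_,
      PauliHardy.pauliGE_wPlus hB hA hAB hρ, PauliHardy.pauliGE_wMinus hB hA hAB hρ⟩⟩
  rw [PauliHardy.kMinus, PauliHardy.ratioMinus_eq_ratioPlus_neg hρ]
  exact ⟨hB.neg.kPlus_pos hρ, hB.neg.bddAbove_range_ratioPlus hρ⟩
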